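/- Let $\mathfrak{sl}_2[t]=\mathfrak{sl}_2(\mathbb C)\otimes\mathbb C[t]$ with bracket $[a\otimes t^r,b\otimes t^s]=[a,b]\otimes t^{r+s}$, and let $x,y,h$ be the standard basis of $\mathfrak{sl}_2$. For $n\in\mathbb Z_{\ge 0}$ let the global Weyl module $W(n)$ be the $\mathfrak{sl}_2[t]$-module generated by $w_n$ with relations $(x\otimes\mathbb C[t])w_n=0$, $(h\otimes 1)w_n=n\,w_n$, $(y\otimes 1)^{n+1}w_n=0$, $\mathbb Z$-graded by powers of $t$ with $w_n$ in grade $0$; for $p\in\mathbb Z$ let $W(n,p)$ be $W(n)$ with the grading shifted so that $w_n$ has grade $p$. Let $\mathcal I_{\mathrm{bdd}}$ be the category of $\mathbb Z$-graded $\mathfrak{sl}_2[t]$-modules $V=\bigoplus_r V[r]$ with $V[r]=0$ for $r\ll 0$, $\dim V[r]<\infty$ for all $r$, and only finitely many nonzero weight spaces $V_\mu=\{v: (h\otimes 1)v=\mu v\}$, with morphisms of degree zero. The graded character of such a $V$ is the function $\mathrm{ch}_{\mathrm{gr}}V:\mu\mapsto\sum_r\dim (V[r]\cap V_\mu)\,u^r$.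 A global Weyl filtration of $M$ is a finite decreasing chain of graded submodules $M=M^0\supseteq M^1\supseteq\cdots\supseteq M^k\supseteq M^{k+1}=0$ such that for every $0\le s\le k$ there are $\lambda_s\in\mathbb Z_{\ge 0}$ and $m_{s,p}\in\mathbb Z_{\ge 0}$ $(p\in\mathbb Z)$ with $M^s/M^{s+1}\cong\bigoplus_{p\in\mathbb Z}W(\lambda_s,p)^{\oplus m_{s,p}}$ as graded modules; the multiplicity of $W(n)$ in it is the formal series $\sum_{p\in\mathbb Z}\big(\sum_{s:\lambda_s=n}m_{s,p}\big)u^p$. Put $$(1:u)_n=\frac1{(1-u)(1-u^2)\cdots(1-u^n)},\qquad \begin{bmatrix}n\\ s\end{bmatrix}=\frac{(1-u^n)\cdots(1-u^{n-s+1})}{(1-u)\cdots(1-u^s)},$$ with $\begin{bmatrix}n\\ 0\end{bmatrix}=1$ and $\begin{bmatrix}n\\ s\end{bmatrix}=0$ for $s<0$. **Proposition.** Let $\lambda,\mu\in\mathbb Z_{\ge 0}$. The module $W(\lambda)\otimes W(\mu)$ is an object of $\mathcal I_{\mathrm{bdd}}$ and has a global Weyl filtration. In every global Weyl filtration of it,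 for each $\nu\in\mathbb Z_{\ge 0}$ with $2\nu\le\lambda+\mu$, the multiplicity of $W(\lambda+\mu-2\nu)$ is $$\begin{bmatrix}\lambda+\mu-2\nu\\ \mu-\nu\end{bmatrix}(1:u)_\nu ,$$ and $W(n)$ has multiplicity $0$ if $n$ is not of the form $\lambda+\mu-2\nu$ with $\nu\in\mathbb Z_{\ge0}$. Moreover (equivalently), $$\mathrm{ch}_{\mathrm{gr}}\big(W(\lambda)\otimes W(\mu)\big)=\sum_{\nu=0}^{\min\{\lambda,\mu\}}\begin{bmatrix}\lambda+\mu-2\nu\\ \mu-\nu\end{bmatrix}(1:u)_\nu\ \mathrm{ch}_{\mathrm{gr}}W(\lambda+\mu-2\nu).$$ -/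

import Mathlib

open scoped TensorProduct DirectSum Polynomial PowerSeries LaurentSeries

noncomputable section

namespace CurrentSl2

/-! ### The elements `(1:u)_n` and the `q`-binomial coefficients -/

/-- `(1:u)_n = 1 / ((1-u)(1-u^2)⋯(1-u^n))`, as a formal power series in `u`. -/
def oneU (n : ℕ) : ℤ⟦X⟧ :=
  PowerSeries.invOfUnit (∏ i ∈ Finset.range n, (1 - (PowerSeries.X : ℤ⟦X⟧) ^ (i + 1))) 1

/-- `oneU n` is the inverse of `(1-u)(1-u^2)⋯(1-u^n)`. -/
theorem prod_mul_oneU (n : ℕ) :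
    (∏ i ∈ Finset.range n, (1 - (PowerSeries.X : ℤ⟦X⟧) ^ (i + 1))) * oneU n = 1 := by
  apply PowerSeries.mul_invOfUnit
  simp [map_prod]

/-- The `q`-binomial `[n choose s] = (1-u^n)⋯(1-u^(n-s+1)) / ((1-u)⋯(1-u^s))`, with value `0` for
`s < 0` and `1` for `s = 0`.  If `s > n`, the factor `1 - u^0 = 0` occurs in the numerator. -/
def qBinom (n : ℕ) (s : ℤ) : ℤ⟦X⟧ :=
  if s < 0 then 0
  else (∏ i ∈ Finset.range s.toNat, (1 - (PowerSeries.X : ℤ⟦X⟧) ^ (n - i))) * oneU s.toNat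

/-! ### The Lie algebra `sl₂[t]` -/

/-- The Lie algebra of complex `2 × 2` matrices of trace zero. -/
abbrev Sl2 : Type := LieAlgebra.SpecialLinear.sl (Fin 2) ℂ

/-- The current algebra `sl₂[t]`, written with the polynomial factor on the left; the bracket is
`[t^r ⊗ a, t^s ⊗ b] = t^(r+s) ⊗ [a, b]`. -/
abbrev Sl2t : Type := ℂ[X] ⊗[ℂ] Sl2

/-- The element `a ⊗ t^r` of `sl₂[t]`. -/
def cur (a : Sl2) (r : ℕ) : Sl2t := (Polynomial.X ^ r : ℂ[X]) ⊗ₜ[ℂ] a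

theorem cur_lie_cur (a b : Sl2) (r s : ℕ) : ⁅cur a r, cur b s⁆ = cur ⁅a, b⁆ (r + s) := by
  simp [cur, pow_add]

/-- The standard basis element `x` of `sl₂`. -/
def sl2X : Sl2 := ⟨!![0, 1; 0, 0], by
  change Matrix.trace (_ : Matrix (Fin 2) (Fin 2) ℂ) = 0
  simp [Matrix.trace_fin_two]⟩

/-- The standard basis element `y` of `sl₂`. -/
def sl2Y : Sl2 := ⟨!![0, 0; 1, 0], by
  change Matrix.trace (_ : Matrix (Fin 2) (Fin 2) ℂ) = 0
  simp [Matrix.trace_fin_two]⟩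

/-- The standard basis element `h` of `sl₂`. -/
def sl2H : Sl2 := ⟨!![1, 0; 0, -1], by
  change Matrix.trace (_ : Matrix (Fin 2) (Fin 2) ℂ) = 0
  simp [Matrix.trace_fin_two]⟩

/-! ### Graded representations -/

section Graded

variable {V W : Type} [AddCommGroup V] [Module ℂ V] [LieRingModule Sl2t V] [LieModule ℂ Sl2t V]
  [AddCommGroup W] [Module ℂ W] [LieRingModule Sl2t W] [LieModule ℂ Sl2t W]

/-- The weight space `V_μ = {v | h v = μ v}`. -/
def wtSpace (V : Type) [AddCommGroup V] [Module ℂ V] [LieRingModule Sl2t V]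
    [LieModule ℂ Sl2t V] (μ : ℤ) : Submodule ℂ V where
  carrier := {v | ⁅cur sl2H 0, v⁆ = (μ : ℂ) • v}
  add_mem' := by
    intro a b ha hb
    simp only [Set.mem_ofPred_eq] at ha hb ⊢
    rw [lie_add, ha, hb, smul_add]
  zero_mem' := by simp
  smul_mem' := by
    intro c v hv
    simp only [Set.mem_ofPred_eq] at hv ⊢
    rw [lie_smul, hv, smul_comm]

/-- The subspaces `𝒱 r = V[r]` make the `sl₂[t]`-module `V` a `ℤ`-graded representation. -/
structure IsGradedRep (𝒱 : ℤ → Submodule ℂ V) : Prop where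
  isInternal : DirectSum.IsInternal 𝒱
  lie_mem : ∀ (a : Sl2) (r : ℕ) (s : ℤ), ∀ v ∈ 𝒱 s, ⁅cur a r, v⁆ ∈ 𝒱 (r + s)

/-- `V` with the grading `𝒱` is an object of the category `I_bdd`. -/
structure IsIbdd (𝒱 : ℤ → Submodule ℂ V) : Prop extends IsGradedRep 𝒱 where
  bddBelow : ∃ b : ℤ, ∀ p < b, 𝒱 p = ⊥
  finiteDimensional : ∀ p, FiniteDimensional ℂ (𝒱 p)
  finite_weights : {μ : ℤ | wtSpace V μ ≠ ⊥}.Finite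

/-- The graded character of `V`, as a function sending a weight `μ` to the Laurent series
`∑_r dim V[r]_μ u^r` (a Laurent series for every object of `I_bdd`; by convention it is `0` if
infinitely many negative powers of `u` occur). -/
def chGr (𝒱 : ℤ → Submodule ℂ V) (μ : ℤ) : ℤ⸨X⸩ :=
  open Classical in
  if hb : BddBelow (Function.support
      fun r : ℤ => (Module.finrank ℂ ↥(𝒱 r ⊓ wtSpace V μ) : ℤ)) then
    HahnSeries.ofSuppBddBelow (fun r : ℤ => (Module.finrank ℂ ↥(𝒱 r ⊓ wtSpace V μ) : ℤ)) hb
  else 0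

/-- The grading of the grade shift `τ_s^* V`, i.e. `(τ_s^* V)[r] = V[r - s]`. -/
def shift (s : ℤ) (𝒱 : ℤ → Submodule ℂ V) (r : ℤ) : Submodule ℂ V := 𝒱 (r - s)

/-- The grading of a tensor product, `(V ⊗ W)[r] = ⨁_k V[k] ⊗ W[r - k]`. -/
def tensorGrading (𝒱 : ℤ → Submodule ℂ V) (𝒲 : ℤ → Submodule ℂ W) (r : ℤ) :
    Submodule ℂ (V ⊗[ℂ] W) :=
  ⨆ k : ℤ, Submodule.map₂ (TensorProduct.mk ℂ V W) (𝒱 k) (𝒲 (r - k))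

/-- The grading of a direct sum: an element has degree `r` iff all its components do. -/
def directSumGrading {ι : Type} {M : ι → Type} [∀ i, AddCommGroup (M i)] [∀ i, Module ℂ (M i)]
    (𝒢 : ∀ i, ℤ → Submodule ℂ (M i)) (r : ℤ) : Submodule ℂ (⨁ i, M i) :=
  ⨅ i, (𝒢 i r).comap (DirectSum.component ℂ ι M i)

/-- A submodule is graded if it is spanned by its homogeneous elements. -/
def IsGradedSub (𝒱 : ℤ → Submodule ℂ V) (N : LieSubmodule ℂ Sl2t V) : Prop :=
  N.toSubmodule = ⨆ r : ℤ, N.toSubmodule ⊓ 𝒱 r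

/-- The subquotient `N / (N ∩ N')`; it is `N / N'` when `N' ⊆ N`. -/
abbrev SubQuot (N N' : LieSubmodule ℂ Sl2t V) : Type := ↥N ⧸ (N'.comap N.incl)

/-- The grading induced on a subquotient. -/
def subQuotGrading (𝒱 : ℤ → Submodule ℂ V) (N N' : LieSubmodule ℂ Sl2t V) (r : ℤ) :
    Submodule ℂ (SubQuot N N') :=
  ((𝒱 r).comap N.toSubmodule.subtype).map
    (LieSubmodule.Quotient.mk' (N'.comap N.incl) : ↥N →ₗ[ℂ] SubQuot N N')

/-- Isomorphism of graded representations: an isomorphism of `sl₂[t]`-modules of degree zero. -/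
def GradedIso (𝒱 : ℤ → Submodule ℂ V) (𝒲 : ℤ → Submodule ℂ W) : Prop :=
  ∃ e : V ≃ₗ⁅ℂ, Sl2t⁆ W, ∀ (r : ℤ) (v : V), v ∈ 𝒱 r ↔ e v ∈ 𝒲 r

end Graded

/-! ### Global Weyl modules -/

attribute [local instance 100] LieRing.ofAssociativeRing

/-- The universal enveloping algebra of `sl₂[t]`. -/
abbrev U : Type := UniversalEnvelopingAlgebra ℂ Sl2t

/-- The element `a ⊗ t^r` in the enveloping algebra. -/
def curU (a : Sl2) (r : ℕ) : U := UniversalEnvelopingAlgebra.ι ℂ (cur a r)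

/-- The graded piece `U[k]`, spanned by the monomials `(a₁ ⊗ t^r₁)⋯(a_s ⊗ t^r_s)` with
`r₁ + ⋯ + r_s = k`. -/
def gradeU (k : ℤ) : Submodule ℂ U :=
  Submodule.span ℂ {z | ∃ l : List (Sl2 × ℕ),
    ((l.map Prod.snd).sum : ℤ) = k ∧ z = (l.map fun p => curU p.1 p.2).prod}

/-- The left ideal of `U` generated by the defining relations of `W(n)`:
`x ⊗ t^r` for all `r`, `h ⊗ 1 - n`, and `(y ⊗ 1)^(n+1)`. -/
def weylIdeal (n : ℕ) : Submodule U U :=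
  Submodule.span U (Set.range (curU sl2X) ∪ {curU sl2H 0 - (n : U), curU sl2Y 0 ^ (n + 1)})

/-- The global Weyl module `W(n)`: the `sl₂[t]`-module generated by `w_n` with relations
`(x ⊗ ℂ[t]) w_n = 0`, `(h ⊗ 1) w_n = n w_n`, `(y ⊗ 1)^(n+1) w_n = 0`. -/
def Weyl (n : ℕ) : Type := U ⧸ weylIdeal n

instance (n : ℕ) : AddCommGroup (Weyl n) := inferInstanceAs (AddCommGroup (U ⧸ weylIdeal n))

instance (n : ℕ) : Module U (Weyl n) := inferInstanceAs (Module U (U ⧸ weylIdeal n))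

instance (n : ℕ) : Module ℂ (Weyl n) := inferInstanceAs (Module ℂ (U ⧸ weylIdeal n))

instance (n : ℕ) : IsScalarTower ℂ U (Weyl n) :=
  inferInstanceAs (IsScalarTower ℂ U (U ⧸ weylIdeal n))

instance (n : ℕ) : LieRingModule Sl2t (Weyl n) where
  bracket a v := (UniversalEnvelopingAlgebra.ι ℂ a : U) • v
  add_lie a b v := by
    change (UniversalEnvelopingAlgebra.ι ℂ (a + b) : U) • v = _
    rw [map_add, add_smul]
  lie_add a v w := smul_add _ _ _
  leibniz_lie a b v := by
    change (UniversalEnvelopingAlgebra.ι ℂ a : U) • (UniversalEnvelopingAlgebra.ι ℂ b : U) • v =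
      (UniversalEnvelopingAlgebra.ι ℂ ⁅a, b⁆ : U) • v +
      (UniversalEnvelopingAlgebra.ι ℂ b : U) • (UniversalEnvelopingAlgebra.ι ℂ a : U) • v
    rw [LieHom.map_lie, LieRing.of_associative_ring_bracket, sub_smul, mul_smul, mul_smul,
      sub_add_cancel]

theorem lie_weyl (n : ℕ) (a : Sl2t) (v : Weyl n) :
    ⁅a, v⁆ = (UniversalEnvelopingAlgebra.ι ℂ a : U) • v := rfl

instance (n : ℕ) : LieModule ℂ Sl2t (Weyl n) where
  smul_lie c a v := by
    rw [lie_weyl, lie_weyl, map_smul, smul_assoc]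
  lie_smul c a v := by
    rw [lie_weyl, lie_weyl]
    exact smul_algebra_smul_comm _ _ _

/-- The generator `w_n` of `W(n)`. -/
def weylGen (n : ℕ) : Weyl n := (weylIdeal n).mkQ 1

/-- The grading of `W(n)` for which `w_n` has grade zero: `W(n)[r] = U[r] w_n`. -/
def weylGrading (n : ℕ) (r : ℤ) : Submodule ℂ (Weyl n) :=
  (gradeU r).map ((LinearMap.toSpanSingleton U (Weyl n) (weylGen n)).restrictScalars ℂ)

/-! ### Filtrations by global Weyl modules -/

/-- A filtration `V = V⁰ ⊇ V¹ ⊇ ⋯ ⊇ Vᵏ ⊇ Vᵏ⁺¹ = 0` by graded submodules with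
`Vˢ / Vˢ⁺¹ ≅ ⨁_p W(λ_s, p)^(m_{s,p})` for `0 ≤ s ≤ k`, where `W(n, p) = τ_p^* W(n)`. -/
structure WeylFiltration {V : Type} [AddCommGroup V] [Module ℂ V] [LieRingModule Sl2t V]
    [LieModule ℂ Sl2t V] (𝒱 : ℤ → Submodule ℂ V) where
  /-- The length `k`. -/
  k : ℕ
  /-- The submodules `V⁰, …, Vᵏ⁺¹`. -/
  N : Fin (k + 2) → LieSubmodule ℂ Sl2t V
  /-- The weights `λ_s`. -/
  wt : Fin (k + 1) → ℕ
  /-- The multiplicities `m_{s,p}`. -/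
  m : Fin (k + 1) → ℤ → ℕ
  graded : ∀ s, IsGradedSub 𝒱 (N s)
  antitone : Antitone N
  first : N 0 = ⊤
  last : N (Fin.last (k + 1)) = ⊥
  iso : ∀ s : Fin (k + 1),
    GradedIso (subQuotGrading 𝒱 (N s.castSucc) (N s.succ))
      (directSumGrading (fun i : (Σ p : ℤ, Fin (m s p)) => shift i.1 (weylGrading (wt s))))

/-- The multiplicity of `W(n, p)` in a filtration by global Weyl modules.  The multiplicity of
`W(n)` is the formal series in `u` whose coefficient at `u^p` is this number. -/
def WeylFiltration.mult {V : Type} [AddCommGroup V] [Module ℂ V] [LieRingModule Sl2t V]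
    [LieModule ℂ Sl2t V] {𝒱 : ℤ → Submodule ℂ V} (F : WeylFiltration 𝒱) (n : ℕ) (p : ℤ) : ℕ :=
  ∑ s : Fin (F.k + 1), if F.wt s = n then F.m s p else 0

end CurrentSl2

end

open CurrentSl2

/-!
The polynomial ring `ℂ[e_i ⊗ t^s]` on `ℂ² ⊗ ℂ[t]` is a module over `sl₂[t]`, and `W(n)` is its
subspace of polynomials of degree `n`. To see this, let `ρ(r)` be the endomorphism of `W(n)` sending
`w_n` to `(h ⊗ t^r) w_n`. It commutes with `sl₂[t]`, and the operators `δ(r)`, one half of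
`ρ(r+1) - h ⊗ t^(r+1)`, shift the operators `y ⊗ t^s` and kill `w_n`. Garland's relations
(`coeff_y_pow_lam`) then bound `W(n)` from above by vectors with the generating function
`∑_k (1:u)_k (1:u)_(n-k)`, which is also that of the polynomials of degree `n`
(`toModel_injective`). So `W(n)` has a homogeneous basis of weight vectors (`isGradedBasis_weyl`).

In `W(a) ⊗ W(b)` consider the weight `a + b - 2j`. Modulo the image of the operators `y ⊗ t^r` the
operators `y` can be moved from one factor to the other, so the weight space is generated there by
the single vector `w_a ⊗ (y ⊗ 1)^j w_b` under a commutative algebra of operators. Modulo also the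
image of the `h ⊗ t^r` with `r > 0`, the actions of this algebra on the two factors are given by two
power series with product one; Garland's relations make both of them polynomials, of degrees at most
`a - j` and `b - j`. The polynomials in the coefficients of such a series are spanned by the
monomials given by partitions in an `(a - j) × (b - j)` box (`span_boxMono`), whose generating
function is a `q`-binomial coefficient. Together with the monomials of degree `j` in the `y ⊗ t^s`,
counted by `(1:u)_j`, this gives generators (`tGens`) with the generating function predicted for the
multiplicity of `W(a + b - 2j)`; by Nakayama's lemma they generate the weight space
(`wtSpace_le_genSub_of_le`).

Let `N_j` be the submodule generated by the generators of index less than `j`. Those of index `j`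
are killed by the `x ⊗ t^r` modulo `N_j`, as `N_j` contains the weight spaces of larger weight.
Hence `N_(j+1) / N_j` is a quotient of a direct sum of shifted copies of `W(a + b - 2j)`. The
linearization formula for Rogers–Szegő polynomials (`rsPoly_mul_rsPoly`), evaluated at one, says
that these direct sums together are just as large as `W(a) ⊗ W(b)`. So all the quotient maps are
isomorphisms (`IsWeylGenerating.exists_weylFiltration`). The coefficients of the same formula give
the character of the tensor product (`chGr_tensor`). The multiplicities in any filtration are
determined by the character, because `n` is the highest weight of `W(n)` and its weight space has
the non-zero character `(1:u)_n` (`WeylFiltration.multSer_eq`).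
-/

noncomputable section

namespace CurrentSl2

/-! ### Counting by degree -/

/-- The generating function `∑ u^(deg i)` of a set with a degree function.  A degree with infinitely
many elements contributes `0`. -/
def genFun {ι : Type*} (d : ι → ℕ) : ℤ⟦X⟧ :=
  PowerSeries.mk fun n => (Nat.card {i // d i = n} : ℤ)

/-- All fibres of the degree function are finite. -/
def FinFib {ι : Type*} (d : ι → ℕ) : Prop := ∀ n, Finite {i // d i = n}

theorem FinFib.of_finite {ι : Type*} [Finite ι] (d : ι → ℕ) : FinFib d :=
  fun _ => Subtype.finite

theorem FinFib.congr {ι κ : Type*} {d : ι → ℕ} {d' : κ → ℕ} (e : ι ≃ κ)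
    (h : ∀ i, d' (e i) = d i) (hd : FinFib d) : FinFib d' := fun n =>
  have := hd n
  Finite.of_equiv {i // d i = n} (e.subtypeEquiv (q := fun j => d' j = n) fun i => by rw [h])

theorem genFun_congr {ι κ : Type*} {d : ι → ℕ} {d' : κ → ℕ} (e : ι ≃ κ)
    (h : ∀ i, d' (e i) = d i) : genFun d = genFun d' := by
  ext n
  simp only [genFun, PowerSeries.coeff_mk]
  rw [Nat.card_congr (e.subtypeEquiv (q := fun j => d' j = n) fun i => by rw [h])]

/-- The fibres of a sum of two degree functions on a product. -/
def fibProdEquiv {ι κ : Type*} (d : ι → ℕ) (d' : κ → ℕ) (n : ℕ) :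
    {p : ι × κ // d p.1 + d' p.2 = n} ≃
      Σ q : {q : ℕ × ℕ // q ∈ Finset.HasAntidiagonal.antidiagonal n},
        {i // d i = q.1.1} × {j // d' j = q.1.2} where
  toFun p := ⟨⟨(d p.1.1, d' p.1.2), Finset.HasAntidiagonal.mem_antidiagonal.2 p.2⟩,
    ⟨p.1.1, rfl⟩, ⟨p.1.2, rfl⟩⟩
  invFun q := ⟨(q.2.1.1, q.2.2.1), by
    rw [q.2.1.2, q.2.2.2]; exact Finset.HasAntidiagonal.mem_antidiagonal.1 q.1.2⟩
  left_inv p := rfl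
  right_inv := by
    rintro ⟨⟨⟨a, b⟩, h⟩, ⟨i, hi⟩, ⟨j, hj⟩⟩
    simp only at hi hj
    subst hi hj
    rfl

theorem FinFib.prod {ι κ : Type*} {d : ι → ℕ} {d' : κ → ℕ} (h : FinFib d) (h' : FinFib d') :
    FinFib fun p : ι × κ => d p.1 + d' p.2 := fun n =>
  have := h
  have := h'
  have : ∀ q : {q : ℕ × ℕ // q ∈ Finset.HasAntidiagonal.antidiagonal n},
      Finite ({i // d i = q.1.1} × {j // d' j = q.1.2}) := fun q =>
    have := h q.1.1
    have := h' q.1.2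
    inferInstance
  Finite.of_equiv _ (fibProdEquiv d d' n).symm

theorem genFun_prod {ι κ : Type*} {d : ι → ℕ} {d' : κ → ℕ} (h : FinFib d) (h' : FinFib d') :
    genFun (fun p : ι × κ => d p.1 + d' p.2) = genFun d * genFun d' := by
  ext n
  simp only [genFun, PowerSeries.coeff_mk, PowerSeries.coeff_mul]
  have : ∀ q : {q : ℕ × ℕ // q ∈ Finset.HasAntidiagonal.antidiagonal n},
      Finite ({i // d i = q.1.1} × {j // d' j = q.1.2}) := fun q =>
    have := h q.1.1
    have := h' q.1.2
    inferInstance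
  rw [Nat.card_congr (fibProdEquiv d d' n), Nat.card_sigma]
  push_cast
  refine Eq.trans ?_ (Finset.sum_coe_sort (Finset.HasAntidiagonal.antidiagonal n) fun q =>
    (Nat.card {i // d i = q.1} : ℤ) * Nat.card {j // d' j = q.2})
  exact Finset.sum_congr rfl fun q _ => by rw [Nat.card_prod]; push_cast; rfl

theorem FinFib.sigma {ι : Type*} [Finite ι] {κ : ι → Type*} {d : ∀ i, κ i → ℕ}
    (h : ∀ i, FinFib (d i)) : FinFib fun p : Σ i, κ i => d p.1 p.2 := fun n =>
  have : ∀ i, Finite {j // d i j = n} := fun i => h i n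
  Finite.of_equiv (Σ i, {j // d i j = n})
    { toFun := fun p => ⟨⟨p.1, p.2.1⟩, p.2.2⟩
      invFun := fun p => ⟨p.1.1, p.1.2, p.2⟩
      left_inv := fun _ => rfl
      right_inv := fun _ => rfl }

theorem genFun_sigma {ι : Type*} [Fintype ι] {κ : ι → Type*} {d : ∀ i, κ i → ℕ}
    (h : ∀ i, FinFib (d i)) :
    genFun (fun p : Σ i, κ i => d p.1 p.2) = ∑ i, genFun (d i) := by
  ext n
  have : ∀ i, Finite {j // d i j = n} := fun i => h i n
  rw [map_sum]
  simp only [genFun, PowerSeries.coeff_mk]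
  rw [Nat.card_congr (β := Σ i, {j // d i j = n})
    { toFun := fun p => ⟨p.1.1, p.1.2, p.2⟩
      invFun := fun p => ⟨⟨p.1, p.2.1⟩, p.2.2⟩
      left_inv := fun _ => rfl
      right_inv := fun _ => rfl }, Nat.card_sigma]
  push_cast
  rfl

theorem genFun_sumElim {ι κ : Type*} {d : ι → ℕ} {d' : κ → ℕ} (h : FinFib d) (h' : FinFib d') :
    genFun (Sum.elim d d') = genFun d + genFun d' := by
  ext n
  have h1 : Finite {i // Sum.elim d d' (Sum.inl i) = n} := h n
  have h2 : Finite {i // Sum.elim d d' (Sum.inr i) = n} := h' n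
  rw [map_add]
  simp only [genFun, PowerSeries.coeff_mk]
  rw [Nat.card_congr (Equiv.subtypeSum (p := fun x => Sum.elim d d' x = n)), Nat.card_sum]
  push_cast
  rfl

theorem genFun_unit (c : ℕ) : genFun (fun _ : Unit => c) = PowerSeries.X ^ c := by
  ext n
  rw [PowerSeries.coeff_X_pow]
  simp only [genFun, PowerSeries.coeff_mk]
  split_ifs with h
  · subst h
    simp
  · have : IsEmpty {i : Unit // c = n} := ⟨fun i => h i.2.symm⟩
    simp

theorem FinFib.add_const {ι : Type*} {d : ι → ℕ} (h : FinFib d) (c : ℕ) :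
    FinFib fun i => d i + c :=
  (h.prod (FinFib.of_finite fun _ : Unit => c)).congr (Equiv.prodPUnit ι) fun _ => rfl

theorem genFun_add_const {ι : Type*} {d : ι → ℕ} (h : FinFib d) (c : ℕ) :
    genFun (fun i => d i + c) = genFun d * PowerSeries.X ^ c := by
  rw [← genFun_unit, ← genFun_prod h (FinFib.of_finite _)]
  exact (genFun_congr (Equiv.prodPUnit ι) fun _ => rfl).symm

/-- `ℕ` as the disjoint union of `{0}` and the successors. -/
def natEquivSumUnit : ℕ ⊕ Unit ≃ ℕ where
  toFun := Sum.elim Nat.succ fun _ => 0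
  invFun n := Nat.casesOn n (Sum.inr ()) Sum.inl
  left_inv := by rintro (_ | _) <;> rfl
  right_inv := by rintro (_ | _) <;> rfl

theorem finFib_mul {c : ℕ} (hc : 0 < c) : FinFib fun m : ℕ => c * m := fun n =>
  Finite.of_injective (fun i : {i // c * i = n} => (⟨i.1, by
    have := i.2; have := Nat.le_mul_of_pos_left i.1 hc; omega⟩ : Fin (n + 1))) fun i j h => by
      simpa [Subtype.ext_iff] using h

theorem genFun_mul {c : ℕ} (hc : 0 < c) :
    (1 - PowerSeries.X ^ c) * genFun (fun m : ℕ => c * m) = 1 := by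
  have h : genFun (fun m : ℕ => c * m) = genFun (fun m : ℕ => c * m) * PowerSeries.X ^ c + 1 := by
    conv_lhs => rw [← genFun_congr (d := Sum.elim (fun m => c * m + c) fun _ => 0) natEquivSumUnit
      (by rintro (_ | _) <;> simp [natEquivSumUnit, mul_add])]
    rw [genFun_sumElim ((finFib_mul hc).add_const c) (FinFib.of_finite _),
      genFun_add_const (finFib_mul hc), genFun_unit, pow_zero]
  linear_combination h

/-! ### Identities for `(1:u)_n` -/

theorem oneU_zero : oneU 0 = 1 := by
  simpa using prod_mul_oneU 0

theorem one_sub_mul_oneU (k : ℕ) : (1 - PowerSeries.X ^ (k + 1)) * oneU (k + 1) = oneU k := by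
  have h1 := prod_mul_oneU k
  have h2 := prod_mul_oneU (k + 1)
  rw [Finset.prod_range_succ] at h2
  linear_combination (-(1 - PowerSeries.X ^ (k + 1)) * oneU (k + 1)) * h1 + oneU k * h2

theorem one_sub_X_pow_ne_zero (k : ℕ) : (1 - PowerSeries.X ^ (k + 1) : ℤ⟦X⟧) ≠ 0 := fun h => by
  simpa using congrArg PowerSeries.constantCoeff h

/-- A family with the recursion and initial value of `oneU` is `oneU`. -/
theorem eq_oneU_of_rec {g : ℕ → ℤ⟦X⟧} (h0 : g 0 = 1)
    (hs : ∀ k, (1 - PowerSeries.X ^ (k + 1)) * g (k + 1) = g k) (k : ℕ) : g k = oneU k := by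
  induction k with
  | zero => rw [h0, oneU_zero]
  | succ k ih =>
    apply mul_left_cancel₀ (one_sub_X_pow_ne_zero k)
    rw [hs, one_sub_mul_oneU, ih]

/-- Exponent vectors `m ∈ ℕ^l`, with degree `∑ i m_i` for `1 ≤ i ≤ l`. -/
def expDeg (l : ℕ) (m : Fin l → ℕ) : ℕ := ∑ i : Fin l, (i.val + 1) * m i

theorem finFib_expDeg_and_genFun (l : ℕ) : FinFib (expDeg l) ∧ genFun (expDeg l) = oneU l := by
  have key : ∀ l, FinFib (expDeg l) → FinFib (expDeg (l + 1)) ∧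
      genFun (expDeg (l + 1)) = genFun (fun m : ℕ => (l + 1) * m) * genFun (expDeg l) := by
    intro l hl
    have e : ∀ p : ℕ × (Fin l → ℕ), expDeg (l + 1) (Fin.snocEquiv (fun _ => ℕ) p) =
        (l + 1) * p.1 + expDeg l p.2 := by
      intro p
      simp [expDeg, Fin.sum_univ_castSucc, add_comm]
    have hm := finFib_mul (c := l + 1) (by omega)
    exact ⟨(hm.prod hl).congr _ e, by rw [← genFun_prod hm hl, genFun_congr _ e]⟩
  have fin : ∀ l, FinFib (expDeg l) := by
    intro l
    induction l with
    | zero => exact FinFib.of_finite _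
    | succ l ih => exact (key l ih).1
  refine ⟨fin l, ?_⟩
  apply eq_oneU_of_rec (g := fun l => genFun (expDeg l))
  · rw [← pow_zero PowerSeries.X, ← genFun_unit]
    exact genFun_congr (Equiv.ofUnique _ _) fun i => by simp [expDeg]
  · intro k
    rw [(key k (fin k)).2, ← mul_assoc, genFun_mul (by omega), one_mul]

/-- Multisets of `k` natural numbers, as finitely supported multiplicity functions. -/
def MultN (k : ℕ) : Type := {f : ℕ →₀ ℕ // f.degree = k}

/-- The sum of the elements of a multiset. -/
def multDeg {k : ℕ} (f : MultN k) : ℕ := Finsupp.weight (id : ℕ → ℕ) f.1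

/-- A multiset of `k + 1` natural numbers either contains `0` or consists of successors. -/
def multSucc (k : ℕ) : MultN k ⊕ MultN (k + 1) → MultN (k + 1) :=
  Sum.elim (fun g => ⟨g.1 + Finsupp.single 0 1, by simp [g.2]⟩)
    fun g => ⟨Finsupp.mapDomain Nat.succ g.1, by rw [Finsupp.degree_mapDomain, g.2]⟩

theorem mapDomain_succ_zero (f : ℕ →₀ ℕ) : Finsupp.mapDomain Nat.succ f 0 = 0 :=
  Finsupp.mapDomain_of_notMem_range _ _ (by simp)

theorem multSucc_inl_val {k : ℕ} (g : MultN k) :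
    (multSucc k (Sum.inl g)).1 = g.1 + Finsupp.single 0 1 := rfl

theorem multSucc_inr_val {k : ℕ} (g : MultN (k + 1)) :
    (multSucc k (Sum.inr g)).1 = Finsupp.mapDomain Nat.succ g.1 := rfl

theorem multSucc_bijective (k : ℕ) : Function.Bijective (multSucc k) := by
  constructor
  · rintro (f | f) (g | g) h
    · have := congrArg Subtype.val h
      rw [multSucc_inl_val, multSucc_inl_val, add_left_inj] at this
      exact congrArg Sum.inl (Subtype.ext this)
    · have := DFunLike.congr_fun (congrArg Subtype.val h) 0
      simp [multSucc_inl_val, multSucc_inr_val, mapDomain_succ_zero] at this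
    · have := DFunLike.congr_fun (congrArg Subtype.val h) 0
      simp [multSucc_inl_val, multSucc_inr_val, mapDomain_succ_zero] at this
    · have := Finsupp.mapDomain_injective Nat.succ_injective (congrArg Subtype.val h)
      exact congrArg Sum.inr (Subtype.ext this)
  · rintro ⟨f, hf⟩
    by_cases h0 : f 0 = 0
    · have e :
          Finsupp.mapDomain Nat.succ (f.comapDomain Nat.succ Nat.succ_injective.injOn) = f := by
        apply Finsupp.mapDomain_comapDomain _ Nat.succ_injective
        intro i hi
        rcases i with _ | i
        · simp [h0] at hi
        · exact ⟨i, rfl⟩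
      refine ⟨Sum.inr ⟨f.comapDomain Nat.succ Nat.succ_injective.injOn, ?_⟩, Subtype.ext e⟩
      rw [← hf, ← Finsupp.degree_mapDomain Nat.succ, e]
    · have e : f - Finsupp.single 0 1 + Finsupp.single 0 1 = f := by
        ext i
        rcases i with _ | i
        · simp only [Finsupp.coe_add, Finsupp.coe_tsub, Pi.add_apply, Pi.sub_apply,
            Finsupp.single_eq_same]
          omega
        · simp
      refine ⟨Sum.inl ⟨f - Finsupp.single 0 1, ?_⟩, Subtype.ext e⟩
      have := congrArg Finsupp.degree e
      rw [map_add, hf, Finsupp.degree_single] at this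
      omega

theorem multDeg_multSucc_inl {k : ℕ} (f : MultN k) :
    multDeg (multSucc k (Sum.inl f)) = multDeg f := by
  simp [multDeg, multSucc_inl_val, Finsupp.weight_single]

theorem multDeg_multSucc_inr {k : ℕ} (f : MultN (k + 1)) :
    multDeg (multSucc k (Sum.inr f)) = multDeg f + (k + 1) := by
  have h : ∀ f : ℕ →₀ ℕ, Finsupp.weight (id : ℕ → ℕ) (Finsupp.mapDomain Nat.succ f) =
      Finsupp.weight (id : ℕ → ℕ) f + f.degree := by
    intro f
    induction f using Finsupp.induction_linear with
    | zero => simp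
    | add f g hf hg => simp only [Finsupp.mapDomain_add, map_add, hf, hg]; ring
    | single a b =>
      rw [Finsupp.mapDomain_single, Finsupp.weight_single, Finsupp.weight_single,
        Finsupp.degree_single]
      simp [mul_add]
  simp only [multDeg, multSucc_inr_val, h, f.2]

theorem finFib_multDeg (k : ℕ) : FinFib (multDeg (k := k)) := by
  induction k with
  | zero =>
    have : Subsingleton (MultN 0) := ⟨fun f g => Subtype.ext <| by
      rw [(Finsupp.degree_eq_zero_iff _).1 f.2, (Finsupp.degree_eq_zero_iff _).1 g.2]⟩
    exact FinFib.of_finite _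
  | succ k ih =>
    intro n
    induction n using Nat.strong_induction_on with
    | _ n ihn =>
      have := ih n
      have h2 : Finite {f : MultN (k + 1) // multDeg f + (k + 1) = n} := by
        by_cases hn : k + 1 ≤ n
        · have := ihn (n - (k + 1)) (by omega)
          exact Finite.of_injective (fun f => (⟨f.1, by have := f.2; omega⟩ :
            {f : MultN (k + 1) // multDeg f = n - (k + 1)})) fun f g h => by
              simpa [Subtype.ext_iff] using h
        · exact @Finite.of_subsingleton _ ⟨fun f => absurd f.2 (by omega)⟩
      refine Finite.of_surjective
        (Sum.elim (fun f : {f : MultN k // multDeg f = n} =>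
            (⟨multSucc k (Sum.inl f.1), by rw [multDeg_multSucc_inl, f.2]⟩ :
              {f : MultN (k + 1) // multDeg f = n}))
          fun f : {f : MultN (k + 1) // multDeg f + (k + 1) = n} =>
            ⟨multSucc k (Sum.inr f.1), by rw [multDeg_multSucc_inr, f.2]⟩) ?_
      rintro ⟨f, hf⟩
      obtain ⟨g | g, rfl⟩ := (multSucc_bijective k).2 f
      · exact ⟨Sum.inl ⟨g, by rw [← hf, multDeg_multSucc_inl]⟩, rfl⟩
      · exact ⟨Sum.inr ⟨g, by rw [← hf, multDeg_multSucc_inr]⟩, rfl⟩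

theorem genFun_multDeg (k : ℕ) : genFun (multDeg (k := k)) = oneU k := by
  apply eq_oneU_of_rec (g := fun k => genFun (multDeg (k := k)))
  · have : Unique (MultN 0) := ⟨⟨⟨0, by simp⟩⟩, fun f => Subtype.ext <|
      (Finsupp.degree_eq_zero_iff _).1 f.2⟩
    rw [← pow_zero PowerSeries.X, ← genFun_unit]
    refine genFun_congr (Equiv.ofUnique _ _) fun f => ?_
    simp [multDeg, (Finsupp.degree_eq_zero_iff _).1 f.2]
  · intro k
    have h : genFun (multDeg (k := k + 1)) =
        genFun (multDeg (k := k)) + genFun (multDeg (k := k + 1)) * PowerSeries.X ^ (k + 1) := by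
      rw [← genFun_add_const (finFib_multDeg _), ← genFun_sumElim (finFib_multDeg _)
        ((finFib_multDeg _).add_const _)]
      refine (genFun_congr (Equiv.ofBijective _ (multSucc_bijective k)) ?_).symm
      rintro (f | f)
      · exact multDeg_multSucc_inl f
      · exact multDeg_multSucc_inr f
    linear_combination h

/-- The partitions with at most `b` parts, all of them at most `a`, built up recursively: either no
part equals `a`, or one part `a` is split off. -/
inductive Box : ℕ → ℕ → Type
  | noSize (b : ℕ) : Box 0 b
  | noPart (a : ℕ) : Box (a + 1) 0
  | smaller {a b : ℕ} (m : Box a (b + 1)) : Box (a + 1) (b + 1)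
  | cons {a b : ℕ} (m : Box (a + 1) b) : Box (a + 1) (b + 1)

/-- The sum of the parts. -/
def boxDeg : ∀ {a b : ℕ}, Box a b → ℕ
  | _, _, .noSize _ => 0
  | _, _, .noPart _ => 0
  | _, _, .smaller m => boxDeg m
  | a + 1, _, .cons m => boxDeg m + (a + 1)

/-- The recursive description of `Box (a + 1) (b + 1)` as a bijection. -/
def boxSuccEquiv (a b : ℕ) : Box a (b + 1) ⊕ Box (a + 1) b ≃ Box (a + 1) (b + 1) where
  toFun := Sum.elim .smaller .cons
  invFun
    | .smaller m => .inl m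
    | .cons m => .inr m
  left_inv := by rintro (_ | _) <;> rfl
  right_inv := by rintro (_ | _) <;> rfl

instance boxZeroUnique (b : ℕ) : Unique (Box 0 b) := ⟨⟨.noSize b⟩, fun | .noSize _ => rfl⟩

instance boxNoPartUnique (a : ℕ) : Unique (Box (a + 1) 0) := ⟨⟨.noPart a⟩, fun | .noPart _ => rfl⟩

theorem Box.finite : ∀ a b : ℕ, Finite (Box a b)
  | 0, _ => inferInstance
  | _ + 1, 0 => inferInstance
  | a + 1, b + 1 =>
    have := Box.finite a (b + 1)
    have := Box.finite (a + 1) b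
    Finite.of_equiv _ (boxSuccEquiv a b)

instance (a b : ℕ) : Finite (Box a b) := Box.finite a b

/-- The product `(1-u)⋯(1-u^n)`, the inverse of `oneU n`. -/
def qFact (n : ℕ) : ℤ⟦X⟧ := ∏ i ∈ Finset.range n, (1 - (PowerSeries.X : ℤ⟦X⟧) ^ (i + 1))

theorem qFact_mul_oneU (n : ℕ) : qFact n * oneU n = 1 := prod_mul_oneU n

theorem qFact_succ (n : ℕ) : qFact (n + 1) = qFact n * (1 - PowerSeries.X ^ (n + 1)) :=
  Finset.prod_range_succ _ _

theorem genFun_boxDeg : ∀ a b : ℕ,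
    genFun (boxDeg (a := a) (b := b)) = qFact (a + b) * oneU a * oneU b
  | 0, b => by
    rw [zero_add, oneU_zero, mul_one, qFact_mul_oneU, ← pow_zero PowerSeries.X, ← genFun_unit]
    exact genFun_congr (Equiv.ofUnique _ _) fun | .noSize _ => rfl
  | a + 1, 0 => by
    rw [add_zero, oneU_zero, mul_one, qFact_mul_oneU, ← pow_zero PowerSeries.X, ← genFun_unit]
    exact genFun_congr (Equiv.ofUnique _ _) fun | .noPart _ => rfl
  | a + 1, b + 1 => by
    have h : genFun (boxDeg (a := a + 1) (b := b + 1)) =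
        genFun (boxDeg (a := a) (b := b + 1)) +
          genFun (boxDeg (a := a + 1) (b := b)) * PowerSeries.X ^ (a + 1) := by
      rw [← genFun_add_const (FinFib.of_finite _),
        ← genFun_sumElim (FinFib.of_finite _) (FinFib.of_finite _)]
      refine (genFun_congr (boxSuccEquiv a b) ?_).symm
      rintro (_ | _) <;> rfl
    rw [h, genFun_boxDeg, genFun_boxDeg, ← one_sub_mul_oneU a, ← one_sub_mul_oneU b,
      show a + 1 + (b + 1) = a + b + 1 + 1 by ring, qFact_succ (a + b + 1),
      show a + (b + 1) = a + b + 1 by ring, show a + 1 + b = a + b + 1 by ring]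
    ring

theorem qBinom_eq_genFun_boxDeg (a b : ℕ) :
    qBinom (a + b) b = genFun (boxDeg (a := a) (b := b)) := by
  rw [genFun_boxDeg, qBinom, if_neg (by omega), Int.toNat_natCast]
  congr 1
  have h : qFact (a + b) = qFact a *
      ∏ i ∈ Finset.range b, (1 - (PowerSeries.X : ℤ⟦X⟧) ^ (a + b - i)) := by
    rw [qFact, qFact, Finset.prod_range_add, ← Finset.prod_range_reflect (n := b)]
    congr 1
    refine Finset.prod_congr rfl fun i hi => ?_
    rw [Finset.mem_range] at hi
    congr 2
    omega
  rw [h]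
  linear_combination
    (-∏ i ∈ Finset.range b, (1 - (PowerSeries.X : ℤ⟦X⟧) ^ (a + b - i))) * qFact_mul_oneU a

/-! ### Linearization of Rogers–Szegő polynomials -/

/-- The normalized Rogers–Szegő polynomial `∑ₖ w^k / ((u)_k (u)_{n-k})` in the variable `w`.  The
coefficient of `w^k` is the character of the weight space `n - 2k` of `W(n)`. -/
def rsPoly (n : ℕ) : ℤ⟦X⟧[X] :=
  ∑ k ∈ Finset.range (n + 1), Polynomial.monomial k (oneU k * oneU (n - k))

/-- `1 / (u)_{n-j}`, extended by zero to `j > n`. -/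
def oSub (n j : ℕ) : ℤ⟦X⟧ := if j ≤ n then oneU (n - j) else 0

theorem oSub_add (j t : ℕ) : oSub (j + t) j = oneU t := by simp [oSub]

theorem oSub_of_lt {n j : ℕ} (h : n < j) : oSub n j = 0 := by simp [oSub, h]

theorem coeff_rsPoly (n k : ℕ) : (rsPoly n).coeff k = oneU k * oSub n k := by
  rw [rsPoly, Polynomial.finsetSum_coeff]
  simp only [Polynomial.coeff_monomial, Finset.sum_ite_eq', Finset.mem_range, oSub, Nat.lt_succ_iff]
  split_ifs <;> simp

theorem rsPoly_zero : rsPoly 0 = 1 := by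
  ext1 k
  rw [coeff_rsPoly, Polynomial.coeff_one]
  split_ifs with h
  · simp [h, oSub, oneU_zero]
  · rw [oSub_of_lt (by omega), mul_zero]

/-- `rsPoly (n - 1)`, with value `0` for `n = 0`. -/
def rsPred (n : ℕ) : ℤ⟦X⟧[X] := if n = 0 then 0 else rsPoly (n - 1)

theorem coeff_rsPred (n k : ℕ) : (rsPred n).coeff k = oneU k * oSub n (k + 1) := by
  rcases n with _ | n
  · simp [rsPred, oSub]
  · simp [rsPred, coeff_rsPoly, oSub]

theorem oSub_succ (n j : ℕ) : oSub n (j + 1) = (1 - PowerSeries.X ^ (n - j)) * oSub n j := by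
  rcases lt_trichotomy n j with h | rfl | h
  · rw [oSub_of_lt h, oSub_of_lt (by omega), mul_zero]
  · rw [oSub_of_lt (by omega)]; simp
  · obtain ⟨t, rfl⟩ := Nat.exists_eq_add_of_lt h
    rw [show j + t + 1 = j + (t + 1) by ring, oSub_add, show j + (t + 1) = (j + 1) + t by ring,
      oSub_add, show j + 1 + t - j = t + 1 by omega, one_sub_mul_oneU]

/-- The three-term recurrence. -/
theorem rsPoly_succ (n : ℕ) :
    Polynomial.C (1 - PowerSeries.X ^ (n + 1)) * rsPoly (n + 1) =
      (1 + Polynomial.X) * rsPoly n - Polynomial.X * rsPred n := by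
  ext1 k
  rw [Polynomial.coeff_C_mul, Polynomial.coeff_sub, add_mul, one_mul, Polynomial.coeff_add]
  rcases k with _ | k
  · simp only [Polynomial.coeff_X_mul_zero, coeff_rsPoly, oneU_zero, oSub, zero_le, if_true,
      Nat.sub_zero, ← one_sub_mul_oneU n]
    ring
  · rw [Polynomial.coeff_X_mul, Polynomial.coeff_X_mul, coeff_rsPoly, coeff_rsPoly, coeff_rsPoly,
      coeff_rsPred, ← one_sub_mul_oneU k]
    rcases lt_or_ge n k with h | h
    · rw [oSub_of_lt (by omega), oSub_of_lt (by omega), oSub_of_lt h]; simp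
    · obtain ⟨t, rfl⟩ := Nat.exists_eq_add_of_le h
      rw [oSub_succ (k + t), show k + t + 1 = (k + 1) + t by ring, oSub_add, oSub_add,
        Nat.add_sub_cancel_left]
      ring

/-- The Rogers–Szegő polynomial `∑ₖ [n choose k] w^k`. -/
def rsH (n : ℕ) : ℤ⟦X⟧[X] := Polynomial.C (qFact n) * rsPoly n

theorem one_add_mul_rsH (n : ℕ) :
    (1 + Polynomial.X) * rsH n =
      rsH (n + 1) + Polynomial.C (1 - PowerSeries.X ^ n) * Polynomial.X * rsH (n - 1) := by
  have h1 : Polynomial.C (qFact n) * rsPred n =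
      Polynomial.C (1 - PowerSeries.X ^ n) * rsH (n - 1) := by
    rcases n with _ | n
    · simp [rsPred]
    · simp only [rsPred, rsH, qFact_succ, Nat.add_sub_cancel, map_mul]
      simp only [Nat.add_eq_zero_iff, one_ne_zero, and_false, if_false]
      ring
  have h2 := rsPoly_succ n
  simp only [rsH, qFact_succ, map_mul] at h1 ⊢
  linear_combination (-Polynomial.C (qFact n)) * h2 + Polynomial.X * h1

/-- The linearization coefficient `1 / ((u)_j (u)_{a-j} (u)_{b-j})`, zero unless `j ≤ a, b`. -/
def linCoeff (a b j : ℕ) : ℤ⟦X⟧ := oneU j * oSub a j * oSub b j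

/-- `linCoeff (a - 1) b j`, with value `0` for `a = 0`. -/
def linPred (a b j : ℕ) : ℤ⟦X⟧ := oneU j * oSub a (j + 1) * oSub b j

theorem linCoeff_zero_step (a b : ℕ) :
    linCoeff a b 0 = (1 - PowerSeries.X ^ (a + 1)) * linCoeff (a + 1) b 0 := by
  simp only [linCoeff, oSub, zero_le, if_true, Nat.sub_zero, ← one_sub_mul_oneU a]
  ring

theorem linCoeff_succ_step (a b j : ℕ) (hj : j < b) :
    linCoeff a b (j + 1) + (1 - PowerSeries.X ^ (a + b - 2 * j)) * linCoeff a b j -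
      linPred a b j = (1 - PowerSeries.X ^ (a + 1)) * linCoeff (a + 1) b (j + 1) := by
  obtain ⟨s, rfl⟩ := Nat.exists_eq_add_of_lt hj
  rcases lt_or_ge a j with h | h
  · simp only [linCoeff, linPred, oSub_of_lt h, oSub_of_lt (show a < j + 1 by omega),
      oSub_of_lt (show a + 1 < j + 1 by omega)]
    ring
  · obtain ⟨t, rfl⟩ := Nat.exists_eq_add_of_le h
    simp only [linCoeff, linPred, oSub_succ (j + t), oSub_add, Nat.add_sub_cancel_left]
    rw [show j + s + 1 = (j + 1) + s by ring, oSub_add, show (j + 1) + s = j + (s + 1) by ring,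
      oSub_add, show j + t + 1 = (j + 1) + t by ring, oSub_add, ← one_sub_mul_oneU j,
      ← one_sub_mul_oneU s, show j + t + (j + (s + 1)) - 2 * j = t + s + 1 by omega]
    ring

theorem linCoeff_last_step (a b : ℕ) :
    (1 - PowerSeries.X ^ (a + b - 2 * b)) * linCoeff a b b - linPred a b b = 0 := by
  rw [linCoeff, linPred, oSub_succ, show a + b - 2 * b = a - b by omega]
  ring

/-- Multiplying a term of the linearization by `1 + w`. -/
theorem one_add_mul_term (a b j : ℕ) :
    (1 + Polynomial.X) * (Polynomial.X ^ j * Polynomial.C (linCoeff a b j) * rsH (a + b - 2 * j)) =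
      Polynomial.X ^ j * Polynomial.C (linCoeff a b j) * rsH (a + 1 + b - 2 * j) +
      Polynomial.X ^ (j + 1) * Polynomial.C ((1 - PowerSeries.X ^ (a + b - 2 * j)) *
        linCoeff a b j) * rsH (a + b - 2 * j - 1) := by
  by_cases h : j ≤ a ∧ j ≤ b
  · have := one_add_mul_rsH (a + b - 2 * j)
    rw [show a + b - 2 * j + 1 = a + 1 + b - 2 * j by omega] at this
    rw [map_mul]
    linear_combination (Polynomial.X ^ j * Polynomial.C (linCoeff a b j)) * this
  · have : linCoeff a b j = 0 := by
      rcases not_and_or.1 h with h | h <;> rw [linCoeff, oSub_of_lt (not_le.1 h)] <;> simp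
    simp [this]

/-- Rogers' linearization formula, by induction on `a` through the three-term recurrence. -/
theorem rsPoly_mul_rsPoly_aux (a b : ℕ) :
    rsPoly a * rsPoly b = ∑ j ∈ Finset.range (b + 1),
      Polynomial.X ^ j * Polynomial.C (linCoeff a b j) * rsH (a + b - 2 * j) ∧
    rsPred a * rsPoly b = ∑ j ∈ Finset.range (b + 1),
      Polynomial.X ^ j * Polynomial.C (linPred a b j) * rsH (a + b - 2 * j - 1) := by
  induction a with
  | zero =>
    constructor
    · rw [Finset.sum_range_succ', Finset.sum_eq_zero]
      · simp [rsPoly_zero, linCoeff, oSub, oneU_zero, rsH, ← mul_assoc, ← map_mul, mul_comm (oneU b),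
          qFact_mul_oneU]
      · intro j _
        simp [linCoeff, oSub]
    · rw [Finset.sum_eq_zero]
      · simp [rsPred]
      · intro j _
        simp [linPred, oSub]
  | succ a ih =>
    obtain ⟨ih1, ih2⟩ := ih
    have hne : Polynomial.C (1 - PowerSeries.X ^ (a + 1) : ℤ⟦X⟧) ≠ 0 :=
      Polynomial.C_ne_zero.2 (one_sub_X_pow_ne_zero a)
    constructor
    · apply mul_left_cancel₀ hne
      rw [← mul_assoc, rsPoly_succ, sub_mul, mul_assoc, mul_assoc, ih1, ih2, Finset.mul_sum,
        Finset.mul_sum, Finset.mul_sum]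
      simp only [one_add_mul_term]
      rw [Finset.sum_add_distrib, add_sub_assoc, ← Finset.sum_sub_distrib]
      have e : ∀ j, Polynomial.X ^ (j + 1) * Polynomial.C ((1 - PowerSeries.X ^ (a + b - 2 * j)) *
            linCoeff a b j) * rsH (a + b - 2 * j - 1) -
          Polynomial.X * (Polynomial.X ^ j * Polynomial.C (linPred a b j) *
            rsH (a + b - 2 * j - 1)) =
          Polynomial.X ^ (j + 1) * Polynomial.C ((1 - PowerSeries.X ^ (a + b - 2 * j)) *
            linCoeff a b j - linPred a b j) * rsH (a + b - 2 * j - 1) := by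
        intro j
        rw [map_sub]
        ring
      simp only [e]
      rw [Finset.sum_range_succ' (n := b), Finset.sum_range_succ (n := b), linCoeff_last_step,
        Finset.sum_range_succ' (n := b), linCoeff_zero_step a b, map_zero,
        mul_zero (Polynomial.X ^ (b + 1)), zero_mul,
        add_zero, add_right_comm, ← Finset.sum_add_distrib]
      congr 1
      · refine Finset.sum_congr rfl fun j hj => ?_
        have := congrArg Polynomial.C (linCoeff_succ_step a b j (Finset.mem_range.1 hj))
        rw [show a + b - 2 * j - 1 = a + 1 + b - 2 * (j + 1) by omega]
        simp only [map_sub, map_add, map_mul] at this ⊢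
        linear_combination (Polynomial.X ^ (j + 1) * rsH (a + 1 + b - 2 * (j + 1))) * this
      · rw [map_mul]
        ring
    · rw [rsPred, if_neg (by omega), Nat.add_sub_cancel, ih1]
      refine Finset.sum_congr rfl fun j _ => ?_
      rw [show a + 1 + b - 2 * j - 1 = a + b - 2 * j by omega]
      congr 3
      simp [linPred, linCoeff, oSub]

/-- The multiplicity series of `W(a + b - 2j)` in `W(a) ⊗ W(b)`. -/
def multSeries (a b j : ℕ) : ℤ⟦X⟧ := qBinom (a + b - 2 * j) ((b : ℤ) - j) * oneU j

theorem multSeries_add (a' b' j : ℕ) :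
    multSeries (a' + j) (b' + j) j = genFun (boxDeg (a := a') (b := b')) * oneU j := by
  rw [multSeries, ← qBinom_eq_genFun_boxDeg, show a' + j + (b' + j) - 2 * j = a' + b' by omega,
    Nat.cast_add, add_sub_cancel_right]

theorem rsPoly_mul_rsPoly (a b : ℕ) :
    rsPoly a * rsPoly b = ∑ j ∈ Finset.range (min a b + 1),
      Polynomial.X ^ j * Polynomial.C (multSeries a b j) * rsPoly (a + b - 2 * j) := by
  rw [(rsPoly_mul_rsPoly_aux a b).1]
  symm
  refine Eq.trans (Finset.sum_congr rfl fun j hj => ?_)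
    (Finset.sum_subset (Finset.range_mono (by omega)) fun j _ hj => ?_)
  · rw [Finset.mem_range] at hj
    obtain ⟨a', rfl⟩ := Nat.exists_eq_add_of_le' (show j ≤ a by omega)
    obtain ⟨b', rfl⟩ := Nat.exists_eq_add_of_le' (show j ≤ b by omega)
    rw [multSeries_add, genFun_boxDeg, rsH, linCoeff, add_comm a' j, oSub_add, add_comm b' j,
      oSub_add, show j + a' + (j + b') - 2 * j = a' + b' by omega]
    simp only [map_mul]
    ring
  · rw [Finset.mem_range] at hj
    rw [linCoeff]
    rcases lt_or_ge a j with h | h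
    · simp [oSub_of_lt h]
    · simp [oSub_of_lt (show b < j by omega)]

open Finset.HasAntidiagonal (antidiagonal)

/-! ### Commuting families and formal power series -/

open scoped IsMulCommutative in
theorem exists_aeval_of_commute {A ι : Type*} [Ring A] [Algebra ℂ A] (f : ι → A)
    (h : ∀ i j, f i * f j = f j * f i) :
    ∃ φ : MvPolynomial ι ℂ →ₐ[ℂ] A, ∀ i, φ (MvPolynomial.X i) = f i := by
  have := Algebra.isMulCommutative_adjoin ℂ (s := Set.range f) (by
    rintro _ ⟨i, rfl⟩ _ ⟨j, rfl⟩; exact h i j)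
  let g : ι → Algebra.adjoin ℂ (Set.range f) := fun i => ⟨f i, Algebra.subset_adjoin ⟨i, rfl⟩⟩
  exact ⟨(Algebra.adjoin ℂ (Set.range f)).val.comp (MvPolynomial.aeval g), fun i => by simp [g]⟩

/-- Evaluation of polynomials at a commuting family in a possibly noncommutative algebra. -/
def commAeval {A ι : Type*} [Ring A] [Algebra ℂ A] (f : ι → A)
    (h : ∀ i j, f i * f j = f j * f i) : MvPolynomial ι ℂ →ₐ[ℂ] A :=
  (exists_aeval_of_commute f h).choose

theorem commAeval_X {A ι : Type*} [Ring A] [Algebra ℂ A] (f : ι → A)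
    (h : ∀ i j, f i * f j = f j * f i) (i : ι) : commAeval f h (MvPolynomial.X i) = f i :=
  (exists_aeval_of_commute f h).choose_spec i

/-- The derivative of a formal power series over a possibly noncommutative ring. -/
def dSer {A : Type*} [Ring A] (F : A⟦X⟧) : A⟦X⟧ :=
  PowerSeries.mk fun n => (n + 1) • PowerSeries.coeff (n + 1) F

theorem coeff_dSer {A : Type*} [Ring A] (F : A⟦X⟧) (n : ℕ) :
    PowerSeries.coeff n (dSer F) = (n + 1) • PowerSeries.coeff (n + 1) F :=
  PowerSeries.coeff_mk _ _

theorem dSer_mul {A : Type*} [Ring A] (F G : A⟦X⟧) :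
    dSer (F * G) = dSer F * G + F * dSer G := by
  ext n
  have h : (n + 1) • PowerSeries.coeff (n + 1) (F * G) =
      ∑ p ∈ antidiagonal (n + 1), p.1 • (PowerSeries.coeff p.1 F * PowerSeries.coeff p.2 G) +
      ∑ p ∈ antidiagonal (n + 1), p.2 • (PowerSeries.coeff p.1 F * PowerSeries.coeff p.2 G) := by
    rw [PowerSeries.coeff_mul, Finset.smul_sum, ← Finset.sum_add_distrib]
    refine Finset.sum_congr rfl fun p hp => ?_
    rw [← add_smul, Finset.HasAntidiagonal.mem_antidiagonal.1 hp]
  rw [coeff_dSer, h, Finset.Nat.sum_antidiagonal_succ, Finset.Nat.sum_antidiagonal_succ', map_add,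
    PowerSeries.coeff_mul, PowerSeries.coeff_mul]
  simp only [zero_smul, zero_add, coeff_dSer, smul_mul_assoc, mul_smul_comm]

theorem dSer_one {A : Type*} [Ring A] : dSer (1 : A⟦X⟧) = 0 := by
  ext n
  simp [coeff_dSer, PowerSeries.coeff_one]

/-- A sequence of vectors is determined by a first-order linear recursion. -/
theorem eq_of_rec {V : Type*} [AddCommGroup V] [Module ℂ V] {P : ℕ → V → V} {u v : ℕ → V}
    (h0 : u 0 = v 0)
    (hu : ∀ n, (n + 1) • u (n + 1) = ∑ p ∈ antidiagonal n, P p.1 (u p.2))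
    (hv : ∀ n, (n + 1) • v (n + 1) = ∑ p ∈ antidiagonal n, P p.1 (v p.2)) (n : ℕ) : u n = v n := by
  induction n using Nat.strong_induction_on with
  | _ n ih =>
    rcases n with _ | n
    · exact h0
    · have h : (n + 1) • u (n + 1) = (n + 1) • v (n + 1) := by
        rw [hu, hv]
        refine Finset.sum_congr rfl fun p hp => ?_
        rw [ih p.2 (by have := Finset.HasAntidiagonal.mem_antidiagonal.1 hp; omega)]
      rw [← Nat.cast_smul_eq_nsmul ℂ, ← Nat.cast_smul_eq_nsmul ℂ] at h
      exact smul_right_injective V (Nat.cast_ne_zero.2 n.succ_ne_zero) h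

section ExpSeries

variable {R : Type*} [CommRing R] [Algebra ℂ R]

/-- The coefficients of `exp (-∑ p_r T^r / r)`; `p i` is the power sum of index `i + 1`, and the
coefficients are, up to sign, the elementary symmetric functions. -/
def expC (p : ℕ → R) : ℕ → R
  | 0 => 1
  | n + 1 => -((n + 1 : ℂ)⁻¹ • ∑ i : Fin (n + 1), p i * expC p (n - i))
  decreasing_by omega

theorem expC_zero (p : ℕ → R) : expC p 0 = 1 := by rw [expC]

theorem expC_succ (p : ℕ → R) (n : ℕ) :
    (n + 1) • expC p (n + 1) = -∑ q ∈ antidiagonal n, p q.1 * expC p q.2 := by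
  rw [expC, smul_neg, ← Nat.cast_smul_eq_nsmul ℂ, smul_smul, Nat.cast_succ,
    mul_inv_cancel₀ (Nat.cast_add_one_ne_zero n), one_smul,
    Finset.Nat.sum_antidiagonal_eq_sum_range_succ (fun i j => p i * expC p j),
    Finset.sum_range]

/-- The series `exp (-∑ p_r T^r / r)`. -/
def expS (p : ℕ → R) : R⟦X⟧ := PowerSeries.mk (expC p)

theorem coeff_expS (p : ℕ → R) (n : ℕ) : PowerSeries.coeff n (expS p) = expC p n :=
  PowerSeries.coeff_mk _ _

theorem dSer_expS (p : ℕ → R) : dSer (expS p) = -(PowerSeries.mk p * expS p) := by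
  ext n
  rw [coeff_dSer, coeff_expS, expC_succ, map_neg, PowerSeries.coeff_mul]
  simp [coeff_expS]

theorem eq_expS {p : ℕ → R} {F : R⟦X⟧} (h0 : PowerSeries.coeff 0 F = 1)
    (h : dSer F = -(PowerSeries.mk p * F)) : F = expS p := by
  ext n
  rw [coeff_expS]
  refine eq_of_rec (P := fun i v => -(p i * v)) (u := fun n => PowerSeries.coeff n F) ?_ ?_ ?_ n
  · rw [h0, expC_zero]
  · intro n
    rw [← coeff_dSer, h, map_neg, PowerSeries.coeff_mul, Finset.sum_neg_distrib]
    simp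
  · intro n
    rw [expC_succ, Finset.sum_neg_distrib]

theorem expS_add (p q : ℕ → R) : expS (p + q) = expS p * expS q := by
  symm
  apply eq_expS
  · simp [PowerSeries.coeff_mul, coeff_expS, expC_zero]
  · have : PowerSeries.mk (p + q) = PowerSeries.mk p + PowerSeries.mk q := by ext; simp
    rw [dSer_mul, dSer_expS, dSer_expS, this]
    ring

theorem expS_zero : expS (0 : ℕ → R) = 1 := by
  symm
  apply eq_expS
  · simp
  · rw [dSer_one]
    have : PowerSeries.mk (0 : ℕ → R) = 0 := by ext; simp
    simp [this]

theorem map_expC {R' : Type*} [CommRing R'] [Algebra ℂ R'] (φ : R →ₐ[ℂ] R') (p : ℕ → R) (n : ℕ) :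
    φ (expC p n) = expC (fun i => φ (p i)) n := by
  refine eq_of_rec (P := fun i v => -(φ (p i) * v)) (u := fun n => φ (expC p n)) ?_ ?_ ?_ n
  · simp [expC_zero]
  · intro n
    rw [← map_nsmul, expC_succ, map_neg, map_sum, Finset.sum_neg_distrib]
    simp
  · intro n
    rw [expC_succ, Finset.sum_neg_distrib]

/-- Newton: the power sums are polynomials in the elementary symmetric functions. -/
theorem mem_of_expC_mem (S : Subalgebra ℂ R) {p : ℕ → R} (h : ∀ n, expC p n ∈ S) (n : ℕ) :
    p n ∈ S := by
  induction n using Nat.strong_induction_on with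
  | _ n ih =>
    have e := expC_succ p n
    rw [Finset.Nat.sum_antidiagonal_eq_sum_range_succ (fun i j => p i * expC p j),
      Finset.sum_range_succ, Nat.sub_self, expC_zero, mul_one] at e
    have e' : p n = -((n + 1) • expC p (n + 1)) -
        ∑ k ∈ Finset.range n, p k * expC p (n - k) := by rw [e]; ring
    rw [e']
    exact S.sub_mem (S.neg_mem (S.nsmul_mem (h _) _)) (S.sum_mem fun k hk =>
      S.mul_mem (ih k (Finset.mem_range.1 hk)) (h _))

end ExpSeries

/-! ### Spanning sets of monomials -/

theorem span_exp_monomials {A B : Type} [CommRing A] [CommRing B] [Algebra A B] (l : ℕ) (g : ℕ → B)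
    (h0 : g 0 = 1) (hl : ∀ i, l < i → g i = 0) (htop : Algebra.adjoin A (Set.range g) = ⊤) :
    Submodule.span A (Set.range fun m : Fin l → ℕ => ∏ i : Fin l, g (i + 1) ^ m i) = ⊤ := by
  have h1 : Algebra.adjoin A (Set.range g) ≤
      Algebra.adjoin A (Set.range fun i : Fin l => g (i + 1)) := by
    apply Algebra.adjoin_le
    rintro _ ⟨i, rfl⟩
    rcases i with _ | i
    · rw [h0]; exact one_mem _
    · by_cases hi : i < l
      · exact Algebra.subset_adjoin ⟨⟨i, hi⟩, rfl⟩
      · rw [hl _ (by omega)]; exact zero_mem _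
  rw [htop, Algebra.adjoin_range_eq_range_aeval] at h1
  rw [eq_top_iff]
  intro x _
  obtain ⟨q, rfl⟩ := h1 (Algebra.mem_top : x ∈ _)
  change MvPolynomial.aeval _ q ∈ _
  rw [MvPolynomial.aeval_def, MvPolynomial.eval₂_eq']
  refine Submodule.sum_mem _ fun m _ => ?_
  rw [← Algebra.smul_def]
  exact Submodule.smul_mem _ _ (Submodule.subset_span ⟨m, rfl⟩)

/-- The monomial in `g 1, g 2, …` given by a partition. -/
def boxMono {B : Type} [CommRing B] (g : ℕ → B) : ∀ {a b : ℕ}, Box a b → B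
  | _, _, .noSize _ => 1
  | _, _, .noPart _ => 1
  | _, _, .smaller m => boxMono g m
  | a + 1, _, .cons m => g (a + 1) * boxMono g m

theorem map_boxMono {B B' : Type} [CommRing B] [CommRing B'] (φ : B →+* B') (g : ℕ → B) :
    ∀ {a b : ℕ} (m : Box a b), φ (boxMono g m) = boxMono (fun i => φ (g i)) m
  | _, _, .noSize _ => map_one φ
  | _, _, .noPart _ => map_one φ
  | _, _, .smaller m => map_boxMono φ g m
  | a + 1, _, .cons m => by rw [boxMono, boxMono, map_mul, map_boxMono]

theorem span_one_of_adjoin {A B : Type} [CommRing A] [CommRing B] [Algebra A B] {g : ℕ → B}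
    (h0 : g 0 = 1) (hl : ∀ i, 0 < i → g i = 0) (htop : Algebra.adjoin A (Set.range g) = ⊤)
    {ι : Type} (i : ι) {f : ι → B} (hf : f i = 1) : Submodule.span A (Set.range f) = ⊤ := by
  have h := span_exp_monomials 0 g h0 hl htop
  rw [eq_top_iff, ← h, Submodule.span_le]
  rintro _ ⟨m, rfl⟩
  exact Submodule.subset_span ⟨i, by simp [hf]⟩

/-- If two polynomials of degrees `a` and `b` are inverse to each other as power series, then the
algebra generated by the coefficients `g i` of the first is spanned by the monomials in `g 1, …, g a`
of degree at most `b`.  The top coefficients `g a` and `g' b` have product zero, so the quotient by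
`g a` is of type `(a - 1, b)` and the ideal generated by `g a` is a quotient of an algebra of type
`(a, b - 1)`. -/
theorem span_boxMono {A : Type} [CommRing A] :
    ∀ (a b : ℕ) {B : Type} [CommRing B] [Algebra A B] (g g' : ℕ → B),
      PowerSeries.mk g * PowerSeries.mk g' = 1 → g 0 = 1 → g' 0 = 1 → (∀ i, a < i → g i = 0) →
      (∀ i, b < i → g' i = 0) → Algebra.adjoin A (Set.range g) = ⊤ →
      Submodule.span A (Set.range (boxMono g (a := a) (b := b))) = ⊤
  | 0, b, B, _, _, g, g', _, h0, _, ha, _, htop =>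
    span_one_of_adjoin h0 ha htop (Box.noSize b) rfl
  | a + 1, 0, B, _, _, g, g', hgg, h0, h0', _, hb, htop => by
    have h1 : PowerSeries.mk g' = 1 := by
      ext i
      rw [PowerSeries.coeff_mk, PowerSeries.coeff_one]
      split_ifs with h
      · rw [h, h0']
      · exact hb i (by omega)
    rw [h1, mul_one] at hgg
    refine span_one_of_adjoin h0 (fun i hi => ?_) htop (Box.noPart a) rfl
    have := congrArg (PowerSeries.coeff i) hgg
    rwa [PowerSeries.coeff_mk, PowerSeries.coeff_one, if_neg (by omega)] at this
  | a + 1, b + 1, B, _, _, g, g', hgg, h0, h0', ha, hb, htop => by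
    have htopprod : g (a + 1) * g' (b + 1) = 0 := by
      have h := congrArg (PowerSeries.coeff (a + 1 + (b + 1))) hgg
      rw [PowerSeries.coeff_mul, PowerSeries.coeff_one, if_neg (by omega),
        Finset.sum_eq_single (a + 1, b + 1)] at h
      · simpa using h
      · rintro ⟨i, j⟩ hij hne
        have hij := Finset.HasAntidiagonal.mem_antidiagonal.1 hij
        simp only [PowerSeries.coeff_mk] at hij ⊢
        rcases lt_trichotomy i (a + 1) with h | h | h
        · rw [hb j (by omega), mul_zero]
        · exact absurd (Prod.ext h (by simp only; omega)) hne
        · rw [ha i h, zero_mul]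
      · intro h
        exact absurd (by simp) h
    have quot : ∀ (I : Ideal B), PowerSeries.mk (fun i => Ideal.Quotient.mk I (g i)) *
          PowerSeries.mk (fun i => Ideal.Quotient.mk I (g' i)) = 1 ∧
        Algebra.adjoin A (Set.range fun i => Ideal.Quotient.mk I (g i)) = ⊤ := by
      intro I
      constructor
      · have := congrArg (PowerSeries.map (Ideal.Quotient.mk I)) hgg
        rw [map_mul, map_one] at this
        exact this
      · have := congrArg (Subalgebra.map (Ideal.Quotient.mkₐ A I)) htop
        rw [AlgHom.map_adjoin, ← Set.range_comp, Algebra.map_top,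
          (AlgHom.range_eq_top _).2 (Ideal.Quotient.mkₐ_surjective A I)] at this
        exact this
    have lift : ∀ (I : Ideal B) {a b : ℕ}, Submodule.span A (Set.range
        (boxMono (fun i => Ideal.Quotient.mk I (g i)) (a := a) (b := b))) = ⊤ →
        ∀ x : B, ∃ s ∈ Submodule.span A (Set.range (boxMono g (a := a) (b := b))), x - s ∈ I := by
      intro I a b h x
      have hx : Ideal.Quotient.mkₐ A I x ∈ Submodule.map (Ideal.Quotient.mkₐ A I).toLinearMap
          (Submodule.span A (Set.range (boxMono g (a := a) (b := b)))) := by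
        rw [Submodule.map_span, ← Set.range_comp]
        have e : ((Ideal.Quotient.mkₐ A I).toLinearMap ∘ boxMono g (a := a) (b := b)) =
            boxMono (fun i => Ideal.Quotient.mk I (g i)) := by
          funext m
          exact map_boxMono (Ideal.Quotient.mk I) g m
        rw [e, h]
        trivial
      obtain ⟨s, hs, e⟩ := hx
      exact ⟨s, hs, Ideal.Quotient.eq.1 (Eq.symm e)⟩
    rw [eq_top_iff]
    intro x _
    obtain ⟨s, hs, hxs⟩ := lift (Ideal.span {g (a + 1)}) (span_boxMono a (b + 1)
      (fun i => Ideal.Quotient.mk _ (g i)) (fun i => Ideal.Quotient.mk _ (g' i)) (quot _).1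
      (by simp [h0]) (by simp [h0']) (fun i hi => by
        rcases Nat.lt_or_ge (a + 1) i with h | h
        · simp [ha i h]
        · rw [show i = a + 1 by omega]
          exact Ideal.Quotient.eq_zero_iff_mem.2 (Ideal.mem_span_singleton_self _))
      (fun i hi => by simp [hb i hi]) (quot _).2) x
    obtain ⟨z, hz⟩ := Ideal.mem_span_singleton'.1 hxs
    let I : Ideal B := LinearMap.ker (LinearMap.mulLeft B (g (a + 1)))
    obtain ⟨t, ht, hzt⟩ := lift I (span_boxMono (a + 1) b
      (fun i => Ideal.Quotient.mk _ (g i)) (fun i => Ideal.Quotient.mk _ (g' i)) (quot _).1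
      (by simp [h0]) (by simp [h0']) (fun i hi => by simp [ha i hi])
      (fun i hi => by
        rcases Nat.lt_or_ge (b + 1) i with h | h
        · simp [hb i h]
        · rw [show i = b + 1 by omega]
          exact Ideal.Quotient.eq_zero_iff_mem.2 htopprod) (quot _).2) z
    have hzt : g (a + 1) * (z - t) = 0 := hzt
    have e : x = s + g (a + 1) * t := by linear_combination -hz + hzt
    rw [e]
    refine Submodule.add_mem _ (Submodule.span_mono ?_ hs) ?_
    · rintro _ ⟨m, rfl⟩
      exact ⟨.smaller m, rfl⟩
    · refine Submodule.span_induction (p := fun t _ => g (a + 1) * t ∈ _) ?_ ?_ ?_ ?_ ht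
      · rintro _ ⟨m, rfl⟩
        exact Submodule.subset_span ⟨.cons m, rfl⟩
      · simp
      · intro x y _ _ hx hy
        rw [mul_add]; exact add_mem hx hy
      · intro c x _ hx
        rw [mul_smul_comm]; exact Submodule.smul_mem _ _ hx

/-! ### Homogeneous polynomials and polarization -/

/-- The monomial attached to a multiset of natural numbers. -/
def multMono {k : ℕ} (f : MultN k) : MvPolynomial ℕ ℂ := MvPolynomial.monomial f.1 1

/-- The homogeneous polynomials of degree `k` in the variables `X 0, X 1, …`. -/
def polyDeg (k : ℕ) : Submodule ℂ (MvPolynomial ℕ ℂ) :=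
  Submodule.span ℂ (Set.range (multMono (k := k)))

theorem X_mul_mem_polyDeg {k : ℕ} (a : ℕ) {q : MvPolynomial ℕ ℂ} (hq : q ∈ polyDeg k) :
    MvPolynomial.X a * q ∈ polyDeg (k + 1) := by
  refine Submodule.span_induction (p := fun q _ => MvPolynomial.X a * q ∈ polyDeg (k + 1))
    ?_ ?_ ?_ ?_ hq
  · rintro _ ⟨f, rfl⟩
    refine Submodule.subset_span ⟨⟨Finsupp.single a 1 + f.1, ?_⟩, ?_⟩
    · rw [map_add, Finsupp.degree_single, f.2, add_comm]
    · simp only [multMono, MvPolynomial.X, MvPolynomial.monomial_mul, one_mul]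
  · simp
  · intro p q _ _ hp hq
    rw [mul_add]; exact add_mem hp hq
  · intro c p _ hp
    rw [mul_smul_comm]; exact Submodule.smul_mem _ _ hp

theorem exists_multMono_succ {k : ℕ} (f : MultN (k + 1)) :
    ∃ (a : ℕ) (g : MultN k), multMono f = MvPolynomial.X a * multMono g := by
  have h : f.1 ≠ 0 := fun h => by have := f.2; simp [h] at this
  obtain ⟨a, ha⟩ := Finsupp.ne_iff.1 h
  have e : Finsupp.single a 1 + (f.1 - Finsupp.single a 1) = f.1 := by
    apply add_tsub_cancel_of_le
    rw [Finsupp.single_le_iff]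
    exact Nat.one_le_iff_ne_zero.2 ha
  refine ⟨a, ⟨f.1 - Finsupp.single a 1, ?_⟩, ?_⟩
  · have := congrArg Finsupp.degree e
    rw [map_add, Finsupp.degree_single, f.2] at this
    omega
  · simp only [multMono, MvPolynomial.X, MvPolynomial.monomial_mul, one_mul, e]

theorem multMono_zero (f : MultN 0) : multMono f = 1 := by
  rw [multMono, (Finsupp.degree_eq_zero_iff _).1 f.2]; rfl

theorem polyDeg_zero_eq : polyDeg 0 = Submodule.span ℂ {1} := by
  rw [polyDeg]
  congr 1
  ext q
  constructor
  · rintro ⟨f, rfl⟩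
    exact multMono_zero f
  · rintro rfl
    exact ⟨⟨0, by simp⟩, multMono_zero _⟩

/-- Induction over the generators of `polyDeg (k + 1)`. -/
theorem polyDeg_succ_le {k : ℕ} {N : Submodule ℂ (MvPolynomial ℕ ℂ)}
    (h : ∀ a, ∀ q ∈ polyDeg k, MvPolynomial.X a * q ∈ N) : polyDeg (k + 1) ≤ N := by
  rw [polyDeg, Submodule.span_le]
  rintro _ ⟨f, rfl⟩
  obtain ⟨a, g, e⟩ := exists_multMono_succ f
  rw [e]
  exact h a _ (Submodule.subset_span ⟨g, rfl⟩)

theorem X_zero_pow_mul_mem_polyDeg (m : ℕ) {k : ℕ} {q : MvPolynomial ℕ ℂ} (hq : q ∈ polyDeg k) :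
    MvPolynomial.X 0 ^ m * q ∈ polyDeg (m + k) := by
  induction m with
  | zero => simpa using hq
  | succ m ih =>
    rw [pow_succ', mul_assoc, Nat.add_right_comm]
    exact X_mul_mem_polyDeg 0 ih

theorem iSup_polyDeg : ⨆ k, polyDeg k = ⊤ := by
  rw [eq_top_iff]
  intro q hq
  clear hq
  induction q using MvPolynomial.induction_on' with
  | monomial f c =>
    have : MvPolynomial.monomial f c = c • multMono (⟨f, rfl⟩ : MultN f.degree) := by
      simp only [multMono, MvPolynomial.smul_monomial, smul_eq_mul, mul_one]
    rw [this]
    exact Submodule.smul_mem _ _ (Submodule.mem_iSup_of_mem _ (Submodule.subset_span ⟨_, rfl⟩))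
  | add p q hp hq => exact add_mem hp hq

/-- The derivation `X s ↦ X (s + r)`, multiplication by a power sum in terms of symmetric
functions. -/
def shiftDer (r : ℕ) : Derivation ℂ (MvPolynomial ℕ ℂ) (MvPolynomial ℕ ℂ) :=
  MvPolynomial.mkDerivation ℂ fun s => MvPolynomial.X (s + r)

theorem shiftDer_X (r s : ℕ) : shiftDer r (MvPolynomial.X s) = MvPolynomial.X (s + r) :=
  MvPolynomial.mkDerivation_X _ _ _

theorem shiftDer_mem_polyDeg (r : ℕ) {k : ℕ} {q : MvPolynomial ℕ ℂ} (hq : q ∈ polyDeg k) :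
    shiftDer r q ∈ polyDeg k := by
  induction k generalizing q with
  | zero =>
    rw [polyDeg_zero_eq, Submodule.mem_span_singleton] at hq
    obtain ⟨c, rfl⟩ := hq
    simp
  | succ k ih =>
    refine polyDeg_succ_le (N := (polyDeg (k + 1)).comap (shiftDer r).toLinearMap) ?_ hq
    intro a q hq
    change shiftDer r (MvPolynomial.X a * q) ∈ polyDeg (k + 1)
    rw [Derivation.leibniz, shiftDer_X, smul_eq_mul, smul_eq_mul, mul_comm q]
    exact add_mem (X_mul_mem_polyDeg a (ih hq)) (X_mul_mem_polyDeg _ hq)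

/-- Commuting operators `Y s` together with operators `δ r` that shift their index by `r + 1`. -/
structure ShiftSystem {V : Type*} [AddCommGroup V] [Module ℂ V] (Y δ : ℕ → Module.End ℂ V) :
    Prop where
  comm : ∀ i j, Y i * Y j = Y j * Y i
  shift : ∀ r s, δ r * Y s = Y s * δ r + Y (s + r + 1)

namespace ShiftSystem

variable {V : Type*} [AddCommGroup V] [Module ℂ V] {Y δ : ℕ → Module.End ℂ V}

/-- Evaluation of polynomials at the operators `Y s`. -/
def eval (S : ShiftSystem Y δ) : MvPolynomial ℕ ℂ →ₐ[ℂ] Module.End ℂ V := commAeval Y S.comm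

theorem eval_X (S : ShiftSystem Y δ) (s : ℕ) : S.eval (MvPolynomial.X s) = Y s :=
  commAeval_X _ _ _

theorem shift_eval (S : ShiftSystem Y δ) (r : ℕ) (q : MvPolynomial ℕ ℂ) :
    δ r * S.eval q = S.eval q * δ r + S.eval (shiftDer (r + 1) q) := by
  induction q using MvPolynomial.induction_on with
  | C c =>
    rw [← MvPolynomial.algebraMap_eq, AlgHom.commutes, Derivation.map_algebraMap, map_zero,
      add_zero]
    exact (Algebra.commutes c (δ r)).symm
  | add p q hp hq => simp only [map_add, mul_add, add_mul, hp, hq]; abel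
  | mul_X p i hp =>
    rw [map_mul, eval_X, ← mul_assoc, hp, add_mul, mul_assoc, S.shift, Derivation.leibniz,
      shiftDer_X, map_add, smul_eq_mul, smul_eq_mul, map_mul, eval_X, mul_comm (MvPolynomial.X i),
      map_mul, eval_X, mul_add, mul_assoc, add_assoc, add_assoc]

theorem shift_eval_apply (S : ShiftSystem Y δ) {v : V} (hv : ∀ r, δ r v = 0) (r : ℕ)
    (q : MvPolynomial ℕ ℂ) : δ r (S.eval q v) = S.eval (shiftDer (r + 1) q) v := by
  have := LinearMap.congr_fun (S.shift_eval r q) v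
  simpa [hv] using this

/-- Polarization: the power `Y 0 ^ k` generates all products of `k` operators `Y s` under the
shift operators. -/
theorem eval_mem (S : ShiftSystem Y δ) {v : V} (hv : ∀ r, δ r v = 0) {k : ℕ} {N : Submodule ℂ V}
    (h0 : (Y 0 ^ k) v ∈ N) (hN : ∀ r, ∀ n ∈ N, δ r n ∈ N) {q : MvPolynomial ℕ ℂ}
    (hq : q ∈ polyDeg k) : S.eval q v ∈ N := by
  have key : ∀ m l : ℕ, m + l = k → ∀ q ∈ polyDeg m,
      S.eval (MvPolynomial.X 0 ^ l * q) v ∈ N := by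
    intro m
    induction m with
    | zero =>
      intro l hl q hq
      rw [polyDeg_zero_eq, Submodule.mem_span_singleton] at hq
      obtain ⟨c, rfl⟩ := hq
      obtain rfl : l = k := by omega
      rw [mul_smul_comm, mul_one, map_smul, map_pow, eval_X]
      exact N.smul_mem c h0
    | succ m ih =>
      intro l hl q hq
      refine polyDeg_succ_le (N := N.comap ((LinearMap.applyₗ v).comp
        (S.eval.toLinearMap.comp (LinearMap.mulLeft ℂ (MvPolynomial.X 0 ^ l))))) ?_ hq
      intro a q hq
      change S.eval (MvPolynomial.X 0 ^ l * (MvPolynomial.X a * q)) v ∈ N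
      rcases a with _ | r
      · rw [← mul_assoc, ← pow_succ]
        exact ih (l + 1) (by omega) q hq
      · have h1 := hN r _ (ih (l + 1) (by omega) q hq)
        rw [S.shift_eval_apply hv, Derivation.leibniz, Derivation.leibniz_pow, shiftDer_X] at h1
        have h2 := ih (l + 1) (by omega) _ (shiftDer_mem_polyDeg (r + 1) hq)
        have e : (MvPolynomial.X 0 ^ l * (MvPolynomial.X (r + 1) * q) : MvPolynomial ℕ ℂ) =
            (l + 1 : ℂ)⁻¹ • (((MvPolynomial.X 0 : MvPolynomial ℕ ℂ) ^ (l + 1) • shiftDer (r + 1) q + q •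
              ((l + 1) • (MvPolynomial.X 0 : MvPolynomial ℕ ℂ) ^ (l + 1 - 1) •
                (MvPolynomial.X (0 + (r + 1)) : MvPolynomial ℕ ℂ))) -
              MvPolynomial.X 0 ^ (l + 1) * shiftDer (r + 1) q) := by
          rw [smul_eq_mul, smul_eq_mul, smul_eq_mul, add_sub_cancel_left, mul_smul_comm,
            ← Nat.cast_smul_eq_nsmul ℂ, smul_smul, Nat.cast_succ,
            inv_mul_cancel₀ (Nat.cast_add_one_ne_zero l), one_smul, Nat.add_sub_cancel, zero_add]
          ring
        rw [e, map_smul, map_sub, LinearMap.smul_apply, LinearMap.sub_apply]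
        exact N.smul_mem _ (N.sub_mem h1 h2)
  simpa using key k 0 (add_zero k) q hq

theorem mk_mul_pow (S : ShiftSystem Y δ) (k : ℕ) :
    PowerSeries.mk δ * PowerSeries.mk Y ^ k =
      PowerSeries.mk Y ^ k * PowerSeries.mk δ + dSer (PowerSeries.mk Y ^ k) := by
  have h1 : PowerSeries.mk δ * PowerSeries.mk Y =
      PowerSeries.mk Y * PowerSeries.mk δ + dSer (PowerSeries.mk Y) := by
    ext1 n
    rw [map_add, PowerSeries.coeff_mul, PowerSeries.coeff_mul, coeff_dSer,
      ← Finset.Nat.sum_antidiagonal_swap (f := fun p : ℕ × ℕ =>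
        PowerSeries.coeff p.1 (PowerSeries.mk Y) * PowerSeries.coeff p.2 (PowerSeries.mk δ))]
    simp only [PowerSeries.coeff_mk, Prod.fst_swap, Prod.snd_swap, S.shift, Finset.sum_add_distrib]
    congr 1
    rw [Finset.sum_congr rfl (g := fun _ => Y (n + 1)), Finset.sum_const,
      Finset.Nat.card_antidiagonal]
    intro p hp
    rw [← Finset.HasAntidiagonal.mem_antidiagonal.1 hp, add_comm p.1]
  induction k with
  | zero => simp [dSer_one]
  | succ k ih =>
    rw [pow_succ, ← mul_assoc, ih, add_mul, mul_assoc, h1, dSer_mul, mul_add, mul_assoc, add_assoc,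
      add_comm (dSer _ * _)]

/-- The coefficients of `Y(T)^k` are obtained from `Y 0 ^ k` by the recursion of complete symmetric
functions. -/
theorem coeff_pow_rec (S : ShiftSystem Y δ) {v : V} (hv : ∀ r, δ r v = 0) (k n : ℕ) :
    (n + 1) • PowerSeries.coeff (n + 1) (PowerSeries.mk Y ^ k) v =
      ∑ p ∈ antidiagonal n, δ p.1 (PowerSeries.coeff p.2 (PowerSeries.mk Y ^ k) v) := by
  have h := LinearMap.congr_fun (congrArg (PowerSeries.coeff n) (S.mk_mul_pow k)) v
  rw [map_add, PowerSeries.coeff_mul, PowerSeries.coeff_mul, coeff_dSer] at h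
  simp only [PowerSeries.coeff_mk, LinearMap.sum_apply, LinearMap.add_apply, Module.End.mul_apply,
    hv, map_zero, Finset.sum_const_zero, zero_add, LinearMap.smul_apply] at h
  exact h.symm

end ShiftSystem

attribute [local instance 100] LieRing.ofAssociativeRing

/-! ### The operators of `sl₂[t]` -/

theorem sl2_lie_X_Y : ⁅sl2X, sl2Y⁆ = sl2H := by
  apply Subtype.ext
  rw [LieSubalgebra.coe_bracket, LieRing.of_associative_ring_bracket]
  simp [sl2X, sl2Y, sl2H]

theorem sl2_lie_H_X : ⁅sl2H, sl2X⁆ = (2 : ℂ) • sl2X := by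
  apply Subtype.ext
  rw [LieSubalgebra.coe_bracket, LieRing.of_associative_ring_bracket]
  simp [sl2X, sl2H]; norm_num

theorem sl2_lie_H_Y : ⁅sl2H, sl2Y⁆ = (-2 : ℂ) • sl2Y := by
  apply Subtype.ext
  rw [LieSubalgebra.coe_bracket, LieRing.of_associative_ring_bracket]
  ext i j
  fin_cases i <;> fin_cases j <;> simp [sl2Y, sl2H]
  norm_num

theorem sl2_eq (a : Sl2) : a = a.1 0 1 • sl2X + a.1 1 0 • sl2Y + a.1 0 0 • sl2H := by
  have h : a.1 0 0 + a.1 1 1 = 0 := by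
    have : Matrix.trace a.1 = 0 := a.2
    rwa [Matrix.trace_fin_two] at this
  apply Subtype.ext
  ext i j
  fin_cases i <;> fin_cases j <;> simp [sl2X, sl2Y, sl2H]
  linear_combination h

theorem cur_add (a b : Sl2) (r : ℕ) : cur (a + b) r = cur a r + cur b r :=
  TensorProduct.tmul_add _ _ _

theorem cur_smul (c : ℂ) (a : Sl2) (r : ℕ) : cur (c • a) r = c • cur a r :=
  TensorProduct.tmul_smul _ _ _

/-- The elements `x ⊗ t^r`, `y ⊗ t^r`, `h ⊗ t^r` span `sl₂[t]`. -/
theorem sl2t_induction {p : Sl2t → Prop} (h0 : p 0) (hadd : ∀ a b, p a → p b → p (a + b))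
    (hsmul : ∀ (c : ℂ) a, p a → p (c • a)) (hx : ∀ r, p (cur sl2X r)) (hy : ∀ r, p (cur sl2Y r))
    (hh : ∀ r, p (cur sl2H r)) (z : Sl2t) : p z := by
  induction z using TensorProduct.induction_on with
  | zero => exact h0
  | add a b ha hb => exact hadd a b ha hb
  | tmul f a =>
    induction f using Polynomial.induction_on' with
    | add f g hf hg => rw [TensorProduct.add_tmul]; exact hadd _ _ hf hg
    | monomial r c =>
      have : (Polynomial.monomial r c : ℂ[X]) ⊗ₜ[ℂ] a = c • cur a r := by
        rw [cur, ← Polynomial.smul_X_eq_monomial, TensorProduct.smul_tmul']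
      rw [this, sl2_eq a, cur_add, cur_add, cur_smul, cur_smul, cur_smul]
      exact hsmul _ _ (hadd _ _ (hadd _ _ (hsmul _ _ (hx r)) (hsmul _ _ (hy r)))
        (hsmul _ _ (hh r)))

section Operators

variable (V : Type) [AddCommGroup V] [Module ℂ V] [LieRingModule Sl2t V] [LieModule ℂ Sl2t V]

/-- The operator by which `a ⊗ t^r` acts. -/
def actOp (a : Sl2) (r : ℕ) : Module.End ℂ V := LieModule.toEnd ℂ Sl2t V (cur a r)

variable {V}

theorem actOp_comm (a b : Sl2) (r s : ℕ) :
    actOp V a r * actOp V b s = actOp V b s * actOp V a r + actOp V ⁅a, b⁆ (r + s) := by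
  have h : actOp V ⁅a, b⁆ (r + s) = ⁅actOp V a r, actOp V b s⁆ := by
    rw [actOp, actOp, actOp, ← cur_lie_cur, LieHom.map_lie]
  rw [h, LieRing.of_associative_ring_bracket]
  abel

theorem actOp_smul (c : ℂ) (a : Sl2) (r : ℕ) : actOp V (c • a) r = c • actOp V a r := by
  rw [actOp, cur_smul, map_smul, actOp]

theorem actOp_comm_self (a : Sl2) (r s : ℕ) :
    actOp V a r * actOp V a s = actOp V a s * actOp V a r := by
  rw [actOp_comm, lie_self, ← zero_smul ℂ a, actOp_smul, zero_smul, add_zero]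

theorem actOp_X_Y (r s : ℕ) : actOp V sl2X r * actOp V sl2Y s =
    actOp V sl2Y s * actOp V sl2X r + actOp V sl2H (r + s) := by
  rw [actOp_comm, sl2_lie_X_Y]

theorem actOp_H_X (r s : ℕ) : actOp V sl2H r * actOp V sl2X s =
    actOp V sl2X s * actOp V sl2H r + (2 : ℂ) • actOp V sl2X (r + s) := by
  rw [actOp_comm, sl2_lie_H_X, actOp_smul]

theorem actOp_H_Y (r s : ℕ) : actOp V sl2H r * actOp V sl2Y s =
    actOp V sl2Y s * actOp V sl2H r + (-2 : ℂ) • actOp V sl2Y (r + s) := by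
  rw [actOp_comm, sl2_lie_H_Y, actOp_smul]

/-! ### Vectors satisfying the relations of a global Weyl module -/

/-- The defining relations of the generator of `W(n)`. -/
structure IsWeylVec (n : ℕ) (v : V) : Prop where
  x_zero : ∀ r, actOp V sl2X r v = 0
  h_zero : actOp V sl2H 0 v = (n : ℂ) • v
  y_pow : (actOp V sl2Y 0 ^ (n + 1)) v = 0

theorem x_zero_y_pow (k : ℕ) :
    actOp V sl2X 0 * actOp V sl2Y 0 ^ (k + 1) = actOp V sl2Y 0 ^ (k + 1) * actOp V sl2X 0 +
      (k + 1 : ℂ) • (actOp V sl2Y 0 ^ k * actOp V sl2H 0) -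
      ((k + 1) * k : ℂ) • actOp V sl2Y 0 ^ k := by
  have hh : ∀ k : ℕ, actOp V sl2H 0 * actOp V sl2Y 0 ^ k =
      actOp V sl2Y 0 ^ k * actOp V sl2H 0 - (2 * k : ℂ) • actOp V sl2Y 0 ^ k := by
    intro k
    induction k with
    | zero => simp
    | succ k ih =>
      rw [pow_succ, ← mul_assoc, ih, sub_mul, mul_assoc, actOp_H_Y, mul_add, mul_smul_comm,
        smul_mul_assoc, ← mul_assoc, add_zero, ← pow_succ]
      push_cast
      module
  induction k with
  | zero => simp [actOp_X_Y]
  | succ k ih =>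
    rw [pow_succ, ← mul_assoc, ih, sub_mul, add_mul, mul_assoc, actOp_X_Y, smul_mul_assoc,
      smul_mul_assoc, mul_assoc _ (actOp V sl2H 0), actOp_H_Y, mul_add, mul_add, mul_smul_comm,
      ← mul_assoc, ← mul_assoc, ← pow_succ, ← pow_succ]
    simp only [add_zero]
    push_cast
    module

/-- A highest weight vector of weight `n` on which `y ⊗ 1` is nilpotent is killed by
`(y ⊗ 1)^(n+1)`. -/
theorem y_pow_eq_zero_of_nilpotent {n : ℕ} {v : V} (hx : actOp V sl2X 0 v = 0)
    (hh : actOp V sl2H 0 v = (n : ℂ) • v) {N : ℕ} (hN : (actOp V sl2Y 0 ^ N) v = 0) :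
    (actOp V sl2Y 0 ^ (n + 1)) v = 0 := by
  induction N with
  | zero =>
    have : v = 0 := by simpa using hN
    rw [this, map_zero]
  | succ N ih =>
    by_cases h : N ≤ n
    · rw [show n + 1 = (n - N) + (N + 1) by omega, pow_add, Module.End.mul_apply, hN, map_zero]
    · apply ih
      have e := LinearMap.congr_fun (x_zero_y_pow (V := V) N) v
      simp only [Module.End.mul_apply, hN, map_zero, LinearMap.sub_apply, LinearMap.add_apply, hx,
        LinearMap.smul_apply, hh, map_smul, zero_add, smul_smul] at e
      rw [← sub_smul] at e
      refine (smul_eq_zero.1 e.symm).resolve_left ?_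
      have h1 : ((N : ℂ) + 1) * n - (N + 1) * N = (N + 1) * ((n : ℂ) - N) := by ring
      rw [h1]
      refine mul_ne_zero (Nat.cast_add_one_ne_zero N) (sub_ne_zero.2 ?_)
      exact_mod_cast (by omega : n ≠ N)

/-- The weight space of highest weight vectors is stable under `h ⊗ ℂ[t]`. -/
theorem IsWeylVec.h_mem {n : ℕ} {v : V} (hv : IsWeylVec n v) (r : ℕ) :
    IsWeylVec n (actOp V sl2H r v) := by
  have hx : ∀ s, actOp V sl2X s (actOp V sl2H r v) = 0 := by
    intro s
    have e := LinearMap.congr_fun (actOp_H_X (V := V) r s) v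
    simpa [hv.x_zero] using e.symm
  have hh : actOp V sl2H 0 (actOp V sl2H r v) = (n : ℂ) • actOp V sl2H r v := by
    have e := LinearMap.congr_fun (actOp_comm_self (V := V) sl2H 0 r) v
    rw [Module.End.mul_apply, Module.End.mul_apply, hv.h_zero, map_smul] at e
    exact e
  refine ⟨hx, hh, y_pow_eq_zero_of_nilpotent (hx 0) hh (N := n + 2) ?_⟩
  have comm : ∀ k : ℕ, actOp V sl2H r * actOp V sl2Y 0 ^ (k + 1) =
      actOp V sl2Y 0 ^ (k + 1) * actOp V sl2H r +
        (-2 * (k + 1) : ℂ) • (actOp V sl2Y r * actOp V sl2Y 0 ^ k) := by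
    intro k
    induction k with
    | zero => simp [actOp_H_Y]
    | succ k ih =>
      rw [pow_succ _ (k + 1), ← mul_assoc, ih, add_mul, mul_assoc, actOp_H_Y, mul_add, add_zero,
        mul_smul_comm, ← mul_assoc, smul_mul_assoc, mul_assoc (actOp V sl2Y r), ← pow_succ, ← pow_succ,
        ← ((Commute.pow_right (actOp_comm_self sl2Y r 0) (k + 1)).eq)]
      push_cast
      module
  have e := LinearMap.congr_fun (comm (n + 1)) v
  simp only [Module.End.mul_apply, LinearMap.add_apply, LinearMap.smul_apply, hv.y_pow, map_zero,
    smul_zero, add_zero, pow_succ' _ (n + 1)] at e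
  rw [← Module.End.mul_apply, ← pow_succ'] at e
  exact e.symm

/-- **Garland's identity**: the coefficients of `y(T)^k Λ(T)` of degree `r > n - k` kill a highest
weight vector.  Here `Λ(T) = exp (-∑ (h ⊗ t^r) T^r / r)` is any series with
`Λ' = -∑ (h ⊗ t^(r+1)) T^r Λ` on `v`, whose coefficients map `v` to vectors killed by `x ⊗ t`.  The
commutator of `x ⊗ t` with `y(T)^(k+1) Λ(T)` is `-(k + 1)` times the derivative of `y(T)^k Λ(T)`, so
that the claim for `(k + 1, r)` implies it for `(k, r + 1)`. -/
theorem coeff_y_pow_mul_eq_zero {n : ℕ} {v : V} {Λ : (Module.End ℂ V)⟦X⟧}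
    (h0 : PowerSeries.coeff 0 Λ = 1)
    (hd : ∀ m, PowerSeries.coeff m
      (dSer Λ + PowerSeries.mk (fun s => actOp V sl2H (s + 1)) * Λ) v = 0)
    (hx : ∀ m, actOp V sl2X 1 (PowerSeries.coeff m Λ v) = 0)
    (hy : ∀ k, n < k → (actOp V sl2Y 0 ^ k) v = 0) (r k : ℕ) (hr : n < k + r) :
    PowerSeries.coeff r (PowerSeries.mk (actOp V sl2Y) ^ k * Λ) v = 0 := by
  set y : (Module.End ℂ V)⟦X⟧ := PowerSeries.mk (actOp V sl2Y)
  set hp : (Module.End ℂ V)⟦X⟧ := PowerSeries.mk fun s => actOp V sl2H (s + 1)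
  set x1 : (Module.End ℂ V)⟦X⟧ := PowerSeries.C (actOp V sl2X 1)
  have killed : ∀ (F G : (Module.End ℂ V)⟦X⟧), (∀ m, PowerSeries.coeff m G v = 0) →
      ∀ m, PowerSeries.coeff m (F * G) v = 0 := by
    intro F G hG m
    rw [PowerSeries.coeff_mul, LinearMap.sum_apply]
    exact Finset.sum_eq_zero fun p _ => by rw [Module.End.mul_apply, hG, map_zero]
  have cxy : x1 * y = y * x1 + hp := by
    ext1 m
    rw [map_add, PowerSeries.coeff_C_mul, PowerSeries.coeff_mul_C]
    simp only [y, hp, PowerSeries.coeff_mk, actOp_X_Y, add_comm 1 m]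
  have chy : hp * y = y * hp + (-2 : ℂ) • dSer y := by
    ext1 m
    rw [map_add, PowerSeries.coeff_mul, PowerSeries.coeff_mul, PowerSeries.coeff_smul, coeff_dSer,
      ← Finset.Nat.sum_antidiagonal_swap (f := fun p : ℕ × ℕ =>
        PowerSeries.coeff p.1 y * PowerSeries.coeff p.2 hp)]
    simp only [y, hp, PowerSeries.coeff_mk, Prod.fst_swap, Prod.snd_swap, actOp_H_Y,
      Finset.sum_add_distrib]
    congr 1
    rw [Finset.sum_congr rfl (g := fun _ => (-2 : ℂ) • actOp V sl2Y (m + 1)), Finset.sum_const,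
      Finset.Nat.card_antidiagonal, smul_comm]
    intro p hp
    rw [← Finset.HasAntidiagonal.mem_antidiagonal.1 hp, add_right_comm]
  have cyy : dSer y * y = y * dSer y := by
    ext1 m
    rw [PowerSeries.coeff_mul, PowerSeries.coeff_mul,
      ← Finset.Nat.sum_antidiagonal_swap (f := fun p : ℕ × ℕ =>
        PowerSeries.coeff p.1 y * PowerSeries.coeff p.2 (dSer y))]
    refine Finset.sum_congr rfl fun p _ => ?_
    simp only [y, coeff_dSer, PowerSeries.coeff_mk, Prod.fst_swap, Prod.snd_swap, smul_mul_assoc,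
      mul_smul_comm, actOp_comm_self sl2Y (p.1 + 1)]
  have dpow : ∀ k : ℕ, dSer (y ^ (k + 1)) = (k + 1 : ℂ) • (y ^ k * dSer y) := by
    intro k
    induction k with
    | zero => simp
    | succ k ih =>
      rw [pow_succ, dSer_mul, ih, smul_mul_assoc, mul_assoc, cyy, ← mul_assoc, ← pow_succ]
      push_cast
      module
  have hpow : ∀ k : ℕ, hp * y ^ k = y ^ k * hp + (-2 : ℂ) • dSer (y ^ k) := by
    intro k
    induction k with
    | zero => simp [dSer_one]
    | succ k ih =>
      rw [pow_succ, ← mul_assoc, ih, add_mul, mul_assoc, chy, dSer_mul, mul_add, mul_smul_comm,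
        smul_mul_assoc, ← mul_assoc]
      module
  have xpow : ∀ k : ℕ, x1 * y ^ (k + 1) =
      y ^ (k + 1) * x1 + (k + 1 : ℂ) • (y ^ k * hp - dSer (y ^ k)) := by
    intro k
    induction k with
    | zero => simp [dSer_one, cxy]
    | succ k ih =>
      rw [pow_succ, ← mul_assoc, ih, add_mul, mul_assoc, cxy, mul_add, smul_mul_assoc, sub_mul,
        mul_assoc, chy, mul_add, mul_smul_comm, ← mul_assoc, ← mul_assoc, ← pow_succ, ← pow_succ, dpow,
        show dSer (y ^ k) * y = (k : ℂ) • (y ^ k * dSer y) from ?_]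
      · push_cast
        module
      · rcases k with _ | k
        · simp [dSer_one]
        · rw [dpow, smul_mul_assoc, mul_assoc, cyy, ← mul_assoc, ← pow_succ]
          push_cast
          rfl
  induction r generalizing k with
  | zero =>
    rw [PowerSeries.coeff_mul]
    rw [Finset.Nat.antidiagonal_zero, Finset.sum_singleton, h0, mul_one]
    rw [PowerSeries.coeff_zero_eq_constantCoeff_apply, map_pow,
      ← PowerSeries.coeff_zero_eq_constantCoeff_apply, PowerSeries.coeff_mk]
    exact hy k (by omega)
  | succ r ih =>
    have h1 := ih (k + 1) (by omega)
    have e : dSer (y ^ k * Λ) = -((k + 1 : ℂ)⁻¹ • (x1 * (y ^ (k + 1) * Λ))) +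
        (k + 1 : ℂ)⁻¹ • (y ^ (k + 1) * (x1 * Λ)) + y ^ k * (dSer Λ + hp * Λ) := by
      rw [← mul_assoc x1, xpow, dSer_mul, add_mul, smul_mul_assoc, smul_add, smul_smul,
        inv_mul_cancel₀ (Nat.cast_add_one_ne_zero k), one_smul, sub_mul, mul_add, mul_assoc,
        mul_assoc]
      module
    have h2 : (r + 1) • PowerSeries.coeff (r + 1) (y ^ k * Λ) v = 0 := by
      have := LinearMap.congr_fun (congrArg (PowerSeries.coeff r) e) v
      rw [coeff_dSer, map_add, map_add, map_neg, PowerSeries.coeff_smul, PowerSeries.coeff_smul,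
        PowerSeries.coeff_C_mul] at this
      simp only [LinearMap.add_apply, LinearMap.neg_apply, LinearMap.smul_apply,
        Module.End.mul_apply, h1, map_zero, smul_zero, killed _ _ hd] at this
      rw [killed (y ^ (k + 1)) (x1 * Λ) fun m => by
        rw [PowerSeries.coeff_C_mul, Module.End.mul_apply, hx]] at this
      simpa only [smul_zero, neg_zero, add_zero] using this
    rw [← Nat.cast_smul_eq_nsmul ℂ] at h2
    exact (smul_eq_zero.1 h2).resolve_left (Nat.cast_ne_zero.2 r.succ_ne_zero)

end Operators

/-! ### The universal property of global Weyl modules -/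

theorem u_induction {p : U → Prop} (hc : ∀ c : ℂ, p (algebraMap ℂ U c))
    (hι : ∀ z, p (UniversalEnvelopingAlgebra.ι ℂ z)) (hadd : ∀ a b, p a → p b → p (a + b))
    (hmul : ∀ a b, p a → p b → p (a * b)) (u : U) : p u := by
  let S : Subalgebra ℂ U :=
    { carrier := {u | p u}
      mul_mem' := fun ha hb => hmul _ _ ha hb
      add_mem' := fun ha hb => hadd _ _ ha hb
      algebraMap_mem' := hc }
  let f : Sl2t →ₗ⁅ℂ⁆ S :=
    { toFun := fun z => ⟨UniversalEnvelopingAlgebra.ι ℂ z, hι z⟩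
      map_add' := fun a b => Subtype.ext (map_add _ a b)
      map_smul' := fun c a => Subtype.ext (map_smul _ c a)
      map_lie' := fun {a b} => Subtype.ext (LieHom.map_lie _ a b) }
  have h : (S.val.comp (UniversalEnvelopingAlgebra.lift ℂ f)) = AlgHom.id ℂ U := by
    apply UniversalEnvelopingAlgebra.hom_ext
    ext z
    simp [f]
  have := AlgHom.congr_fun h u
  have h2 := (UniversalEnvelopingAlgebra.lift ℂ f u).2
  rw [show ((UniversalEnvelopingAlgebra.lift ℂ f u : S) : U) = u from this] at h2
  exact h2

section

variable (V : Type) [AddCommGroup V] [Module ℂ V] [LieRingModule Sl2t V] [LieModule ℂ Sl2t V]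

/-- The action of the enveloping algebra on an `sl₂[t]`-module. -/
def uAct : U →ₐ[ℂ] Module.End ℂ V :=
  UniversalEnvelopingAlgebra.lift ℂ (LieModule.toEnd ℂ Sl2t V)

variable {V}

theorem uAct_ι (z : Sl2t) (v : V) : uAct V (UniversalEnvelopingAlgebra.ι ℂ z) v = ⁅z, v⁆ := by
  rw [uAct, UniversalEnvelopingAlgebra.lift_ι_apply, LieModule.toEnd_apply_apply]

theorem uAct_curU (a : Sl2) (r : ℕ) : uAct V (curU a r) = actOp V a r := by
  ext v
  exact uAct_ι _ _

variable {W : Type} [AddCommGroup W] [Module ℂ W] [LieRingModule Sl2t W] [LieModule ℂ Sl2t W]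

theorem lie_mem_of_actOp {N : Submodule ℂ V} (hx : ∀ r, ∀ v ∈ N, actOp V sl2X r v ∈ N)
    (hy : ∀ r, ∀ v ∈ N, actOp V sl2Y r v ∈ N) (hh : ∀ r, ∀ v ∈ N, actOp V sl2H r v ∈ N)
    (z : Sl2t) {v : V} (hv : v ∈ N) : ⁅z, v⁆ ∈ N := by
  refine sl2t_induction (p := fun z => ⁅z, v⁆ ∈ N) ?_ ?_ ?_ ?_ ?_ ?_ z
  · rw [zero_lie]; exact zero_mem _
  · intro a b ha hb
    rw [add_lie]; exact add_mem ha hb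
  · intro c a ha
    have e : ⁅c • a, v⁆ = c • ⁅a, v⁆ := smul_lie c a v
    rw [e]; exact N.smul_mem c ha
  · exact fun r => hx r v hv
  · exact fun r => hy r v hv
  · exact fun r => hh r v hv

/-- A subspace stable under the operators `x ⊗ t^r`, `y ⊗ t^r`, `h ⊗ t^r` is a submodule. -/
def lieSubmoduleOf (N : Submodule ℂ V) (hx : ∀ r, ∀ v ∈ N, actOp V sl2X r v ∈ N)
    (hy : ∀ r, ∀ v ∈ N, actOp V sl2Y r v ∈ N) (hh : ∀ r, ∀ v ∈ N, actOp V sl2H r v ∈ N) :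
    LieSubmodule ℂ Sl2t V :=
  { N with lie_mem := fun {z _} hv => lie_mem_of_actOp hx hy hh z hv }

theorem map_uAct (f : V →ₗ⁅ℂ,Sl2t⁆ W) (u : U) : ∀ v, f (uAct V u v) = uAct W u (f v) := by
  induction u using u_induction with
  | hc c => intro v; simp [AlgHom.commutes]
  | hι z => intro v; rw [uAct_ι, uAct_ι, LieModuleHom.map_lie]
  | hadd a b ha hb => intro v; simp [ha, hb]
  | hmul a b ha hb => intro v; simp [ha, hb]

theorem map_actOp (f : V →ₗ⁅ℂ,Sl2t⁆ W) (a : Sl2) (r : ℕ) (v : V) :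
    f (actOp V a r v) = actOp W a r (f v) := LieModuleHom.map_lie f _ _

theorem uAct_mem (N : LieSubmodule ℂ Sl2t V) (u : U) : ∀ v ∈ N, uAct V u v ∈ N := by
  induction u using u_induction with
  | hc c =>
    intro v hv
    rw [AlgHom.commutes]
    exact N.smul_mem c hv
  | hι z => intro v hv; rw [uAct_ι]; exact N.lie_mem hv
  | hadd a b ha hb => intro v hv; rw [map_add]; exact N.add_mem (ha v hv) (hb v hv)
  | hmul a b ha hb => intro v hv; rw [map_mul]; exact ha _ (hb v hv)

end

theorem uAct_weyl {n : ℕ} (u : U) : ∀ v : Weyl n, uAct (Weyl n) u v = u • v := by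
  induction u using u_induction with
  | hc c => intro v; rw [AlgHom.commutes, algebraMap_smul]; rfl
  | hι z => intro v; rw [uAct_ι, lie_weyl]
  | hadd a b ha hb => intro v; rw [map_add, add_smul, LinearMap.add_apply, ha, hb]
  | hmul a b ha hb => intro v; rw [map_mul, mul_smul, Module.End.mul_apply, ha, hb]

theorem smul_weylGen {n : ℕ} (u : U) : u • weylGen n = (weylIdeal n).mkQ u := by
  rw [weylGen]
  refine ((weylIdeal n).mkQ.map_smul u 1).symm.trans ?_
  rw [smul_eq_mul, mul_one]

theorem exists_smul_weylGen {n : ℕ} (v : Weyl n) : ∃ u : U, v = u • weylGen n := by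
  obtain ⟨u, rfl⟩ := (weylIdeal n).mkQ_surjective v
  exact ⟨u, (smul_weylGen u).symm⟩

theorem smul_weylGen_eq_zero {n : ℕ} {u : U} (h : u ∈ weylIdeal n) : u • weylGen n = 0 := by
  rw [smul_weylGen]
  exact (Submodule.Quotient.mk_eq_zero _).2 h

theorem isWeylVec_weylGen (n : ℕ) : IsWeylVec n (weylGen n) := by
  refine ⟨fun r => ?_, ?_, ?_⟩
  · rw [← uAct_curU, uAct_weyl]
    exact smul_weylGen_eq_zero (Submodule.subset_span (Or.inl ⟨r, rfl⟩))
  · have h := smul_weylGen_eq_zero (n := n) (Submodule.subset_span (Or.inr (Or.inl rfl)))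
    rw [sub_smul, sub_eq_zero] at h
    rw [← uAct_curU, uAct_weyl, h, ← map_natCast (algebraMap ℂ U), algebraMap_smul]
  · rw [← uAct_curU, ← map_pow, uAct_weyl]
    exact smul_weylGen_eq_zero (Submodule.subset_span (Or.inr (Or.inr rfl)))

theorem exists_weylLift {V : Type} [AddCommGroup V] [Module ℂ V] [LieRingModule Sl2t V]
    [LieModule ℂ Sl2t V] {n : ℕ} {v : V} (hv : IsWeylVec n v) :
    ∃ f : Weyl n →ₗ⁅ℂ,Sl2t⁆ V, f (weylGen n) = v := by
  let : Module U V := Module.compHom V (uAct V).toRingHom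
  have hsmul : ∀ (u : U) (v : V), u • v = uAct V u v := fun _ _ => rfl
  have : IsScalarTower ℂ U V := ⟨fun c u v => by
    rw [hsmul, hsmul, map_smul, LinearMap.smul_apply]⟩
  let f : Weyl n →ₗ[U] V := (weylIdeal n).liftQ (LinearMap.toSpanSingleton U V v) (by
    rw [weylIdeal, Submodule.span_le]
    rintro _ (⟨r, rfl⟩ | rfl | rfl)
    · rw [SetLike.mem_coe, LinearMap.mem_ker, LinearMap.toSpanSingleton_apply, hsmul, uAct_curU,
        hv.x_zero]
    · rw [SetLike.mem_coe, LinearMap.mem_ker, LinearMap.toSpanSingleton_apply, hsmul, map_sub,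
        LinearMap.sub_apply, uAct_curU, hv.h_zero, map_natCast, sub_eq_zero]
      exact (Nat.cast_smul_eq_nsmul ℂ n v).trans rfl
    · rw [SetLike.mem_coe, LinearMap.mem_ker, LinearMap.toSpanSingleton_apply, hsmul, map_pow,
        uAct_curU, hv.y_pow])
  have hf : f (weylGen n) = v := by
    change (weylIdeal n).liftQ _ _ ((weylIdeal n).mkQ 1) = v
    rw [Submodule.mkQ_apply, Submodule.liftQ_apply, LinearMap.toSpanSingleton_apply, one_smul]
  exact ⟨{ f.restrictScalars ℂ with
    map_lie' := fun {z w} => by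
      change f ((UniversalEnvelopingAlgebra.ι ℂ z : U) • w) = ⁅z, f w⁆
      rw [map_smul, hsmul, uAct_ι] }, hf⟩

theorem weyl_eq_top {n : ℕ} (N : LieSubmodule ℂ Sl2t (Weyl n)) (h : weylGen n ∈ N) (v : Weyl n) :
    v ∈ N := by
  obtain ⟨u, rfl⟩ := exists_smul_weylGen v
  rw [← uAct_weyl]
  exact uAct_mem N u _ h

theorem weylHom_ext {V : Type} [AddCommGroup V] [Module ℂ V] [LieRingModule Sl2t V]
    [LieModule ℂ Sl2t V] {n : ℕ} {f g : Weyl n →ₗ⁅ℂ,Sl2t⁆ V}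
    (h : f (weylGen n) = g (weylGen n)) : f = g := by
  ext v
  obtain ⟨u, rfl⟩ := exists_smul_weylGen v
  rw [← uAct_weyl, map_uAct, map_uAct, h]

/-! ### The endomorphisms of a global Weyl module -/

/-- The endomorphism of `W(n)` with `w_n ↦ (h ⊗ t^r) w_n`. -/
def rho (n r : ℕ) : Weyl n →ₗ⁅ℂ,Sl2t⁆ Weyl n :=
  (exists_weylLift ((isWeylVec_weylGen n).h_mem r)).choose

theorem rho_gen (n r : ℕ) : rho n r (weylGen n) = actOp _ sl2H r (weylGen n) :=
  (exists_weylLift ((isWeylVec_weylGen n).h_mem r)).choose_spec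

/-- `rho n r` as a linear endomorphism. -/
def rhoEnd (n r : ℕ) : Module.End ℂ (Weyl n) := (rho n r : Weyl n →ₗ[ℂ] Weyl n)

theorem rhoEnd_apply (n r : ℕ) (v : Weyl n) : rhoEnd n r v = rho n r v := rfl

theorem rhoEnd_gen (n r : ℕ) : rhoEnd n r (weylGen n) = actOp _ sl2H r (weylGen n) := rho_gen n r

theorem rhoEnd_actOp (n r : ℕ) (a : Sl2) (s : ℕ) :
    rhoEnd n r * actOp _ a s = actOp _ a s * rhoEnd n r :=
  LinearMap.ext fun v => map_actOp (rho n r) a s v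

theorem rhoEnd_comm (n r s : ℕ) : rhoEnd n r * rhoEnd n s = rhoEnd n s * rhoEnd n r := by
  have h : (rho n r).comp (rho n s) = (rho n s).comp (rho n r) := by
    apply weylHom_ext
    rw [LieModuleHom.comp_apply, LieModuleHom.comp_apply, rho_gen, rho_gen, map_actOp, map_actOp,
      rho_gen, rho_gen]
    exact LinearMap.congr_fun (actOp_comm_self (V := Weyl n) sl2H s r) _
  exact LinearMap.ext fun v => LieModuleHom.congr_fun h v

/-- The operator by which a power sum in the positions of the vectors `y` acts. -/
def delta (n r : ℕ) : Module.End ℂ (Weyl n) :=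
  (2⁻¹ : ℂ) • (rhoEnd n (r + 1) - actOp _ sl2H (r + 1))

theorem delta_gen (n r : ℕ) : delta n r (weylGen n) = 0 := by
  simp [delta, rhoEnd_gen]

theorem shiftSystem_weyl (n : ℕ) : ShiftSystem (actOp (Weyl n) sl2Y) (delta n) where
  comm := actOp_comm_self sl2Y
  shift r s := by
    rw [delta, smul_mul_assoc, sub_mul, actOp_H_Y, rhoEnd_actOp, mul_smul_comm, mul_sub,
      show r + 1 + s = s + r + 1 by ring]
    module

/-! ### Operators of a given degree -/

/-- The operator `f` raises degrees by `d`. -/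
def HasDeg {V : Type} [AddCommGroup V] [Module ℂ V] (𝒱 : ℤ → Submodule ℂ V) (d : ℕ)
    (f : Module.End ℂ V) : Prop := ∀ s, ∀ v ∈ 𝒱 s, f v ∈ 𝒱 (d + s)

section HasDeg

variable {V : Type} [AddCommGroup V] [Module ℂ V] {𝒱 : ℤ → Submodule ℂ V}

theorem HasDeg.one : HasDeg 𝒱 0 1 := fun s v hv => by simpa using hv

theorem HasDeg.mul {d e : ℕ} {f g : Module.End ℂ V} (hf : HasDeg 𝒱 d f) (hg : HasDeg 𝒱 e g) :
    HasDeg 𝒱 (d + e) (f * g) := fun s v hv => by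
  rw [Nat.cast_add, add_assoc]
  exact hf _ _ (hg _ _ hv)

theorem HasDeg.add {d : ℕ} {f g : Module.End ℂ V} (hf : HasDeg 𝒱 d f) (hg : HasDeg 𝒱 d g) :
    HasDeg 𝒱 d (f + g) := fun _ _ hv => add_mem (hf _ _ hv) (hg _ _ hv)

theorem HasDeg.smul {d : ℕ} {f : Module.End ℂ V} (hf : HasDeg 𝒱 d f) (c : ℂ) :
    HasDeg 𝒱 d (c • f) := fun _ _ hv => Submodule.smul_mem _ _ (hf _ _ hv)

theorem HasDeg.sub {d : ℕ} {f g : Module.End ℂ V} (hf : HasDeg 𝒱 d f) (hg : HasDeg 𝒱 d g) :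
    HasDeg 𝒱 d (f - g) := fun _ _ hv => sub_mem (hf _ _ hv) (hg _ _ hv)

theorem HasDeg.sum {ι : Type*} {d : ℕ} {f : ι → Module.End ℂ V} {s : Finset ι}
    (hf : ∀ i ∈ s, HasDeg 𝒱 d (f i)) : HasDeg 𝒱 d (∑ i ∈ s, f i) := fun r v hv => by
  rw [LinearMap.sum_apply]
  exact Submodule.sum_mem _ fun i hi => hf i hi r v hv

theorem HasDeg.pow {d : ℕ} {f : Module.End ℂ V} (hf : HasDeg 𝒱 d f) (m : ℕ) :
    HasDeg 𝒱 (d * m) (f ^ m) := by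
  induction m with
  | zero => exact HasDeg.one
  | succ m ih => rw [pow_succ, mul_add, mul_one]; exact ih.mul hf

theorem hasDeg_expC {R : Type*} [CommRing R] [Algebra ℂ R] (φ : R →ₐ[ℂ] Module.End ℂ V)
    {p : ℕ → R} (hp : ∀ i, HasDeg 𝒱 (i + 1) (φ (p i))) (m : ℕ) : HasDeg 𝒱 m (φ (expC p m)) := by
  induction m using Nat.strong_induction_on with
  | _ m ih =>
    rcases m with _ | m
    · rw [expC_zero, map_one]; exact HasDeg.one
    · have e : φ (expC p (m + 1)) = (-(m + 1 : ℂ)⁻¹) •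
          ∑ i : Fin (m + 1), φ (p i) * φ (expC p (m - i)) := by
        rw [expC, map_neg, map_smul, map_sum, neg_smul]
        simp
      rw [e]
      refine (HasDeg.sum fun i _ => ?_).smul _
      have := (hp i).mul (ih (m - i) (by omega))
      rwa [show i.1 + 1 + (m - i.1) = m + 1 by omega] at this

theorem hasDeg_expMono {R : Type*} [CommRing R] [Algebra ℂ R] (φ : R →ₐ[ℂ] Module.End ℂ V)
    {g : ℕ → R} (hg : ∀ i, HasDeg 𝒱 i (φ (g i))) {l : ℕ} (m : Fin l → ℕ) :
    HasDeg 𝒱 (expDeg l m) (φ (∏ i : Fin l, g (i + 1) ^ m i)) := by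
  induction l with
  | zero => simpa [expDeg] using HasDeg.one
  | succ l ih =>
    rw [Fin.prod_univ_castSucc, map_mul, expDeg, Fin.sum_univ_castSucc, map_pow]
    exact (ih fun i => m i.castSucc).mul ((hg (l + 1)).pow _)

theorem hasDeg_boxMono {R : Type} [CommRing R] [Algebra ℂ R] (φ : R →ₐ[ℂ] Module.End ℂ V)
    {g : ℕ → R} (hg : ∀ i, HasDeg 𝒱 i (φ (g i))) :
    ∀ {a b : ℕ} (m : Box a b), HasDeg 𝒱 (boxDeg m) (φ (boxMono g m))
  | _, _, .noSize _ => by rw [boxMono, map_one]; exact HasDeg.one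
  | _, _, .noPart _ => by rw [boxMono, map_one]; exact HasDeg.one
  | _, _, .smaller m => hasDeg_boxMono φ hg m
  | a + 1, _, .cons m => by
    rw [boxMono, map_mul, boxDeg, add_comm]
    exact (hg (a + 1)).mul (hasDeg_boxMono φ hg m)

theorem ShiftSystem.hasDeg_eval {Y δ : ℕ → Module.End ℂ V} (S : ShiftSystem Y δ)
    (hY : ∀ s, HasDeg 𝒱 s (Y s)) : ∀ {k : ℕ} (f : MultN k),
    HasDeg 𝒱 (multDeg f) (S.eval (multMono f)) := by
  intro k
  induction k with
  | zero =>
    intro f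
    rw [multMono_zero, map_one, multDeg, (Finsupp.degree_eq_zero_iff _).1 f.2, map_zero]
    exact HasDeg.one
  | succ k ih =>
    intro f
    obtain ⟨a, g, e⟩ := exists_multMono_succ f
    have hd : multDeg f = a + multDeg g := by
      have h := congrArg MvPolynomial.support e
      simp only [multMono, MvPolynomial.X, MvPolynomial.monomial_mul, one_mul,
        MvPolynomial.support_monomial, one_ne_zero, if_false, Finset.singleton_inj] at h
      rw [multDeg, h, map_add, Finsupp.weight_single, one_smul]
      rfl
    rw [e, map_mul, S.eval_X, hd]
    exact (hY a).mul (ih g)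

end HasDeg

theorem curU_mul_mem_gradeU (a : Sl2) (r : ℕ) {k : ℤ} {z : U} (hz : z ∈ gradeU k) :
    curU a r * z ∈ gradeU (r + k) := by
  refine Submodule.span_induction (p := fun z _ => curU a r * z ∈ gradeU (r + k)) ?_ ?_ ?_ ?_ hz
  · rintro _ ⟨l, hl, rfl⟩
    exact Submodule.subset_span ⟨(a, r) :: l, by simp [← hl], by simp⟩
  · simp
  · intro p q _ _ hp hq
    rw [mul_add]; exact add_mem hp hq
  · intro c p _ hp
    rw [mul_smul_comm]; exact Submodule.smul_mem _ _ hp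

theorem mul_curU_mem_gradeU (a : Sl2) (r : ℕ) {k : ℤ} {z : U} (hz : z ∈ gradeU k) :
    z * curU a r ∈ gradeU (r + k) := by
  refine Submodule.span_induction (p := fun z _ => z * curU a r ∈ gradeU (r + k)) ?_ ?_ ?_ ?_ hz
  · rintro _ ⟨l, hl, rfl⟩
    exact Submodule.subset_span ⟨l ++ [(a, r)], by simp [← hl, add_comm], by simp⟩
  · simp
  · intro p q _ _ hp hq
    rw [add_mul]; exact add_mem hp hq
  · intro c p _ hp
    rw [smul_mul_assoc]; exact Submodule.smul_mem _ _ hp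

theorem one_mem_gradeU : (1 : U) ∈ gradeU 0 := Submodule.subset_span ⟨[], by simp, by simp⟩

theorem mem_weylGrading {n : ℕ} {r : ℤ} {v : Weyl n} :
    v ∈ weylGrading n r ↔ ∃ u ∈ gradeU r, u • weylGen n = v := Iff.rfl

theorem weylGen_mem (n : ℕ) : weylGen n ∈ weylGrading n 0 :=
  mem_weylGrading.2 ⟨1, one_mem_gradeU, one_smul _ _⟩

theorem hasDeg_weyl (n : ℕ) (a : Sl2) (r : ℕ) : HasDeg (weylGrading n) r (actOp _ a r) := by
  intro s v hv
  obtain ⟨u, hu, rfl⟩ := mem_weylGrading.1 hv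
  rw [← uAct_curU, uAct_weyl, ← mul_smul]
  exact mem_weylGrading.2 ⟨_, curU_mul_mem_gradeU a r hu, rfl⟩

theorem hasDeg_rho (n r : ℕ) : HasDeg (weylGrading n) r (rhoEnd n r) := by
  intro s v hv
  obtain ⟨u, hu, rfl⟩ := mem_weylGrading.1 hv
  rw [← uAct_weyl, rhoEnd_apply, map_uAct, rho_gen, ← uAct_curU, ← Module.End.mul_apply, ← map_mul,
    uAct_weyl]
  exact mem_weylGrading.2 ⟨_, mul_curU_mem_gradeU _ r hu, rfl⟩

theorem hasDeg_delta (n r : ℕ) : HasDeg (weylGrading n) (r + 1) (delta n r) :=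
  ((hasDeg_rho n _).sub (hasDeg_weyl n _ _)).smul _

theorem iSup_weylGrading (n : ℕ) : ⨆ r, weylGrading n r = ⊤ := by
  have key : ∀ (a : Sl2) (r : ℕ), ∀ v ∈ ⨆ r, weylGrading n r,
      actOp _ a r v ∈ ⨆ r, weylGrading n r := by
    intro a r v hv
    refine Submodule.iSup_induction (motive := fun v => actOp _ a r v ∈ ⨆ r, weylGrading n r) _ hv
      (fun s v hv => Submodule.mem_iSup_of_mem _ (hasDeg_weyl n a r s v hv))
      (by rw [map_zero]; exact zero_mem _) (fun v w hv hw => by rw [map_add]; exact add_mem hv hw)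
  rw [eq_top_iff]
  intro v _
  exact weyl_eq_top (lieSubmoduleOf _ (fun r => key _ r) (fun r => key _ r) fun r => key _ r)
    (Submodule.mem_iSup_of_mem 0 (weylGen_mem n)) v

/-! ### Spanning sets modulo an ideal -/

theorem exists_sub_mem_of_span {A R : Type} [CommRing A] [CommRing R] [Algebra ℂ A] [Algebra ℂ R]
    (a : A →ₐ[ℂ] R) (J : Ideal R) {g : ℕ → R}
    (htop : Algebra.adjoin ℂ (Set.range a ∪ Set.range g ∪ J) = ⊤) {ι : Type} (mono : ι → R)
    (hspan : ∀ [Algebra A (R ⧸ J)],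
      Algebra.adjoin A (Set.range fun i => Ideal.Quotient.mk J (g i)) = ⊤ →
      Submodule.span A (Set.range fun i => Ideal.Quotient.mk J (mono i)) = ⊤) (r : R) :
    ∃ s ∈ Submodule.span ℂ (Set.range fun p : A × ι => a p.1 * mono p.2), r - s ∈ J := by
  let : Algebra A R := a.toRingHom.toAlgebra
  have hsmul : ∀ (x : A) (r : R), x • r = a x * r := fun _ _ => rfl
  have hA2 : Algebra.adjoin A (Set.range fun i => Ideal.Quotient.mk J (g i)) = ⊤ := by
    rw [eq_top_iff]
    intro r' _
    obtain ⟨r, rfl⟩ := Ideal.Quotient.mk_surjective r'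
    have hr : r ∈ Algebra.adjoin ℂ (Set.range a ∪ Set.range g ∪ J) := by rw [htop]; trivial
    refine Algebra.adjoin_induction (p := fun r _ => Ideal.Quotient.mk J r ∈
      Algebra.adjoin A (Set.range fun i => Ideal.Quotient.mk J (g i)))
      ?_ ?_ (fun x y _ _ hx hy => ?_) (fun x y _ _ hx hy => ?_) hr
    · rintro _ ((⟨x, rfl⟩ | ⟨i, rfl⟩) | hj)
      · exact (Algebra.adjoin A _).algebraMap_mem x
      · exact Algebra.subset_adjoin ⟨i, rfl⟩
      · rw [Ideal.Quotient.eq_zero_iff_mem.2 hj]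
        exact zero_mem _
    · intro c
      rw [← a.commutes c]
      exact (Algebra.adjoin A _).algebraMap_mem _
    · rw [map_add]; exact add_mem hx hy
    · rw [map_mul]; exact mul_mem hx hy
  have hx : Ideal.Quotient.mkₐ A J r ∈ Submodule.map (Ideal.Quotient.mkₐ A J).toLinearMap
      (Submodule.span A (Set.range mono)) := by
    rw [Submodule.map_span, ← Set.range_comp]
    exact (hspan hA2).symm ▸ Submodule.mem_top
  obtain ⟨s, hs, e⟩ := hx
  refine ⟨s, ?_, Ideal.Quotient.eq.1 (Eq.symm e)⟩
  refine Submodule.span_induction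
    (p := fun s _ => s ∈ Submodule.span ℂ (Set.range fun p : A × ι => a p.1 * mono p.2))
    ?_ (zero_mem _) (fun _ _ _ _ => add_mem) ?_ hs
  · rintro _ ⟨i, rfl⟩
    exact Submodule.subset_span ⟨(1, i), by simp⟩
  · intro x s _ hs
    refine Submodule.span_induction
      (p := fun s _ => x • s ∈ Submodule.span ℂ (Set.range fun p : A × ι => a p.1 * mono p.2))
      ?_ (by rw [smul_zero]; exact zero_mem _)
      (fun _ _ _ _ h1 h2 => by rw [smul_add]; exact add_mem h1 h2)
      (fun c y _ h => by
        rw [hsmul, mul_smul_comm, ← hsmul]; exact Submodule.smul_mem _ _ h) hs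
    rintro _ ⟨⟨y, i⟩, rfl⟩
    exact Submodule.subset_span ⟨(x * y, i), by simp only [map_mul, hsmul, mul_assoc]⟩

theorem expC_mem {R : Type*} [CommRing R] [Algebra ℂ R] (S : Subalgebra ℂ R) {p : ℕ → R}
    (h : ∀ n, p n ∈ S) (n : ℕ) : expC p n ∈ S := by
  induction n using Nat.strong_induction_on with
  | _ n ih =>
    rcases n with _ | n
    · rw [expC_zero]; exact S.one_mem
    · rw [expC]
      exact S.neg_mem (S.smul_mem (S.sum_mem fun i _ => S.mul_mem (h _) (ih _ (by omega))) _)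

/-- An operator commuting with the power sums commutes with the elementary symmetric functions. -/
theorem commute_expC {R A : Type*} [CommRing R] [Algebra ℂ R] [Ring A] [Algebra ℂ A]
    (φ : R →ₐ[ℂ] A) {p : ℕ → R} {f : A} (h : ∀ i, Commute f (φ (p i))) (n : ℕ) :
    Commute f (φ (expC p n)) := by
  have := expC_mem ((Subalgebra.centralizer ℂ {f}).comap φ) (p := p) (fun i => by
    rw [Subalgebra.mem_comap, Subalgebra.mem_centralizer_iff]
    rintro _ rfl
    exact h i) n
  rw [Subalgebra.mem_comap, Subalgebra.mem_centralizer_iff] at this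
  exact this f rfl

theorem map_expC_succ {R A : Type*} [CommRing R] [Algebra ℂ R] [Ring A] [Algebra ℂ A]
    (φ : R →ₐ[ℂ] A) (p : ℕ → R) (n : ℕ) : (n + 1) • φ (expC p (n + 1)) =
      ∑ q ∈ antidiagonal n, -(φ (p q.1) * φ (expC p q.2)) := by
  rw [← map_nsmul, expC_succ, map_neg, map_sum, Finset.sum_neg_distrib]
  simp

theorem map_expC_congr {R R' A : Type*} [CommRing R] [Algebra ℂ R] [CommRing R'] [Algebra ℂ R']
    [Ring A] [Algebra ℂ A] {φ : R →ₐ[ℂ] A} {φ' : R' →ₐ[ℂ] A} {p : ℕ → R} {p' : ℕ → R'}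
    (h : ∀ i, φ (p i) = φ' (p' i)) (n : ℕ) : φ (expC p n) = φ' (expC p' n) := by
  refine eq_of_rec (P := fun i v => -(φ (p i) * v)) (u := fun n => φ (expC p n))
    (v := fun n => φ' (expC p' n)) ?_
    (map_expC_succ φ p) ?_ n
  · simp [expC_zero]
  · intro n
    simp only [h]
    exact map_expC_succ φ' p' n

/-- The operator `Λ(T) / V(T)` applied to `Y 0 ^ k v` gives `Y(T)^k Λ(T) v`. -/
theorem ShiftSystem.expC_sub_apply {V : Type*} [AddCommGroup V] [Module ℂ V]
    {Y δ : ℕ → Module.End ℂ V} (S : ShiftSystem Y δ) {R : Type*} [CommRing R] [Algebra ℂ R]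
    (φ : R →ₐ[ℂ] Module.End ℂ V) {p₀ p₁ : ℕ → R} (hδ : ∀ i, φ (p₀ i) = δ i)
    (hρ : ∀ i s, Commute (Y s) (φ (p₁ i))) {v : V} (hv : ∀ r, δ r v = 0) (k m : ℕ) :
    φ (expC (p₁ - p₀) m) ((Y 0 ^ k) v) = PowerSeries.coeff m
      (PowerSeries.mk Y ^ k * PowerSeries.mk fun b => φ (expC p₁ b)) v := by
  have h1 : ∀ w : V, (∀ r, δ r w = 0) → ∀ a, φ (expC (-p₀) a) ((Y 0 ^ k) w) =
      PowerSeries.coeff a (PowerSeries.mk Y ^ k) w := by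
    intro w hw a
    refine eq_of_rec (P := fun i v => δ i v) (u := fun a => φ (expC (-p₀) a) ((Y 0 ^ k) w))
      (v := fun a => PowerSeries.coeff a (PowerSeries.mk Y ^ k) w) ?_ ?_
      (S.coeff_pow_rec hw k) a
    · simp only [expC_zero, map_one, Module.End.one_apply]
      rw [PowerSeries.coeff_zero_eq_constantCoeff_apply, map_pow,
        ← PowerSeries.coeff_zero_eq_constantCoeff_apply, PowerSeries.coeff_mk]
    · intro n
      have := LinearMap.congr_fun (map_expC_succ φ (-p₀) n) ((Y 0 ^ k) w)
      rw [LinearMap.smul_apply, LinearMap.sum_apply] at this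
      rw [this]
      refine Finset.sum_congr rfl fun q _ => ?_
      rw [Pi.neg_apply, map_neg, neg_mul, neg_neg, Module.End.mul_apply, hδ]
  have h2 : ∀ b r, δ r (φ (expC p₁ b) v) = 0 := by
    intro b r
    rw [← hδ, ← Module.End.mul_apply, ← map_mul, mul_comm, map_mul, Module.End.mul_apply, hδ, hv,
      map_zero]
  have e : expC (p₁ - p₀) m = ∑ q ∈ antidiagonal m, expC (-p₀) q.1 * expC p₁ q.2 := by
    rw [← coeff_expS, sub_eq_neg_add, expS_add, PowerSeries.coeff_mul]
    simp only [coeff_expS]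
  rw [e, map_sum, LinearMap.sum_apply, PowerSeries.coeff_mul, LinearMap.sum_apply]
  refine Finset.sum_congr rfl fun q _ => ?_
  have hc : Commute (Y 0 ^ k) (φ (expC p₁ q.2)) :=
    (commute_expC φ (fun i => hρ i 0) q.2).pow_left k
  rw [map_mul, Module.End.mul_apply, Module.End.mul_apply, PowerSeries.coeff_mk, ← h1 _ (h2 _),
    ← Module.End.mul_apply (Y 0 ^ k), hc.eq, Module.End.mul_apply]

theorem mem_of_X_stable {σ V : Type*} [AddCommGroup V] [Module ℂ V]
    (φ : MvPolynomial σ ℂ →ₐ[ℂ] Module.End ℂ V) {N : Submodule ℂ V}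
    (h : ∀ i, ∀ v ∈ N, φ (MvPolynomial.X i) v ∈ N) (q : MvPolynomial σ ℂ) {v : V} (hv : v ∈ N) :
    φ q v ∈ N := by
  induction q using MvPolynomial.induction_on with
  | C c =>
    rw [← MvPolynomial.algebraMap_eq, AlgHom.commutes]
    exact N.smul_mem c hv
  | add p q hp hq => rw [map_add]; exact N.add_mem hp hq
  | mul_X p i hp => rw [mul_comm, map_mul]; exact h i _ hp

/-! ### A spanning set of `W(n)` -/

section

variable (V : Type) [AddCommGroup V] [Module ℂ V] [LieRingModule Sl2t V] [LieModule ℂ Sl2t V]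

/-- Polynomials in the operators `y ⊗ t^s`. -/
def yEval : MvPolynomial ℕ ℂ →ₐ[ℂ] Module.End ℂ V :=
  commAeval (actOp V sl2Y) (actOp_comm_self sl2Y)

variable {V}

theorem yEval_X (s : ℕ) : yEval V (MvPolynomial.X s) = actOp V sl2Y s := commAeval_X _ _ _

theorem actOp_H_yEval (r : ℕ) (q : MvPolynomial ℕ ℂ) :
    actOp V sl2H r * yEval V q =
      yEval V q * actOp V sl2H r + (-2 : ℂ) • yEval V (shiftDer r q) := by
  induction q using MvPolynomial.induction_on with
  | C c =>
    rw [← MvPolynomial.algebraMap_eq, AlgHom.commutes, Derivation.map_algebraMap, map_zero,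
      smul_zero, add_zero]
    exact (Algebra.commutes c _).symm
  | add p q hp hq => simp only [map_add, mul_add, add_mul, hp, hq, smul_add]; abel
  | mul_X p i hp =>
    rw [map_mul, yEval_X, ← mul_assoc, hp, add_mul, mul_assoc, actOp_H_Y, Derivation.leibniz,
      shiftDer_X, map_add, smul_eq_mul, smul_eq_mul, map_mul, yEval_X,
      mul_comm (MvPolynomial.X i), map_mul, yEval_X, mul_add, mul_assoc, smul_mul_assoc,
      mul_smul_comm, add_comm r i]
    module

end

theorem commute_rhoEnd_delta (n r s : ℕ) : Commute (rhoEnd n r) (delta n s) :=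
  (Commute.sub_right (rhoEnd_comm n _ _) (rhoEnd_actOp n _ _ _)).smul_right _

theorem commute_delta (n r s : ℕ) : Commute (delta n r) (delta n s) := by
  refine (Commute.sub_left (commute_rhoEnd_delta n _ _) ?_).smul_left _
  exact (Commute.sub_right (rhoEnd_actOp n _ _ _).symm (actOp_comm_self _ _ _)).smul_right _

/-- The commutative algebra generated by the operators `delta` and `rho`, as the image of a
polynomial ring. -/
def phiW (n : ℕ) : MvPolynomial (ℕ ⊕ ℕ) ℂ →ₐ[ℂ] Module.End ℂ (Weyl n) :=
  commAeval (Sum.elim (delta n) fun i => rhoEnd n (i + 1)) (by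
    rintro (i | i) (j | j)
    · exact commute_delta n i j
    · exact (commute_rhoEnd_delta n (j + 1) i).symm
    · exact commute_rhoEnd_delta n (i + 1) j
    · exact rhoEnd_comm n (i + 1) (j + 1))

theorem phiW_inl (n i : ℕ) : phiW n (MvPolynomial.X (Sum.inl i)) = delta n i := commAeval_X _ _ _

theorem phiW_inr (n i : ℕ) : phiW n (MvPolynomial.X (Sum.inr i)) = rhoEnd n (i + 1) :=
  commAeval_X _ _ _

/-- The elementary symmetric functions in the power sums `rho`: the action of the coefficients of
`Λ(T)` by endomorphisms of `W(n)`. -/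
def lam (n m : ℕ) : Module.End ℂ (Weyl n) :=
  phiW n (expC (fun i => MvPolynomial.X (Sum.inr i)) m)

theorem commute_actOp_lam (n m : ℕ) (a : Sl2) (r : ℕ) : Commute (actOp _ a r) (lam n m) :=
  commute_expC _ (fun i => by rw [phiW_inr]; exact (rhoEnd_actOp n _ a r).symm) m

theorem commute_rhoEnd_lam (n m r : ℕ) : Commute (rhoEnd n r) (lam n m) :=
  commute_expC _ (fun i => by rw [phiW_inr]; exact rhoEnd_comm n _ _) m

/-- Garland's relations in `W(n)`. -/
theorem coeff_y_pow_lam (n r k : ℕ) (h : n < k + r) :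
    PowerSeries.coeff r (PowerSeries.mk (actOp (Weyl n) sl2Y) ^ k * PowerSeries.mk (lam n))
      (weylGen n) = 0 := by
  refine coeff_y_pow_mul_eq_zero (n := n) ?_ ?_ ?_ ?_ r k h
  · rw [PowerSeries.coeff_mk, lam, expC_zero, map_one]
  · intro m
    rw [map_add, coeff_dSer, PowerSeries.coeff_mk, lam, map_expC_succ, PowerSeries.coeff_mul,
      ← Finset.sum_add_distrib, LinearMap.sum_apply]
    refine Finset.sum_eq_zero fun q _ => ?_
    rw [PowerSeries.coeff_mk, PowerSeries.coeff_mk, LinearMap.add_apply, LinearMap.neg_apply,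
      (commute_actOp_lam n q.2 sl2H (q.1 + 1)).eq, phiW_inr, ← lam,
      (commute_rhoEnd_lam n q.2 (q.1 + 1)).eq, Module.End.mul_apply, Module.End.mul_apply,
      rhoEnd_gen, neg_add_cancel]
  · intro m
    rw [PowerSeries.coeff_mk, ← Module.End.mul_apply, (commute_actOp_lam n m sl2X 1).eq,
      Module.End.mul_apply, (isWeylVec_weylGen n).x_zero, map_zero]
  · intro k hk
    obtain ⟨j, rfl⟩ := Nat.exists_eq_add_of_le (show n + 1 ≤ k from hk)
    rw [add_comm, pow_add, Module.End.mul_apply, (isWeylVec_weylGen n).y_pow, map_zero]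

/-- The coefficients of `Λ(T) / V(T)` as polynomials in the power sums, where `Λ(T)` and `V(T)` are
the series `exp (-∑ p_r T^r / r)` for the power sums `rho` and `delta`, respectively. -/
def gW (i : ℕ) : MvPolynomial (ℕ ⊕ ℕ) ℂ :=
  expC ((fun i => MvPolynomial.X (Sum.inr i)) - fun i => MvPolynomial.X (Sum.inl i)) i

theorem phiW_gW (n k i : ℕ) (h : n < k + i) :
    phiW n (gW i) ((actOp _ sl2Y 0 ^ k) (weylGen n)) = 0 := by
  rw [gW, (shiftSystem_weyl n).expC_sub_apply (phiW n) (phiW_inl n)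
    (fun i s => by rw [phiW_inr]; exact (rhoEnd_actOp n _ _ _).symm) (delta_gen n)]
  exact coeff_y_pow_lam n i k h

theorem adjoin_gW : Algebra.adjoin ℂ (Set.range (MvPolynomial.rename (R := ℂ)
    (Sum.inl : ℕ → ℕ ⊕ ℕ)) ∪ Set.range gW) = ⊤ := by
  set S := Algebra.adjoin ℂ (Set.range (MvPolynomial.rename (R := ℂ)
    (Sum.inl : ℕ → ℕ ⊕ ℕ)) ∪ Set.range gW)
  have h1 : ∀ i, (MvPolynomial.X (Sum.inl i) : MvPolynomial (ℕ ⊕ ℕ) ℂ) ∈ S := fun i =>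
    Algebra.subset_adjoin (Or.inl ⟨MvPolynomial.X i, MvPolynomial.rename_X _ _⟩)
  have h2 := mem_of_expC_mem S (p := (fun i => (MvPolynomial.X (Sum.inr i) :
    MvPolynomial (ℕ ⊕ ℕ) ℂ)) - fun i => MvPolynomial.X (Sum.inl i))
    fun n => Algebra.subset_adjoin (Or.inr ⟨n, rfl⟩)
  rw [eq_top_iff, ← MvPolynomial.adjoin_range_X, Algebra.adjoin_le_iff]
  rintro _ ⟨i | i, rfl⟩
  · exact h1 i
  · have := S.add_mem (h2 i) (h1 i)
    rwa [Pi.sub_apply, sub_add_cancel] at this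

/-- The index set of the spanning set of `W(n)`. -/
def SpanIdx (n : ℕ) : Type := Σ k : Fin (n + 1), MultN k × (Fin (n - k) → ℕ)

/-- The spanning set of `W(n)`: a product of `k` operators `y ⊗ t^s` and a monomial in the first
`n - k` coefficients of `Λ(T) / V(T)`. -/
def spanVec (n : ℕ) (i : SpanIdx n) : Weyl n :=
  phiW n (∏ j : Fin (n - i.1), gW (j + 1) ^ i.2.2 j) (yEval _ (multMono i.2.1) (weylGen n))

theorem phiW_y_pow_mem (n k : ℕ) (r : MvPolynomial (ℕ ⊕ ℕ) ℂ) :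
    phiW n r ((actOp _ sl2Y 0 ^ k) (weylGen n)) ∈ Submodule.span ℂ (Set.range (spanVec n)) := by
  set c := (actOp _ sl2Y 0 ^ k) (weylGen n) with hc
  rcases lt_or_ge n k with hk | hk
  · have h0 : c = 0 := by
      have := phiW_gW n k 0 (by omega)
      rwa [gW, expC_zero, map_one, Module.End.one_apply] at this
    rw [h0, map_zero]
    exact zero_mem _
  have hlin : ∀ v : Weyl n, ∀ r s, phiW n (r * s) v = phiW n r (phiW n s v) := fun v r s => by
    rw [map_mul, Module.End.mul_apply]
  let J : Ideal (MvPolynomial (ℕ ⊕ ℕ) ℂ) :=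
    { carrier := {r | phiW n r c = 0}
      add_mem' := fun {a b} ha hb => by
        change phiW n (a + b) c = 0
        rw [map_add, LinearMap.add_apply, show phiW n a c = 0 from ha,
          show phiW n b c = 0 from hb, add_zero]
      zero_mem' := by simp
      smul_mem' := fun s a ha => by
        change phiW n (s * a) c = 0
        rw [hlin, show phiW n a c = 0 from ha, map_zero] }
  obtain ⟨s, hs, hrs⟩ := exists_sub_mem_of_span (MvPolynomial.rename Sum.inl) J
    (top_le_iff.1 (adjoin_gW.ge.trans (Algebra.adjoin_mono Set.subset_union_left)))
    (fun m : Fin (n - k) → ℕ => ∏ j : Fin (n - k), gW (j + 1) ^ m j) (fun htop => by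
      have := span_exp_monomials (n - k) (fun i => Ideal.Quotient.mk J (gW i))
        (by rw [gW, expC_zero, map_one]) (fun i hi => Ideal.Quotient.eq_zero_iff_mem.2
          (phiW_gW n k i (by omega))) htop
      simpa only [map_prod, map_pow] using this) r
  have e : phiW n r c = phiW n s c := by
    have : phiW n (r - s) c = 0 := hrs
    rwa [map_sub, LinearMap.sub_apply, sub_eq_zero] at this
  rw [e]
  refine Submodule.span_induction (p := fun s _ => phiW n s c ∈ _) ?_ ?_ ?_ ?_ hs
  · rintro _ ⟨⟨x, m⟩, rfl⟩
    have hx : phiW n (MvPolynomial.rename Sum.inl x) c ∈ (polyDeg k).map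
        ((LinearMap.applyₗ (weylGen n)).comp (yEval (Weyl n)).toLinearMap) := by
      refine mem_of_X_stable ((phiW n).comp (MvPolynomial.rename Sum.inl)) ?_ x ?_
      · rintro i _ ⟨q, hq, rfl⟩
        rw [AlgHom.comp_apply, MvPolynomial.rename_X, phiW_inl]
        exact ⟨_, shiftDer_mem_polyDeg (i + 1) hq,
          ((shiftSystem_weyl n).shift_eval_apply (delta_gen n) i q).symm⟩
      · refine ⟨MvPolynomial.X 0 ^ k * 1, X_zero_pow_mul_mem_polyDeg k (k := 0) ?_, ?_⟩
        · rw [polyDeg_zero_eq]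
          exact Submodule.mem_span_singleton_self _
        · rw [mul_one]
          change yEval _ (MvPolynomial.X 0 ^ k) (weylGen n) = c
          rw [map_pow, yEval_X]
    obtain ⟨q, hq, e⟩ := hx
    simp only []
    rw [mul_comm, hlin, ← e]
    change phiW n _ (yEval _ q (weylGen n)) ∈ _
    refine Submodule.span_induction (p := fun q _ => phiW n _ (yEval _ q (weylGen n)) ∈ _)
      ?_ ?_ ?_ ?_ hq
    · rintro _ ⟨f, rfl⟩
      exact Submodule.subset_span ⟨⟨⟨k, by omega⟩, f, m⟩, rfl⟩
    · simp
    · intro p q _ _ hp hq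
      rw [map_add, LinearMap.add_apply, map_add]; exact add_mem hp hq
    · intro d p _ hp
      rw [map_smul, LinearMap.smul_apply, map_smul]; exact Submodule.smul_mem _ _ hp
  · simp
  · intro p q _ _ hp hq
    rw [map_add, LinearMap.add_apply]; exact add_mem hp hq
  · intro d p _ hp
    rw [map_smul, LinearMap.smul_apply]; exact Submodule.smul_mem _ _ hp

theorem commute_actOp_phiW (n : ℕ) (a : Sl2) (r : ℕ) (p : MvPolynomial ℕ ℂ) :
    Commute (actOp _ a r) (phiW n (MvPolynomial.rename Sum.inr p)) := by
  induction p using MvPolynomial.induction_on with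
  | C c =>
    rw [MvPolynomial.rename_C, ← MvPolynomial.algebraMap_eq, AlgHom.commutes]
    exact (Algebra.commutes c _).symm
  | add p q hp hq => rw [map_add, map_add]; exact hp.add_right hq
  | mul_X p i hp =>
    rw [map_mul, map_mul, MvPolynomial.rename_X, phiW_inr]
    exact hp.mul_right (rhoEnd_actOp n _ a r).symm

/-- `W(n)` is spanned by the vectors `p(ρ) q(y) w_n` with polynomials `p` and `q`. -/
theorem span_rho_y (n : ℕ) : Submodule.span ℂ
    (Set.range fun x : MvPolynomial ℕ ℂ × MvPolynomial ℕ ℂ =>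
      phiW n (MvPolynomial.rename Sum.inr x.1) (yEval _ x.2 (weylGen n))) = ⊤ := by
  set N := Submodule.span ℂ (Set.range fun x : MvPolynomial ℕ ℂ × MvPolynomial ℕ ℂ =>
      phiW n (MvPolynomial.rename Sum.inr x.1) (yEval _ x.2 (weylGen n)))
  have mem : ∀ p q, phiW n (MvPolynomial.rename Sum.inr p) (yEval _ q (weylGen n)) ∈ N :=
    fun p q => Submodule.subset_span ⟨(p, q), rfl⟩
  have ext : ∀ f : Module.End ℂ (Weyl n),
      (∀ p q, f (phiW n (MvPolynomial.rename Sum.inr p) (yEval _ q (weylGen n))) ∈ N) →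
      ∀ v ∈ N, f v ∈ N := by
    intro f hf v hv
    refine (Submodule.span_le (p := N.comap f)).2 ?_ hv
    rintro _ ⟨x, rfl⟩
    exact hf x.1 x.2
  have comm : ∀ (a : Sl2) r p v, actOp _ a r (phiW n (MvPolynomial.rename Sum.inr p) v) =
      phiW n (MvPolynomial.rename Sum.inr p) (actOp _ a r v) := fun a r p v =>
    LinearMap.congr_fun (commute_actOp_phiW n a r p).eq v
  have hρ : ∀ p, ∀ v ∈ N, phiW n (MvPolynomial.rename Sum.inr p) v ∈ N := fun p =>
    ext _ fun p' q => by
      rw [← Module.End.mul_apply, ← map_mul, ← map_mul]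
      exact mem _ _
  have hy : ∀ r, ∀ v ∈ N, actOp _ sl2Y r v ∈ N := fun r => ext _ fun p q => by
    rw [comm, ← yEval_X, ← Module.End.mul_apply (yEval _ _), ← map_mul]
    exact mem _ _
  have hhq : ∀ r q, actOp _ sl2H r (yEval _ q (weylGen n)) ∈ N := by
    intro r q
    rw [← Module.End.mul_apply, actOp_H_yEval, LinearMap.add_apply, Module.End.mul_apply]
    refine add_mem ?_ (N.smul_mem _ (by simpa using mem 1 (shiftDer r q)))
    rcases r with _ | r
    · rw [(isWeylVec_weylGen n).h_zero, map_smul]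
      exact N.smul_mem _ (by simpa using mem 1 q)
    · have e : actOp _ sl2H (r + 1) (weylGen n) =
          phiW n (MvPolynomial.rename Sum.inr (MvPolynomial.X r)) (weylGen n) := by
        rw [MvPolynomial.rename_X, phiW_inr, rhoEnd_gen]
      have hc : Commute (yEval (Weyl n) q)
          (phiW n (MvPolynomial.rename Sum.inr (MvPolynomial.X r))) := by
        induction q using MvPolynomial.induction_on with
        | C c =>
          rw [← MvPolynomial.algebraMap_eq, AlgHom.commutes]
          exact Algebra.commutes c _
        | add p q hp hq => rw [map_add]; exact hp.add_left hq
        | mul_X p i hp =>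
          rw [map_mul, yEval_X]
          exact hp.mul_left (commute_actOp_phiW n _ _ _)
      rw [e, ← Module.End.mul_apply, hc.eq]
      exact mem _ _
  have hh : ∀ r, ∀ v ∈ N, actOp _ sl2H r v ∈ N := fun r => ext _ fun p q => by
    rw [comm]; exact hρ p _ (hhq r q)
  have hxq : ∀ r q, actOp _ sl2X r (yEval _ q (weylGen n)) ∈ N := by
    intro r q
    induction q using MvPolynomial.induction_on with
    | C c =>
      rw [← MvPolynomial.algebraMap_eq, AlgHom.commutes]
      change actOp _ sl2X r (c • weylGen n) ∈ N
      rw [map_smul, (isWeylVec_weylGen n).x_zero, smul_zero]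
      exact zero_mem _
    | add p q hp hq => rw [map_add, LinearMap.add_apply, map_add]; exact add_mem hp hq
    | mul_X p i hp =>
      rw [mul_comm, map_mul, yEval_X, ← Module.End.mul_apply, ← mul_assoc, actOp_X_Y, add_mul,
        LinearMap.add_apply]
      exact add_mem (hy _ _ hp) (hhq _ _)
  have hx : ∀ r, ∀ v ∈ N, actOp _ sl2X r v ∈ N := fun r => ext _ fun p q => by
    rw [comm]; exact hρ p _ (hxq r q)
  rw [eq_top_iff]
  intro v _
  have h1 : weylGen n ∈ N := by simpa using mem 1 1
  exact weyl_eq_top (lieSubmoduleOf N hx hy hh) h1 v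

theorem span_spanVec (n : ℕ) : Submodule.span ℂ (Set.range (spanVec n)) = ⊤ := by
  rw [eq_top_iff, ← span_rho_y n, Submodule.span_le]
  rintro _ ⟨⟨p, q⟩, rfl⟩
  rw [SetLike.mem_coe]
  have hq : q ∈ ⨆ k, polyDeg k := by rw [iSup_polyDeg]; trivial
  simp only []
  induction hq using Submodule.iSup_induction' with
  | mem k q hq =>
    have := (shiftSystem_weyl n).eval_mem (delta_gen n) (k := k)
      (N := LinearMap.range ((LinearMap.applyₗ ((actOp _ sl2Y 0 ^ k) (weylGen n))).comp
        (phiW n).toLinearMap)) ⟨1, by simp⟩ (by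
          rintro r _ ⟨s, rfl⟩
          refine ⟨MvPolynomial.X (Sum.inl r) * s, ?_⟩
          simp [phiW_inl]) hq
    obtain ⟨s, e⟩ := this
    change phiW n s ((actOp _ sl2Y 0 ^ k) (weylGen n)) = yEval _ q (weylGen n) at e
    rw [← e, ← Module.End.mul_apply, ← map_mul]
    exact phiW_y_pow_mem n k _
  | zero => simp
  | add p q _ _ hp hq => rw [map_add, LinearMap.add_apply, map_add]; exact add_mem hp hq

/-- The degree of a vector of the spanning set. -/
def spanDeg (n : ℕ) (i : SpanIdx n) : ℕ := expDeg (n - i.1) i.2.2 + multDeg i.2.1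

theorem spanVec_mem (n : ℕ) (i : SpanIdx n) : spanVec n i ∈ weylGrading n (spanDeg n i) := by
  have hδ : ∀ i, HasDeg (weylGrading n) (i + 1)
      (phiW n (MvPolynomial.X (Sum.inr i) - MvPolynomial.X (Sum.inl i))) := by
    intro i
    rw [map_sub, phiW_inl, phiW_inr]
    exact (hasDeg_rho n _).sub (hasDeg_delta n i)
  have h1 := hasDeg_expMono (phiW n) (g := gW) (fun m => hasDeg_expC (phiW n) hδ m) i.2.2
  have h2 := (shiftSystem_weyl n).hasDeg_eval (hasDeg_weyl n sl2Y) i.2.1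
  have := (h1.mul h2) 0 _ (weylGen_mem n)
  rw [add_zero] at this
  exact this

theorem finFib_spanDeg (n : ℕ) : FinFib (spanDeg n) := by
  have := FinFib.sigma (fun k : Fin (n + 1) =>
    (finFib_multDeg k).prod (finFib_expDeg_and_genFun (n - k)).1)
  refine this.congr (Equiv.refl _) fun i => ?_
  rw [spanDeg, add_comm]
  rfl

theorem genFun_spanDeg (n : ℕ) : genFun (spanDeg n) =
    ∑ k : Fin (n + 1), oneU k * oneU (n - k) := by
  have := genFun_sigma (fun k : Fin (n + 1) =>
    (finFib_multDeg k).prod (finFib_expDeg_and_genFun (n - k)).1)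
  rw [← genFun_congr (d := fun p : SpanIdx n => multDeg p.2.1 + expDeg (n - p.1) p.2.2)
    (Equiv.refl _) fun i => (add_comm _ _ : spanDeg n i = _)]
  refine this.trans ?_
  refine Finset.sum_congr rfl fun k _ => ?_
  rw [genFun_prod (finFib_multDeg k) (finFib_expDeg_and_genFun (n - k)).1, genFun_multDeg,
    (finFib_expDeg_and_genFun (n - k)).2]

/-! ### Bases of graded spaces -/

/-- A surjective linear map of degree zero between spaces with homogeneous bases, having the same
finite number of basis vectors in every degree, is injective. -/
theorem injective_of_genFun_eq {ι κ : Type*} {d : ι → ℕ} {e : κ → ℕ} (hd : FinFib d)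
    (he : FinFib e) (h : genFun d = genFun e) (T : (ι →₀ ℂ) →ₗ[ℂ] (κ →₀ ℂ))
    (hT : ∀ i, T (Finsupp.single i 1) ∈ Finsupp.supported ℂ ℂ {k | e k = d i})
    (hs : Function.Surjective T) : Function.Injective T := by
  have comm : ∀ (n : ℕ) (x : ι →₀ ℂ),
      T (x.filter fun i => d i = n) = (T x).filter fun k => e k = n := by
    intro n x
    induction x using Finsupp.induction_linear with
    | zero => simp only [Finsupp.filter_zero, map_zero]
    | add x y hx hy => rw [Finsupp.filter_add, map_add, map_add, Finsupp.filter_add, hx, hy]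
    | single i c =>
      have hc : Finsupp.single i c = c • Finsupp.single i 1 := by simp
      have hi := (Finsupp.mem_supported ℂ _).1 (hT i)
      rw [hc, map_smul]
      by_cases hn : d i = n
      · rw [Finsupp.filter_eq_self_iff _ _ |>.2, map_smul, Finsupp.filter_eq_self_iff _ _ |>.2]
        · intro k hk
          have : T (Finsupp.single i 1) k ≠ 0 := fun h0 => hk (by simp [h0])
          rw [← hn]
          exact hi (Finsupp.mem_support_iff.2 this)
        · intro j hj
          by_contra hne
          have : i ≠ j := fun e => hne (e ▸ hn)
          simp [this] at hj
      · rw [Finsupp.filter_eq_zero_iff _ _ |>.2, map_zero, Eq.comm, Finsupp.filter_eq_zero_iff]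
        · intro k hk
          by_contra hne
          have : T (Finsupp.single i 1) k ≠ 0 := fun h0 => hne (by simp [h0])
          exact hn ((hi (Finsupp.mem_support_iff.2 this) : e k = d i) ▸ hk)
        · intro j hj
          have : i ≠ j := fun e => hn (e ▸ hj)
          simp [this]
  rw [injective_iff_map_eq_zero]
  intro x hx
  ext i
  let A := Finsupp.supported ℂ ℂ {j | d j = d i}
  let B := Finsupp.supported ℂ ℂ {k | e k = d i}
  have : Finite {j | d j = d i} := hd (d i)
  have : Finite {k | e k = d i} := he (d i)
  have : Module.Finite ℂ A := Module.Finite.equiv (Finsupp.supportedEquivFinsupp _).symm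
  have : Module.Finite ℂ B := Module.Finite.equiv (Finsupp.supportedEquivFinsupp _).symm
  have hfr : Module.finrank ℂ A = Module.finrank ℂ B := by
    rw [(Finsupp.supportedEquivFinsupp (M := ℂ) (R := ℂ) {j | d j = d i}).finrank_eq,
      (Finsupp.supportedEquivFinsupp (M := ℂ) (R := ℂ) {k | e k = d i}).finrank_eq,
      Module.finrank_eq_nat_card_basis Finsupp.basisSingleOne,
      Module.finrank_eq_nat_card_basis Finsupp.basisSingleOne]
    have := congrArg (PowerSeries.coeff (d i)) h
    simp only [genFun, PowerSeries.coeff_mk] at this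
    exact_mod_cast this
  have hfilter : ∀ (x : ι →₀ ℂ), x.filter (fun j => d j = d i) ∈ A := fun x =>
    (Finsupp.mem_supported ℂ _).2 fun j hj => by
      rw [Finset.mem_coe, Finsupp.support_filter, Finset.mem_filter] at hj
      exact hj.2
  have hfix : ∀ x ∈ A, x.filter (fun j => d j = d i) = x := fun x hx =>
    (Finsupp.filter_eq_self_iff _ _).2 fun j hj =>
      (Finsupp.mem_supported ℂ _).1 hx (Finsupp.mem_support_iff.2 hj)
  have hfix' : ∀ x ∈ B, x.filter (fun k => e k = d i) = x := fun x hx =>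
    (Finsupp.filter_eq_self_iff _ _).2 fun j hj =>
      (Finsupp.mem_supported ℂ _).1 hx (Finsupp.mem_support_iff.2 hj)
  have hmap : ∀ x ∈ A, T x ∈ B := by
    intro x hx
    rw [← hfix x hx, comm]
    exact (Finsupp.mem_supported ℂ _).2 fun j hj => by
      rw [Finset.mem_coe, Finsupp.support_filter, Finset.mem_filter] at hj
      exact hj.2
  have hsurj : Function.Surjective (T.restrict hmap) := by
    rintro ⟨y, hy⟩
    obtain ⟨x, rfl⟩ := hs y
    exact ⟨⟨_, hfilter x⟩, Subtype.ext (by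
      rw [LinearMap.restrict_apply]
      exact (comm _ _).trans (hfix' _ hy))⟩
  have hinj := (LinearMap.injective_iff_surjective_of_finrank_eq_finrank hfr).2 hsurj
  have h0 : T.restrict hmap ⟨_, hfilter x⟩ = 0 := Subtype.ext (by
    rw [LinearMap.restrict_apply]
    exact (comm _ _).trans (by rw [hx, Finsupp.filter_zero]; rfl))
  have h1 := congrArg Subtype.val ((injective_iff_map_eq_zero _).1 hinj _ h0)
  have h2 := DFunLike.congr_fun h1 i
  exact (Finsupp.filter_apply_pos (fun j => d j = d i) x rfl).symm.trans h2

section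

variable {V : Type} [AddCommGroup V] [Module ℂ V] [LieRingModule Sl2t V] [LieModule ℂ Sl2t V]
  {ι : Type}

/-- A basis of weight vectors, those of degree `r` being a basis of `V[r]`; there are finitely many
in every degree and all degrees are non-negative. -/
structure IsGradedBasis (𝒱 : ℤ → Submodule ℂ V) (b : Module.Basis ι ℂ V) (d : ι → ℕ)
    (wt : ι → ℤ) : Prop where
  finFib : FinFib d
  grade : ∀ r, 𝒱 r = Submodule.span ℂ (b '' {i | (d i : ℤ) = r})
  wt_mem : ∀ i, b i ∈ wtSpace V (wt i)

theorem mem_wtSpace {μ : ℤ} {v : V} : v ∈ wtSpace V μ ↔ actOp V sl2H 0 v = (μ : ℂ) • v := Iff.rfl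

namespace IsGradedBasis

variable {𝒱 : ℤ → Submodule ℂ V} {b : Module.Basis ι ℂ V} {d : ι → ℕ} {wt : ι → ℤ}

theorem mem_grade (H : IsGradedBasis 𝒱 b d wt) {r : ℤ} {v : V} :
    v ∈ 𝒱 r ↔ ∀ i, b.repr v i ≠ 0 → (d i : ℤ) = r := by
  rw [H.grade, Module.Basis.mem_span_image]
  exact ⟨fun h i hi => h (Finsupp.mem_support_iff.2 hi),
    fun h i hi => h i (Finsupp.mem_support_iff.1 hi)⟩

theorem repr_actOp_H (H : IsGradedBasis 𝒱 b d wt) (v : V) (i : ι) :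
    b.repr (actOp V sl2H 0 v) i = (wt i : ℂ) * b.repr v i := by
  have h : (b.coord i).comp (actOp V sl2H 0) = (wt i : ℂ) • b.coord i := by
    refine b.ext fun j => ?_
    rw [LinearMap.comp_apply, mem_wtSpace.1 (H.wt_mem j), map_smul, LinearMap.smul_apply,
      Module.Basis.coord_apply, Module.Basis.repr_self]
    by_cases hj : j = i
    · rw [hj]
    · rw [Finsupp.single_eq_of_ne (Ne.symm hj), smul_zero, smul_zero]
  exact LinearMap.congr_fun h v

theorem mem_wt (H : IsGradedBasis 𝒱 b d wt) {μ : ℤ} {v : V} :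
    v ∈ wtSpace V μ ↔ ∀ i, b.repr v i ≠ 0 → wt i = μ := by
  rw [mem_wtSpace]
  constructor
  · intro h i hi
    have := H.repr_actOp_H v i
    rw [h, map_smul, Finsupp.smul_apply, smul_eq_mul] at this
    exact_mod_cast (mul_right_cancel₀ hi this).symm
  · intro h
    apply b.repr.injective
    ext i
    rw [H.repr_actOp_H, map_smul, Finsupp.smul_apply, smul_eq_mul]
    by_cases hi : b.repr v i = 0
    · rw [hi, mul_zero, mul_zero]
    · rw [h i hi]

theorem inf_eq (H : IsGradedBasis 𝒱 b d wt) (r μ : ℤ) :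
    𝒱 r ⊓ wtSpace V μ = Submodule.span ℂ (b '' {i | (d i : ℤ) = r ∧ wt i = μ}) := by
  ext v
  rw [Submodule.mem_inf, H.mem_grade, H.mem_wt, Module.Basis.mem_span_image]
  constructor
  · exact fun h i hi => ⟨h.1 i (Finsupp.mem_support_iff.1 hi), h.2 i (Finsupp.mem_support_iff.1 hi)⟩
  · exact fun h => ⟨fun i hi => (h (Finsupp.mem_support_iff.2 hi)).1,
      fun i hi => (h (Finsupp.mem_support_iff.2 hi)).2⟩

theorem finite_deg (H : IsGradedBasis 𝒱 b d wt) (r : ℤ) : {i | (d i : ℤ) = r}.Finite := by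
  by_cases hr : 0 ≤ r
  · obtain ⟨n, rfl⟩ := Int.eq_ofNat_of_zero_le hr
    have : Finite {i | d i = n} := H.finFib n
    refine (Set.toFinite {i | d i = n}).subset fun i hi => ?_
    exact_mod_cast (hi : (d i : ℤ) = n)
  · refine Set.finite_empty.subset fun i (hi : (d i : ℤ) = r) => hr ?_
    omega

theorem finrank_inf (H : IsGradedBasis 𝒱 b d wt) (r μ : ℤ) :
    Module.finrank ℂ ↥(𝒱 r ⊓ wtSpace V μ) = Nat.card {i // (d i : ℤ) = r ∧ wt i = μ} := by
  rw [H.inf_eq]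
  have hli : LinearIndependent ℂ fun i : {i // (d i : ℤ) = r ∧ wt i = μ} => b i :=
    b.linearIndependent.comp _ Subtype.val_injective
  have e : b '' {i | (d i : ℤ) = r ∧ wt i = μ} =
      Set.range fun i : {i // (d i : ℤ) = r ∧ wt i = μ} => b i := by
    ext v
    simp
  rw [e]
  exact Module.finrank_eq_nat_card_basis (Module.Basis.span hli)

theorem finiteDimensional (H : IsGradedBasis 𝒱 b d wt) (r : ℤ) : FiniteDimensional ℂ (𝒱 r) := by
  rw [H.grade]
  exact FiniteDimensional.span_of_finite ℂ ((H.finite_deg r).image b)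

theorem eq_bot (H : IsGradedBasis 𝒱 b d wt) {r : ℤ} (hr : r < 0) : 𝒱 r = ⊥ := by
  rw [H.grade, Submodule.span_eq_bot]
  rintro _ ⟨i, hi, rfl⟩
  have : (d i : ℤ) = r := hi
  omega

theorem isInternal (H : IsGradedBasis 𝒱 b d wt) : DirectSum.IsInternal 𝒱 := by
  rw [DirectSum.isInternal_submodule_iff_iSupIndep_and_iSup_eq_top]
  constructor
  · rw [iSupIndep_def]
    intro r
    have h : ⨆ s, ⨆ _ : s ≠ r, 𝒱 s ≤ Submodule.span ℂ (b '' {i | (d i : ℤ) ≠ r}) := by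
      refine iSup₂_le fun s hs => ?_
      rw [H.grade]
      exact Submodule.span_mono (Set.image_mono fun i (hi : (d i : ℤ) = s) =>
        fun h => hs (hi.symm.trans h))
    refine Disjoint.mono_right h ?_
    rw [H.grade]
    exact b.linearIndependent.disjoint_span_image (Set.disjoint_left.2 fun i h1 h2 => h2 h1)
  · rw [eq_top_iff, ← b.span_eq, Submodule.span_le]
    rintro _ ⟨i, rfl⟩
    refine Submodule.mem_iSup_of_mem (d i : ℤ) ?_
    rw [H.grade]
    exact Submodule.subset_span ⟨i, rfl, rfl⟩

theorem basis_mem (H : IsGradedBasis 𝒱 b d wt) (i : ι) : b i ∈ 𝒱 (d i) := by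
  rw [H.grade]
  exact Submodule.subset_span ⟨i, rfl, rfl⟩

theorem finite_weights (H : IsGradedBasis 𝒱 b d wt) (hw : (Set.range wt).Finite) :
    {μ : ℤ | wtSpace V μ ≠ ⊥}.Finite := by
  refine hw.subset fun μ hμ => ?_
  obtain ⟨v, hv, h0⟩ := Submodule.exists_mem_ne_zero_of_ne_bot hμ
  obtain ⟨i, hi⟩ := Finsupp.ne_iff.1 (b.repr.map_ne_zero_iff.2 h0)
  exact ⟨i, H.mem_wt.1 hv i hi⟩

/-- The series counting the basis vectors of weight `μ` by degree. -/
theorem chGr_eq (H : IsGradedBasis 𝒱 b d wt) (μ : ℤ) :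
    chGr 𝒱 μ = HahnSeries.ofPowerSeries ℤ ℤ (genFun fun i : {i // wt i = μ} => d i) := by
  have hb : BddBelow (Function.support
      fun r : ℤ => (Module.finrank ℂ ↥(𝒱 r ⊓ wtSpace V μ) : ℤ)) := by
    refine ⟨0, fun r hr => ?_⟩
    by_contra h
    apply hr
    change (Module.finrank ℂ ↥(𝒱 r ⊓ wtSpace V μ) : ℤ) = 0
    rw [H.eq_bot (not_le.1 h), bot_inf_eq, finrank_bot, Nat.cast_zero]
  rw [chGr, dif_pos hb]
  ext r
  rw [HahnSeries.coeff_ofSuppBddBelow, PowerSeries.coeff_coe]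
  split_ifs with hr
  · rw [H.eq_bot hr, bot_inf_eq, finrank_bot, Nat.cast_zero]
  · obtain ⟨n, rfl⟩ := Int.eq_ofNat_of_zero_le (not_lt.1 hr)
    rw [H.finrank_inf, genFun, PowerSeries.coeff_mk, Nat.card_congr]
    exact
      { toFun := fun i => ⟨⟨i.1, i.2.2⟩, by simpa using i.2.1⟩
        invFun := fun i => ⟨i.1.1, by simpa using i.2, i.1.2⟩
        left_inv := fun _ => rfl
        right_inv := fun _ => rfl }

end IsGradedBasis

end

/-! ### A polynomial model of `W(n)` -/

/-- The polynomial ring in the basis `X (j, s) = e_j ⊗ t^s` of the natural `sl₂[t]`-module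
`ℂ² ⊗ ℂ[t]`, on which `sl₂[t]` acts by derivations. -/
abbrev Model : Type := MvPolynomial (Fin 2 × ℕ) ℂ

/-- The vector `e_j ⊗ f` of `ℂ² ⊗ ℂ[t]`. -/
def modelVec (j : Fin 2) : ℂ[X] →ₗ[ℂ] Model :=
  (Polynomial.basisMonomials ℂ).constr ℂ fun s => MvPolynomial.X (j, s)

theorem modelVec_X_pow (j : Fin 2) (s : ℕ) :
    modelVec j (Polynomial.X ^ s) = MvPolynomial.X (j, s) := by
  have h : Polynomial.basisMonomials ℂ s = Polynomial.X ^ s := by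
    rw [Polynomial.coe_basisMonomials]
    exact Polynomial.monomial_one_right_eq_X_pow s
  rw [modelVec, ← h, Module.Basis.constr_basis]

/-- The derivation by which `a ⊗ f` acts on the model. -/
def modelDer : Sl2t →ₗ[ℂ] Derivation ℂ Model Model :=
  TensorProduct.lift (LinearMap.mk₂ ℂ
    (fun f a => MvPolynomial.mkDerivation ℂ fun p =>
      ∑ i, (a : Matrix (Fin 2) (Fin 2) ℂ) i p.1 • modelVec i (f * Polynomial.X ^ p.2))
    (fun f g a => MvPolynomial.derivation_ext fun p => by
      simp only [MvPolynomial.mkDerivation_X, Derivation.add_apply, add_mul, map_add, smul_add,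
        Finset.sum_add_distrib])
    (fun c f a => MvPolynomial.derivation_ext fun p => by
      simp only [MvPolynomial.mkDerivation_X, Derivation.smul_apply, smul_mul_assoc, map_smul,
        Finset.smul_sum, smul_comm c])
    (fun f a b => MvPolynomial.derivation_ext fun p => by
      simp only [MvPolynomial.mkDerivation_X, Derivation.add_apply, ← Finset.sum_add_distrib,
        ← add_smul]
      rfl)
    (fun c f a => MvPolynomial.derivation_ext fun p => by
      simp only [MvPolynomial.mkDerivation_X, Derivation.smul_apply, Finset.smul_sum, smul_smul]
      rfl))

theorem modelDer_tmul_modelVec (f : ℂ[X]) (a : Sl2) (j : Fin 2) (g : ℂ[X]) :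
    modelDer (f ⊗ₜ a) (modelVec j g) =
      ∑ i, (a : Matrix (Fin 2) (Fin 2) ℂ) i j • modelVec i (f * g) := by
  induction g using Polynomial.induction_on' with
  | add p q hp hq =>
    simp only [map_add, mul_add, hp, hq, smul_add, Finset.sum_add_distrib]
  | monomial s c =>
    rw [← Polynomial.smul_X_eq_monomial, map_smul, Derivation.map_smul, modelVec_X_pow]
    simp only [mul_smul_comm, map_smul, smul_comm _ c, ← Finset.smul_sum]
    exact congrArg (c • ·) (MvPolynomial.mkDerivation_X _ _ _)

theorem modelDer_lie (z w : Sl2t) (v : Model) :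
    modelDer ⁅z, w⁆ v = modelDer z (modelDer w v) - modelDer w (modelDer z v) := by
  have add_l : ∀ z z' w : Sl2t, ⁅z + z', w⁆ = ⁅z, w⁆ + ⁅z', w⁆ := fun z z' w => add_lie z z' w
  have l_add : ∀ z w w' : Sl2t, ⁅z, w + w'⁆ = ⁅z, w⁆ + ⁅z, w'⁆ := fun z w w' => lie_add z w w'
  have zero_l : ∀ z : Sl2t, ⁅(0 : Sl2t), z⁆ = 0 := fun z => zero_lie z
  have l_zero : ∀ z : Sl2t, ⁅z, (0 : Sl2t)⁆ = 0 := fun z => lie_zero z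
  induction z using TensorProduct.induction_on with
  | zero => rw [zero_l, map_zero, Derivation.zero_apply, Derivation.zero_apply, map_zero, sub_zero]
  | add z z' h h' =>
    rw [add_l, map_add, map_add, Derivation.add_apply, Derivation.add_apply, Derivation.add_apply, h,
      h', map_add]
    abel
  | tmul f a =>
    induction w using TensorProduct.induction_on with
    | zero =>
      rw [l_zero, map_zero, Derivation.zero_apply, Derivation.zero_apply, map_zero, sub_zero]
    | add z z' h h' =>
      rw [l_add, map_add, map_add, Derivation.add_apply, Derivation.add_apply,
        Derivation.add_apply, h, h', map_add]
      abel
    | tmul g b =>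
      rw [← Derivation.commutator_apply]
      refine congrArg (fun D : Derivation ℂ Model Model => D v) ?_
      refine MvPolynomial.derivation_ext fun ⟨j, s⟩ => ?_
      have e : ∀ i j, (⁅a, b⁆ : Sl2).1 i j = a.1 i 0 * b.1 0 j + a.1 i 1 * b.1 1 j -
          (b.1 i 0 * a.1 0 j + b.1 i 1 * a.1 1 j) := by
        intro i j
        rw [LieSubalgebra.coe_bracket, LieRing.of_associative_ring_bracket, Matrix.sub_apply,
          Matrix.mul_apply, Matrix.mul_apply, Fin.sum_univ_two, Fin.sum_univ_two]
      rw [← modelVec_X_pow, Derivation.commutator_apply,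
        LieAlgebra.ExtendScalars.bracket_tmul, modelDer_tmul_modelVec, modelDer_tmul_modelVec,
        modelDer_tmul_modelVec]
      simp only [Fin.sum_univ_two, map_add, Derivation.map_smul, modelDer_tmul_modelVec, e,
        ← mul_assoc, mul_comm g f]
      module

instance : LieRingModule Sl2t Model where
  bracket z v := modelDer z v
  add_lie z w v := by
    change modelDer (z + w) v = _
    rw [map_add]; rfl
  lie_add z v w := map_add _ _ _
  leibniz_lie z w v := by
    change modelDer z (modelDer w v) = modelDer ⁅z, w⁆ v + modelDer w (modelDer z v)
    rw [modelDer_lie, sub_add_cancel]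

instance : LieModule ℂ Sl2t Model where
  smul_lie c z v := by
    change modelDer (c • z) v = c • modelDer z v
    rw [map_smul]; rfl
  lie_smul c z v := Derivation.map_smul _ _ _

theorem actOp_model (a : Sl2) (r : ℕ) (v : Model) : actOp Model a r v = modelDer (cur a r) v := rfl

theorem actOp_model_X (a : Sl2) (r : ℕ) (j : Fin 2) (s : ℕ) :
    actOp Model a r (MvPolynomial.X (j, s)) =
      a.1 0 j • MvPolynomial.X (0, r + s) + a.1 1 j • MvPolynomial.X (1, r + s) := by
  rw [actOp_model, cur, ← modelVec_X_pow, modelDer_tmul_modelVec, Fin.sum_univ_two, ← pow_add,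
    modelVec_X_pow, modelVec_X_pow]

theorem actOp_model_mul (a : Sl2) (r : ℕ) (p q : Model) :
    actOp Model a r (p * q) = actOp Model a r p * q + p * actOp Model a r q := by
  rw [actOp_model, Derivation.leibniz, smul_eq_mul, smul_eq_mul, add_comm, mul_comm q]
  rfl

/-- The shift derivations of the model, multiplication by `t^r` on `ℂ² ⊗ ℂ[t]`. -/
def modelShift (r : ℕ) : Derivation ℂ Model Model :=
  MvPolynomial.mkDerivation ℂ fun p => MvPolynomial.X (p.1, p.2 + r)

theorem modelShift_X (r : ℕ) (j : Fin 2) (s : ℕ) :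
    modelShift r (MvPolynomial.X (j, s)) = MvPolynomial.X (j, s + r) :=
  MvPolynomial.mkDerivation_X _ _ _

theorem modelShift_actOp (r : ℕ) (a : Sl2) (s : ℕ) (v : Model) :
    modelShift r (actOp Model a s v) = actOp Model a s (modelShift r v) := by
  have h : ⁅modelShift r, modelDer (cur a s)⁆ = 0 := by
    refine MvPolynomial.derivation_ext fun p => ?_
    rw [← Prod.mk.eta (p := p), Derivation.commutator_apply, ← actOp_model, ← actOp_model,
      modelShift_X, actOp_model_X, actOp_model_X, map_add, Derivation.map_smul,
      Derivation.map_smul, modelShift_X, modelShift_X, add_assoc, sub_self]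
    rfl
  have := congrArg (fun D : Derivation ℂ Model Model => D v) h
  simp only [Derivation.commutator_apply] at this
  exact sub_eq_zero.1 this

theorem actOp_model_pow_eq_zero (a : Sl2) (r : ℕ) {p : Model} (h : actOp Model a r p = 0) (m : ℕ) :
    actOp Model a r (p ^ m) = 0 := by
  rw [actOp_model, Derivation.leibniz_pow, ← actOp_model, h, smul_zero, smul_zero]

theorem y_pow_model (n k : ℕ) :
    (actOp Model sl2Y 0 ^ k) (MvPolynomial.X (0, 0) ^ n) =
      (n.descFactorial k : ℂ) • (MvPolynomial.X (0, 0) ^ (n - k) * MvPolynomial.X (1, 0) ^ k) := by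
  have h1 : actOp Model sl2Y 0 (MvPolynomial.X (1, 0)) = 0 := by
    rw [actOp_model_X]; simp [sl2Y]
  have h0 : actOp Model sl2Y 0 (MvPolynomial.X (0, 0)) = MvPolynomial.X (1, 0) := by
    rw [actOp_model_X]; simp [sl2Y]
  induction k with
  | zero => simp
  | succ k ih =>
    rw [pow_succ', Module.End.mul_apply, ih, map_smul, actOp_model_mul,
      actOp_model_pow_eq_zero _ _ h1, mul_zero, add_zero, actOp_model _ _ (_ ^ _),
      Derivation.leibniz_pow, ← actOp_model, h0, Nat.descFactorial_succ, ← Nat.sub_sub]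
    simp only [smul_eq_mul, nsmul_eq_mul, Nat.cast_mul, MvPolynomial.smul_eq_C_mul, map_mul,
      map_natCast]
    ring

theorem isWeylVec_model (n : ℕ) : IsWeylVec n (MvPolynomial.X (0, 0) ^ n : Model) where
  x_zero r := actOp_model_pow_eq_zero _ _ (by rw [actOp_model_X]; simp [sl2X]) n
  h_zero := by
    have h0 : actOp Model sl2H 0 (MvPolynomial.X (0, 0)) = MvPolynomial.X (0, 0) := by
      rw [actOp_model_X]; simp [sl2H]
    rw [actOp_model, Derivation.leibniz_pow, ← actOp_model, h0, Nat.cast_smul_eq_nsmul]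
    rcases n with _ | n
    · simp
    · rw [Nat.add_sub_cancel, smul_eq_mul, ← pow_succ]
  y_pow := by
    rw [y_pow_model, Nat.descFactorial_eq_zero_iff_lt.2 n.lt_succ_self, Nat.cast_zero, zero_smul]

/-- The homomorphism from `W(n)` to the model, `w_n ↦ (e_0 ⊗ 1)^n`. -/
def toModel (n : ℕ) : Weyl n →ₗ⁅ℂ,Sl2t⁆ Model := (exists_weylLift (isWeylVec_model n)).choose

theorem toModel_gen (n : ℕ) : toModel n (weylGen n) = MvPolynomial.X (0, 0) ^ n :=
  (exists_weylLift (isWeylVec_model n)).choose_spec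

/-! #### The image of `W(n)` in the model -/

/-- Polynomials in the `e_j ⊗ t^s` for a fixed `j`. -/
def modelIncl (j : Fin 2) : MvPolynomial ℕ ℂ →ₐ[ℂ] Model := MvPolynomial.rename (Prod.mk j)

/-- The derivation shifting the factors `e_j ⊗ t^s` for one `j`. -/
def modelShift₁ (j : Fin 2) (r : ℕ) : Derivation ℂ Model Model :=
  MvPolynomial.mkDerivation ℂ fun p => if p.1 = j then MvPolynomial.X (p.1, p.2 + r) else 0

theorem shiftSystem_model (j : Fin 2) : ShiftSystem
    (fun s => LinearMap.mulLeft ℂ (MvPolynomial.X (j, s) : Model))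
    (fun r => (modelShift₁ j (r + 1)).toLinearMap) where
  comm s t := LinearMap.ext fun v => by
    rw [Module.End.mul_apply, Module.End.mul_apply]
    exact mul_left_comm _ _ _
  shift r s := LinearMap.ext fun v => by
    have h : modelShift₁ j (r + 1) (MvPolynomial.X (j, s)) = MvPolynomial.X (j, s + (r + 1)) := by
      rw [modelShift₁, MvPolynomial.mkDerivation_X, if_pos rfl]
    rw [LinearMap.add_apply, Module.End.mul_apply, Module.End.mul_apply, LinearMap.mulLeft_apply,
      LinearMap.mulLeft_apply, LinearMap.mulLeft_apply, Derivation.coeFn_coe, Derivation.leibniz, h,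
      smul_eq_mul, smul_eq_mul, mul_comm v, add_assoc s]

theorem shiftSystem_model_eval (j : Fin 2) (q : MvPolynomial ℕ ℂ) (v : Model) :
    (shiftSystem_model j).eval q v = modelIncl j q * v := by
  induction q using MvPolynomial.induction_on generalizing v with
  | C c =>
    rw [← MvPolynomial.algebraMap_eq, AlgHom.commutes, AlgHom.commutes, ← Algebra.smul_def]
    rfl
  | add p q hp hq => rw [map_add, map_add, LinearMap.add_apply, hp, hq, add_mul]
  | mul_X p i hp =>
    rw [map_mul, map_mul, Module.End.mul_apply, hp, ShiftSystem.eval_X, modelIncl,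
      MvPolynomial.rename_X, mul_assoc]
    rfl

theorem modelShift₁_modelIncl {i j : Fin 2} (h : i ≠ j) (r : ℕ) (q : MvPolynomial ℕ ℂ) :
    modelShift₁ i r (modelIncl j q) = 0 := by
  induction q using MvPolynomial.induction_on with
  | C c =>
    rw [← MvPolynomial.algebraMap_eq, AlgHom.commutes, Derivation.map_algebraMap]
  | add p q hp hq => rw [map_add, map_add, hp, hq, add_zero]
  | mul_X p s hp =>
    rw [map_mul, Derivation.leibniz, hp, modelIncl, MvPolynomial.rename_X, modelShift₁,
      MvPolynomial.mkDerivation_X, if_neg (Ne.symm h), smul_zero, smul_zero, add_zero]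

theorem modelShift_gen (n r : ℕ) : modelShift r (MvPolynomial.X (0, 0) ^ n) =
    actOp Model sl2H r (MvPolynomial.X (0, 0) ^ n) := by
  rw [actOp_model, Derivation.leibniz_pow, Derivation.leibniz_pow, ← actOp_model, modelShift_X,
    actOp_model_X, add_comm 0 r]
  simp [sl2H]

theorem toModel_rho (n r : ℕ) (v : Weyl n) :
    toModel n (rho n r v) = modelShift r (toModel n v) := by
  let f : Weyl n →ₗ⁅ℂ,Sl2t⁆ Model :=
    { (modelShift r).toLinearMap.comp (toModel n : Weyl n →ₗ[ℂ] Model) with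
      map_lie' := fun {z v} => by
        change modelShift r (toModel n ⁅z, v⁆) = ⁅z, modelShift r (toModel n v)⁆
        refine sl2t_induction (p := fun z => modelShift r (toModel n ⁅z, v⁆) =
          ⁅z, modelShift r (toModel n v)⁆) ?_ ?_ ?_ ?_ ?_ ?_ z
        · simp
        · intro a b ha hb
          rw [add_lie, map_add, map_add, ha, hb, add_lie]
        · intro c a ha
          have h1 : ∀ {M : Type} [AddCommGroup M] [Module ℂ M] [LieRingModule Sl2t M]
              [LieModule ℂ Sl2t M] (m : M), ⁅c • a, m⁆ = c • ⁅a, m⁆ := fun m => smul_lie c a m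
          rw [h1, map_smul, Derivation.map_smul, ha, h1]
        all_goals
          intro s
          rw [LieModuleHom.map_lie]
          exact modelShift_actOp r _ s _ }
  have h : (toModel n).comp (rho n r) = f := by
    apply weylHom_ext
    rw [LieModuleHom.comp_apply, rho_gen, map_actOp, toModel_gen]
    change _ = modelShift r (toModel n (weylGen n))
    rw [toModel_gen, modelShift_gen]
  exact LieModuleHom.congr_fun h v

theorem modelShift₁_eq (r : ℕ) (v : Model) :
    modelShift₁ 0 r v = (2⁻¹ : ℂ) • (modelShift r v + actOp Model sl2H r v) ∧
    modelShift₁ 1 r v = (2⁻¹ : ℂ) • (modelShift r v - actOp Model sl2H r v) := by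
  have h0 : modelShift₁ 0 r = (2⁻¹ : ℂ) • (modelShift r + modelDer (cur sl2H r)) := by
    refine MvPolynomial.derivation_ext fun ⟨j, s⟩ => ?_
    rw [Derivation.smul_apply, Derivation.add_apply, ← actOp_model, modelShift_X, actOp_model_X,
      modelShift₁, MvPolynomial.mkDerivation_X, add_comm r s]
    fin_cases j
    · simp [sl2H, ← two_smul ℂ, smul_smul]
    · simp [sl2H]
  have h1 : modelShift₁ 1 r = (2⁻¹ : ℂ) • (modelShift r - modelDer (cur sl2H r)) := by
    refine MvPolynomial.derivation_ext fun ⟨j, s⟩ => ?_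
    rw [Derivation.smul_apply, Derivation.sub_apply, ← actOp_model, modelShift_X, actOp_model_X,
      modelShift₁, MvPolynomial.mkDerivation_X, add_comm r s]
    fin_cases j
    · simp [sl2H]
    · simp [sl2H, ← two_smul ℂ, smul_smul]
  rw [h0, h1]
  exact ⟨rfl, rfl⟩

/-- The image of `W(n)` contains all polynomials of degree `n`, here split by the degrees in the
two groups of variables.  Both groups are polarized from `X (0, 0) ^ (n - k) * X (1, 0) ^ k`. -/
theorem mem_range_toModel {n k : ℕ} (hk : k ≤ n) {p q : MvPolynomial ℕ ℂ} (hp : p ∈ polyDeg (n - k))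
    (hq : q ∈ polyDeg k) :
    modelIncl 0 p * modelIncl 1 q ∈ LinearMap.range (toModel n : Weyl n →ₗ[ℂ] Model) := by
  set N := LinearMap.range (toModel n : Weyl n →ₗ[ℂ] Model)
  have hδ : ∀ r, ∀ v ∈ N, modelShift₁ 0 r v ∈ N ∧ modelShift₁ 1 r v ∈ N := by
    rintro r _ ⟨v, rfl⟩
    have h1 : modelShift r (toModel n v) ∈ N := ⟨rho n r v, toModel_rho n r v⟩
    have h2 : actOp Model sl2H r (toModel n v) ∈ N := ⟨actOp _ sl2H r v, map_actOp _ _ _ _⟩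
    exact ⟨(modelShift₁_eq r _).1 ▸ N.smul_mem _ (add_mem h1 h2),
      (modelShift₁_eq r _).2 ▸ N.smul_mem _ (sub_mem h1 h2)⟩
  have hX : ∀ (j : Fin 2) m, modelIncl j (MvPolynomial.X 0 ^ m) = MvPolynomial.X (j, 0) ^ m := by
    intro j m
    rw [map_pow, modelIncl, MvPolynomial.rename_X]
  have hm : ∀ (j : Fin 2) m (v : Model),
      (LinearMap.mulLeft ℂ (MvPolynomial.X (j, 0) : Model) ^ m) v =
        MvPolynomial.X (j, 0) ^ m * v := by
    intro j m v
    rw [LinearMap.pow_mulLeft, LinearMap.mulLeft_apply]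
  have h0 : (MvPolynomial.X (0, 0) ^ (n - k) * MvPolynomial.X (1, 0) ^ k : Model) ∈ N := by
    have h : (actOp Model sl2Y 0 ^ k) (MvPolynomial.X (0, 0) ^ n) ∈ N := by
      refine ⟨(actOp _ sl2Y 0 ^ k) (weylGen n), ?_⟩
      have := map_uAct (toModel n) (curU sl2Y 0 ^ k) (weylGen n)
      rw [map_pow, map_pow, uAct_curU, uAct_curU, toModel_gen] at this
      exact this
    rw [y_pow_model] at h
    exact (N.smul_mem_iff (Nat.cast_ne_zero.2
      (Nat.descFactorial_eq_zero_iff_lt.not.2 (not_lt.2 hk)))).1 h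
  have h1 : modelIncl 0 p * MvPolynomial.X (1, 0) ^ k ∈ N := by
    rw [← shiftSystem_model_eval]
    refine (shiftSystem_model 0).eval_mem (fun r => ?_) ?_ (fun r v hv => (hδ _ v hv).1) hp
    · rw [← hX]; exact modelShift₁_modelIncl (by decide) _ _
    · rw [hm]; exact h0
  rw [mul_comm, ← shiftSystem_model_eval]
  refine (shiftSystem_model 1).eval_mem (fun r => modelShift₁_modelIncl (by decide) _ _) ?_
    (fun r v hv => (hδ _ v hv).2) hq
  rw [hm, mul_comm]; exact h1

/-! ### A basis of `W(n)` -/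

/-- A homogeneous spanning family with as many members in every degree as a homogeneous basis is
linearly independent. -/
theorem linearIndependent_of_genFun_eq {S ι κ : Type*} [AddCommGroup S] [Module ℂ S] {B : κ → S}
    {e : κ → ℕ} {t : ι → S} {d : ι → ℕ} (hB : LinearIndependent ℂ B) (he : FinFib e)
    (hd : FinFib d) (h : genFun d = genFun e)
    (ht : ∀ i, t i ∈ Submodule.span ℂ (B '' {k | e k = d i}))
    (hs : ∀ k, B k ∈ Submodule.span ℂ (Set.range t)) : LinearIndependent ℂ t := by
  have ht' : ∀ i, ∃ c ∈ Finsupp.supported ℂ ℂ {k | e k = d i},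
      Finsupp.linearCombination ℂ B c = t i := fun i =>
    (Finsupp.mem_span_image_iff_linearCombination ℂ).1 (ht i)
  choose c hc hct using ht'
  let T := Finsupp.linearCombination ℂ c
  have hT : ∀ x, Finsupp.linearCombination ℂ B (T x) = Finsupp.linearCombination ℂ t x := by
    intro x
    have : (Finsupp.linearCombination ℂ B).comp T = Finsupp.linearCombination ℂ t := by
      ext i
      simp [T, hct]
    exact LinearMap.congr_fun this x
  have hinj := injective_of_genFun_eq hd he h T
    (fun i => by simpa [T] using hc i) (by
      have : LinearMap.range T = ⊤ := by
        rw [eq_top_iff, ← Finsupp.basisSingleOne.span_eq, Submodule.span_le]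
        rintro _ ⟨k, rfl⟩
        rw [Finsupp.coe_basisSingleOne]
        obtain ⟨x, hx⟩ := (Finsupp.mem_span_range_iff_exists_finsupp).1 (hs k)
        refine ⟨x, hB ?_⟩
        rw [hT, Finsupp.linearCombination_single, one_smul]
        exact hx
      exact LinearMap.range_eq_top.1 this)
  intro x y hxy
  apply hinj
  apply hB
  rw [hT, hT]
  exact hxy

/-- The index set of the basis of `W(n)`: pairs of monomials in the vectors `e_0 ⊗ t^s` and in the
vectors `e_1 ⊗ t^s`, of total degree `n`. -/
def WIdx (n : ℕ) : Type := Σ k : Fin (n + 1), MultN (n - k) × MultN k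

/-- The degree of a basis vector of `W(n)`. -/
def wDeg {n : ℕ} (i : WIdx n) : ℕ := multDeg i.2.1 + multDeg i.2.2

/-- The weight of a basis vector of `W(n)`. -/
def wWt {n : ℕ} (i : WIdx n) : ℤ := n - 2 * (i.1 : ℕ)

theorem finFib_wDeg (n : ℕ) : FinFib (wDeg (n := n)) :=
  FinFib.sigma fun k : Fin (n + 1) => (finFib_multDeg (n - k)).prod (finFib_multDeg k)

theorem genFun_wDeg (n : ℕ) : genFun (wDeg (n := n)) =
    ∑ k : Fin (n + 1), oneU k * oneU (n - k) := by
  refine (genFun_sigma fun k : Fin (n + 1) =>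
    (finFib_multDeg (n - k)).prod (finFib_multDeg k)).trans ?_
  refine Finset.sum_congr rfl fun k _ => ?_
  rw [genFun_prod (finFib_multDeg _) (finFib_multDeg _), genFun_multDeg, genFun_multDeg, mul_comm]

/-- The exponent of a monomial of the model. -/
def modelExp {n : ℕ} (i : WIdx n) : Fin 2 × ℕ →₀ ℕ :=
  Finsupp.mapDomain (Prod.mk 0) i.2.1.1 + Finsupp.mapDomain (Prod.mk 1) i.2.2.1

theorem modelExp_apply_zero {n : ℕ} (i : WIdx n) (s : ℕ) : modelExp i (0, s) = i.2.1.1 s := by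
  rw [modelExp, Finsupp.add_apply, Finsupp.mapDomain_apply (Prod.mk_right_injective _),
    Finsupp.mapDomain_of_notMem_range _ _ (by rintro ⟨t, h⟩; simp at h), add_zero]

theorem modelExp_apply_one {n : ℕ} (i : WIdx n) (s : ℕ) : modelExp i (1, s) = i.2.2.1 s := by
  rw [modelExp, Finsupp.add_apply, Finsupp.mapDomain_apply (Prod.mk_right_injective _),
    Finsupp.mapDomain_of_notMem_range _ _ (by rintro ⟨t, h⟩; simp at h), zero_add]

theorem modelExp_injective (n : ℕ) : Function.Injective (modelExp (n := n)) := by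
  intro i j h
  have h0 : i.2.1.1 = j.2.1.1 := by
    ext s
    rw [← modelExp_apply_zero, h, modelExp_apply_zero]
  have h1 : i.2.2.1 = j.2.2.1 := by
    ext s
    rw [← modelExp_apply_one, h, modelExp_apply_one]
  obtain ⟨k, f, g⟩ := i
  obtain ⟨k', f', g'⟩ := j
  have hk : k = k' := Fin.ext (by rw [← g.2, ← g'.2, h1])
  subst hk
  have hf : f = f' := Subtype.ext h0
  have hg : g = g' := Subtype.ext h1
  rw [hf, hg]

/-- The monomials of degree `n` in the model. -/
def modelMono {n : ℕ} (i : WIdx n) : Model := MvPolynomial.monomial (modelExp i) 1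

theorem modelMono_eq {n : ℕ} (i : WIdx n) :
    modelMono i = modelIncl 0 (multMono i.2.1) * modelIncl 1 (multMono i.2.2) := by
  rw [modelIncl, modelIncl, multMono, multMono, MvPolynomial.rename_monomial,
    MvPolynomial.rename_monomial, MvPolynomial.monomial_mul, one_mul]
  rfl

theorem linearIndependent_modelMono (n : ℕ) : LinearIndependent ℂ (modelMono (n := n)) := by
  have := (MvPolynomial.basisMonomials (Fin 2 × ℕ) ℂ).linearIndependent.comp _
    (modelExp_injective n)
  rwa [MvPolynomial.coe_basisMonomials] at this

theorem modelMono_mem_range {n : ℕ} (i : WIdx n) :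
    modelMono i ∈ LinearMap.range (toModel n : Weyl n →ₗ[ℂ] Model) := by
  rw [modelMono_eq]
  exact mem_range_toModel (Nat.lt_succ_iff.1 i.1.2) (Submodule.subset_span ⟨_, rfl⟩)
    (Submodule.subset_span ⟨_, rfl⟩)

theorem actOp_H_modelIncl (j : Fin 2) {k : ℕ} (f : MultN k) :
    actOp Model sl2H 0 (modelIncl j (multMono f)) =
      (sl2H.1 j j * k) • modelIncl j (multMono f) := by
  induction k with
  | zero =>
    rw [multMono_zero, map_one, Nat.cast_zero, mul_zero, zero_smul]
    exact Derivation.map_one_eq_zero _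
  | succ k ih =>
    obtain ⟨a, g, e⟩ := exists_multMono_succ f
    have hX : actOp Model sl2H 0 (MvPolynomial.X (j, a)) = sl2H.1 j j • MvPolynomial.X (j, a) := by
      rw [actOp_model_X]
      fin_cases j <;> simp [sl2H]
    rw [e, map_mul, actOp_model_mul, ih, modelIncl, MvPolynomial.rename_X, hX, smul_mul_assoc,
      mul_smul_comm, ← add_smul]
    push_cast
    congr 1
    ring

theorem actOp_H_modelMono {n : ℕ} (i : WIdx n) :
    actOp Model sl2H 0 (modelMono i) = ((wWt i : ℤ) : ℂ) • modelMono i := by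
  have hk : ((n - (i.1 : ℕ) : ℕ) : ℂ) = n - (i.1 : ℕ) := Nat.cast_sub (Nat.lt_succ_iff.1 i.1.2)
  rw [modelMono_eq, actOp_model_mul, actOp_H_modelIncl, actOp_H_modelIncl, smul_mul_assoc,
    mul_smul_comm, ← add_smul, hk, wWt]
  congr 1
  simp only [sl2H, Matrix.of_apply, Matrix.cons_val', Matrix.cons_val_zero, Matrix.cons_val_one,
    Matrix.cons_val_fin_one]
  push_cast
  ring

/-- The bidegree on the model: polynomial degree and power of `t`. -/
def modelWeight : Fin 2 × ℕ → ℕ × ℕ := fun p => (1, p.2)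

theorem weight_mapDomain (j : Fin 2) (f : ℕ →₀ ℕ) :
    Finsupp.weight modelWeight (Finsupp.mapDomain (Prod.mk j) f) =
      (f.degree, Finsupp.weight (id : ℕ → ℕ) f) := by
  induction f using Finsupp.induction_linear with
  | zero => simp; rfl
  | add f g hf hg => rw [Finsupp.mapDomain_add, map_add, hf, hg, map_add, map_add]; rfl
  | single s c =>
    rw [Finsupp.mapDomain_single, Finsupp.weight_single, Finsupp.weight_single,
      Finsupp.degree_single, modelWeight]
    simp

theorem isWeightedHomogeneous_actOp_monomial (a : Sl2) (r : ℕ) (g : Fin 2 × ℕ →₀ ℕ) :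
    MvPolynomial.IsWeightedHomogeneous modelWeight
      (actOp Model a r (MvPolynomial.monomial g 1)) (Finsupp.weight modelWeight g + (0, r)) := by
  induction g using Finsupp.induction_linear with
  | zero =>
    have : actOp Model a r (MvPolynomial.monomial 0 1) = 0 := Derivation.map_one_eq_zero _
    rw [this]
    exact MvPolynomial.isWeightedHomogeneous_zero _ _ _
  | add f g hf hg =>
    have e : (MvPolynomial.monomial (f + g) 1 : Model) =
        MvPolynomial.monomial f 1 * MvPolynomial.monomial g 1 := by
      rw [MvPolynomial.monomial_mul, one_mul]
    have hm := fun f => MvPolynomial.isWeightedHomogeneous_monomial (R := ℂ) modelWeight f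
      (r := 1) rfl
    rw [e, actOp_model_mul, map_add]
    refine MvPolynomial.IsWeightedHomogeneous.add ?_ ?_
    · have := hf.mul (hm g)
      rwa [add_right_comm] at this
    · have := (hm f).mul hg
      rwa [← add_assoc] at this
  | single p c =>
    obtain ⟨j, s⟩ := p
    have e : (MvPolynomial.monomial (Finsupp.single (j, s) c) 1 : Model) =
        MvPolynomial.X (j, s) ^ c := (MvPolynomial.X_pow_eq_monomial).symm
    have hX : ∀ i s, MvPolynomial.IsWeightedHomogeneous modelWeight
        (MvPolynomial.X (i, s) : Model) (1, s) := fun i s =>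
      MvPolynomial.isWeightedHomogeneous_X ℂ modelWeight (i, s)
    have hsmul : ∀ (c : ℂ) i s, MvPolynomial.IsWeightedHomogeneous modelWeight
        (c • MvPolynomial.X (i, s) : Model) (1, s) := fun c i s =>
      Submodule.smul_mem (MvPolynomial.weightedHomogeneousSubmodule ℂ modelWeight _) c (hX i s)
    rw [e, actOp_model, Derivation.leibniz_pow, ← actOp_model, Finsupp.weight_single]
    rcases c with _ | c
    · rw [zero_smul]
      exact MvPolynomial.isWeightedHomogeneous_zero _ _ _
    · rw [Nat.add_sub_cancel, actOp_model_X]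
      refine (MvPolynomial.weightedHomogeneousSubmodule ℂ modelWeight _).toAddSubmonoid.nsmul_mem
        ?_ (c + 1)
      have h1 := ((hX j s).pow c).mul ((hsmul (a.1 0 j) 0 (r + s)).add (hsmul (a.1 1 j) 1 (r + s)))
      have h2 : c • ((1, s) : ℕ × ℕ) + (1, r + s) = (c + 1) • modelWeight (j, s) + (0, r) := by
        ext
        · simp [modelWeight]
        · simp [modelWeight]; ring
      rw [h2] at h1
      exact h1

theorem isWeightedHomogeneous_actOp (a : Sl2) (r : ℕ) {n m : ℕ} {p : Model}
    (hp : MvPolynomial.IsWeightedHomogeneous modelWeight p (n, m)) :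
    MvPolynomial.IsWeightedHomogeneous modelWeight (actOp Model a r p) (n, r + m) := by
  rw [p.as_sum, map_sum]
  refine Submodule.sum_mem (MvPolynomial.weightedHomogeneousSubmodule ℂ modelWeight _)
    fun g hg => ?_
  have hw := hp (MvPolynomial.mem_support_iff.1 hg)
  have h1 := isWeightedHomogeneous_actOp_monomial a r g
  rw [hw, Prod.mk_add_mk, add_zero, add_comm m] at h1
  have e : MvPolynomial.monomial g (MvPolynomial.coeff g p) =
      MvPolynomial.coeff g p • (MvPolynomial.monomial g 1 : Model) := by
    rw [MvPolynomial.smul_monomial, smul_eq_mul, mul_one]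
  rw [e, map_smul]
  exact Submodule.smul_mem _ _ h1

theorem toModel_mem {n : ℕ} {r : ℤ} {v : Weyl n} (hv : v ∈ weylGrading n r) :
    toModel n v ∈ Submodule.span ℂ (modelMono '' {i : WIdx n | (wDeg i : ℤ) = r}) := by
  obtain ⟨u, hu, rfl⟩ := mem_weylGrading.1 hv
  refine Submodule.span_induction (p := fun u _ => toModel n (u • weylGen n) ∈ _) ?_ ?_ ?_ ?_ hu
  · clear hv hu
    rintro _ ⟨l, rfl, rfl⟩
    have h1 : MvPolynomial.IsWeightedHomogeneous modelWeight
        (toModel n ((l.map fun p => curU p.1 p.2).prod • weylGen n)) (n, (l.map Prod.snd).sum) := by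
      induction l with
      | nil =>
        rw [List.map_nil, List.prod_nil, one_smul, toModel_gen]
        have := (MvPolynomial.isWeightedHomogeneous_X ℂ modelWeight ((0 : Fin 2), 0)).pow n
        simpa [modelWeight] using this
      | cons p l ih =>
        rw [List.map_cons, List.prod_cons, mul_smul, ← uAct_weyl, uAct_curU, map_actOp,
          List.map_cons, List.sum_cons]
        exact isWeightedHomogeneous_actOp _ _ ih
    set q := toModel n ((l.map fun p => curU p.1 p.2).prod • weylGen n)
    rw [q.as_sum]
    refine Submodule.sum_mem _ fun g hg => ?_
    have hw := h1 (MvPolynomial.mem_support_iff.1 hg)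
    have e : MvPolynomial.monomial g (MvPolynomial.coeff g q) =
        MvPolynomial.coeff g q • (MvPolynomial.monomial g 1 : Model) := by
      rw [MvPolynomial.smul_monomial, smul_eq_mul, mul_one]
    rw [e]
    refine Submodule.smul_mem _ _ (Submodule.subset_span ?_)
    have hg2 : g = Finsupp.mapDomain (Prod.mk 0) (g.curry 0) +
        Finsupp.mapDomain (Prod.mk 1) (g.curry 1) := by
      ext ⟨j, s⟩
      rw [Finsupp.add_apply]
      fin_cases j
      · rw [Finsupp.mapDomain_of_notMem_range (f := Prod.mk 1) _ _ (by rintro ⟨t, h⟩; simp at h),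
          add_zero]
        exact (Finsupp.mapDomain_apply (Prod.mk_right_injective (0 : Fin 2)) (g.curry 0) s).symm
      · rw [Finsupp.mapDomain_of_notMem_range (f := Prod.mk 0) _ _ (by rintro ⟨t, h⟩; simp at h),
          zero_add]
        exact (Finsupp.mapDomain_apply (Prod.mk_right_injective (1 : Fin 2)) (g.curry 1) s).symm
    rw [hg2, map_add, weight_mapDomain, weight_mapDomain, Prod.mk_add_mk, Prod.mk.injEq] at hw
    refine ⟨⟨⟨(g.curry 1).degree, by omega⟩, ⟨g.curry 0, ?_⟩, ⟨g.curry 1, rfl⟩⟩, ?_, ?_⟩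
    · change _ = n - (g.curry 1).degree
      omega
    · exact congrArg Nat.cast hw.2
    · exact congrArg (fun g => (MvPolynomial.monomial g 1 : Model)) hg2.symm
  · rw [zero_smul, map_zero]; exact zero_mem _
  · intro p q _ _ hp hq
    rw [add_smul, map_add]; exact add_mem hp hq
  · intro c p _ hp
    rw [smul_assoc, map_smul]; exact Submodule.smul_mem _ _ hp

theorem toModel_injective (n : ℕ) : Function.Injective (toModel n) := by
  have hli : LinearIndependent ℂ fun i => toModel n (spanVec n i) := by
    refine linearIndependent_of_genFun_eq (linearIndependent_modelMono n) (finFib_wDeg n)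
      (finFib_spanDeg n) ((genFun_spanDeg n).trans (genFun_wDeg n).symm) (fun i => ?_) fun k => ?_
    · have := toModel_mem (spanVec_mem n i)
      simpa only [Nat.cast_inj] using this
    · obtain ⟨v, hv⟩ := modelMono_mem_range k
      have h1 : v ∈ Submodule.span ℂ (Set.range (spanVec n)) := by
        rw [span_spanVec]; trivial
      have h2 := Submodule.mem_map_of_mem (f := (toModel n : Weyl n →ₗ[ℂ] Model)) h1
      rw [Submodule.map_span, ← Set.range_comp, hv] at h2
      exact h2
  rw [injective_iff_map_eq_zero]
  intro v hv
  have h1 : v ∈ Submodule.span ℂ (Set.range (spanVec n)) := by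
    rw [span_spanVec]; trivial
  obtain ⟨c, rfl⟩ := Finsupp.mem_span_range_iff_exists_finsupp.1 h1
  have h0 : c = 0 := by
    apply hli
    rw [map_zero, Finsupp.linearCombination_apply, ← hv, Finsupp.sum, map_finsuppSum]
    simp only [map_smul]
    rfl
  rw [h0, Finsupp.sum_zero_index]

/-- If the pieces `𝒱 r` span `V` and are contained in the homogeneous pieces defined by a basis,
they are equal to them. -/
theorem eq_span_of_le {V ι : Type*} [AddCommGroup V] [Module ℂ V] {𝒱 : ℤ → Submodule ℂ V}
    (b : Module.Basis ι ℂ V) (d : ι → ℤ)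
    (hle : ∀ r, 𝒱 r ≤ Submodule.span ℂ (b '' {i | d i = r})) (htop : ⨆ r, 𝒱 r = ⊤) (r : ℤ) :
    𝒱 r = Submodule.span ℂ (b '' {i | d i = r}) := by
  refine le_antisymm (hle r) fun x hx => ?_
  let π : V →ₗ[ℂ] V := b.constr ℂ fun i => if d i = r then b i else 0
  have h1 : ∀ x ∈ Submodule.span ℂ (b '' {i | d i = r}), π x = x := by
    intro x hx
    refine Submodule.span_induction (p := fun x _ => π x = x) ?_ (map_zero _)
      (fun _ _ _ _ h h' => by rw [map_add, h, h']) (fun _ _ _ h => by rw [map_smul, h]) hx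
    rintro _ ⟨i, hi, rfl⟩
    exact (b.constr_basis ℂ _ i).trans (if_pos hi)
  have h2 : ∀ s ≠ r, ∀ x ∈ Submodule.span ℂ (b '' {i | d i = s}), π x = 0 := by
    intro s hs x hx
    refine Submodule.span_induction (p := fun x _ => π x = 0) ?_ (map_zero _)
      (fun _ _ _ _ h h' => by rw [map_add, h, h', add_zero])
      (fun _ _ _ h => by rw [map_smul, h, smul_zero]) hx
    rintro _ ⟨i, hi, rfl⟩
    exact (b.constr_basis ℂ _ i).trans (if_neg fun h => hs (hi.symm.trans h))
  have h3 : ∀ v ∈ ⨆ s, 𝒱 s, π v ∈ 𝒱 r := by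
    intro v hv
    induction hv using Submodule.iSup_induction' with
    | mem s v hv =>
      by_cases hs : s = r
      · subst hs
        rwa [h1 v (hle _ hv)]
      · rw [h2 s hs v (hle _ hv)]; exact zero_mem _
    | zero => rw [map_zero]; exact zero_mem _
    | add v w _ _ hv hw => rw [map_add]; exact add_mem hv hw
  rw [← h1 x hx]
  exact h3 x (htop ▸ Submodule.mem_top)

theorem exists_weylBasis (n : ℕ) :
    ∃ b : Module.Basis (WIdx n) ℂ (Weyl n), IsGradedBasis (weylGrading n) b wDeg wWt := by
  choose v hv using modelMono_mem_range (n := n)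
  let f := (toModel n : Weyl n →ₗ[ℂ] Model)
  have hinj : Function.Injective f := toModel_injective n
  have hfv : f ∘ v = modelMono := funext hv
  have hli : LinearIndependent ℂ v := LinearIndependent.of_comp f (by
    rw [hfv]; exact linearIndependent_modelMono n)
  have hle : ∀ r, weylGrading n r ≤ Submodule.span ℂ (v '' {i | (wDeg i : ℤ) = r}) := by
    intro r x hx
    have := toModel_mem hx
    rw [← hfv, Set.image_comp, ← Submodule.map_span] at this
    obtain ⟨y, hy, e⟩ := this
    rwa [← hinj e]
  have hspan : ⊤ ≤ Submodule.span ℂ (Set.range v) := by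
    rw [← iSup_weylGrading]
    exact iSup_le fun r => (hle r).trans (Submodule.span_mono (Set.image_subset_range _ _))
  let b := Module.Basis.mk hli hspan
  have hb : ⇑b = v := Module.Basis.coe_mk hli hspan
  refine ⟨b, finFib_wDeg n, eq_span_of_le b (fun i => (wDeg i : ℤ)) ?_ (iSup_weylGrading n), ?_⟩
  · intro r
    rw [hb]; exact hle r
  · intro i
    rw [mem_wtSpace, hb]
    apply hinj
    rw [map_smul]
    refine (map_actOp (toModel n) _ _ _).trans ?_
    rw [show toModel n (v i) = modelMono i from hv i, actOp_H_modelMono]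
    exact congrArg _ (hv i).symm

/-- The basis of `W(n)` corresponding to the monomials of the model. -/
def weylBasis (n : ℕ) : Module.Basis (WIdx n) ℂ (Weyl n) := (exists_weylBasis n).choose

theorem isGradedBasis_weyl (n : ℕ) : IsGradedBasis (weylGrading n) (weylBasis n) wDeg wWt :=
  (exists_weylBasis n).choose_spec

/-! ### Tensor products of graded representations -/

section

variable {V W : Type} [AddCommGroup V] [Module ℂ V] [AddCommGroup W] [Module ℂ W]

variable (V W) in
/-- The operator `f ⊗ 1`. -/
def lAct : Module.End ℂ V →ₐ[ℂ] Module.End ℂ (V ⊗[ℂ] W) := Module.End.rTensorAlgHom ℂ V W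

variable (V W) in
/-- The operator `1 ⊗ f`. -/
def rAct : Module.End ℂ W →ₐ[ℂ] Module.End ℂ (V ⊗[ℂ] W) := Module.End.lTensorAlgHom ℂ W V

theorem lAct_tmul (f : Module.End ℂ V) (v : V) (w : W) : lAct V W f (v ⊗ₜ w) = f v ⊗ₜ w := rfl

theorem rAct_tmul (f : Module.End ℂ W) (v : V) (w : W) : rAct V W f (v ⊗ₜ w) = v ⊗ₜ f w := rfl

theorem commute_lAct_rAct (f : Module.End ℂ V) (g : Module.End ℂ W) :
    Commute (lAct V W f) (rAct V W g) :=
  TensorProduct.ext' fun _ _ => rfl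

theorem HasDeg.lAct {𝒱 : ℤ → Submodule ℂ V} {𝒲 : ℤ → Submodule ℂ W} {d : ℕ} {f : Module.End ℂ V}
    (hf : HasDeg 𝒱 d f) : HasDeg (tensorGrading 𝒱 𝒲) d (lAct V W f) := by
  intro r v hv
  refine (iSup_le (a := (tensorGrading 𝒱 𝒲 (d + r)).comap (CurrentSl2.lAct V W f)) fun k => ?_) hv
  rw [Submodule.map₂_le]
  intro m hm n hn
  refine Submodule.mem_iSup_of_mem (d + k) ?_
  rw [add_sub_add_left_eq_sub]
  exact Submodule.apply_mem_map₂ _ (hf k m hm) hn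

theorem HasDeg.rAct {𝒱 : ℤ → Submodule ℂ V} {𝒲 : ℤ → Submodule ℂ W} {d : ℕ} {f : Module.End ℂ W}
    (hf : HasDeg 𝒲 d f) : HasDeg (tensorGrading 𝒱 𝒲) d (rAct V W f) := by
  intro r v hv
  refine (iSup_le (a := (tensorGrading 𝒱 𝒲 (d + r)).comap (CurrentSl2.rAct V W f)) fun k => ?_) hv
  rw [Submodule.map₂_le]
  intro m hm n hn
  refine Submodule.mem_iSup_of_mem k ?_
  rw [add_sub_assoc]
  exact Submodule.apply_mem_map₂ _ hm (hf _ n hn)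

variable [LieRingModule Sl2t V] [LieModule ℂ Sl2t V] [LieRingModule Sl2t W] [LieModule ℂ Sl2t W]

theorem actOp_tensor (a : Sl2) (r : ℕ) :
    actOp (V ⊗[ℂ] W) a r = lAct V W (actOp V a r) + rAct V W (actOp W a r) :=
  TensorProduct.ext' fun v w => TensorProduct.LieModule.lie_tmul_right _ v w

theorem tmul_mem_wtSpace {α β : ℤ} {v : V} {w : W} (hv : v ∈ wtSpace V α) (hw : w ∈ wtSpace W β) :
    v ⊗ₜ[ℂ] w ∈ wtSpace (V ⊗[ℂ] W) (α + β) := by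
  rw [mem_wtSpace] at hv hw ⊢
  rw [actOp_tensor, LinearMap.add_apply, lAct_tmul, rAct_tmul, hv, hw, TensorProduct.tmul_smul,
    ← TensorProduct.smul_tmul', ← add_smul]
  push_cast
  rfl

theorem IsGradedBasis.tensor {𝒱 : ℤ → Submodule ℂ V} {𝒲 : ℤ → Submodule ℂ W} {ι κ : Type}
    {b : Module.Basis ι ℂ V} {c : Module.Basis κ ℂ W} {d : ι → ℕ} {e : κ → ℕ} {wt : ι → ℤ}
    {wt' : κ → ℤ} (H : IsGradedBasis 𝒱 b d wt) (H' : IsGradedBasis 𝒲 c e wt') :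
    IsGradedBasis (tensorGrading 𝒱 𝒲) (b.tensorProduct c) (fun p => d p.1 + e p.2)
      (fun p => wt p.1 + wt' p.2) where
  finFib := H.finFib.prod H'.finFib
  grade r := by
    apply le_antisymm
    · refine iSup_le fun k => ?_
      rw [H.grade, H'.grade, Submodule.map₂_span_span]
      refine Submodule.span_mono ?_
      rintro _ ⟨_, ⟨i, hi, rfl⟩, _, ⟨j, hj, rfl⟩, rfl⟩
      refine ⟨(i, j), ?_, Module.Basis.tensorProduct_apply _ _ _ _⟩
      have h1 : (d i : ℤ) = k := hi
      have h2 : (e j : ℤ) = r - k := hj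
      change ((d i + e j : ℕ) : ℤ) = r
      omega
    · rw [Submodule.span_le]
      rintro _ ⟨⟨i, j⟩, h, rfl⟩
      rw [Module.Basis.tensorProduct_apply]
      have h1 : ((d i + e j : ℕ) : ℤ) = r := h
      have h2 := H'.basis_mem j
      rw [show (e j : ℤ) = r - d i by omega] at h2
      exact Submodule.mem_iSup_of_mem (d i : ℤ)
        (Submodule.apply_mem_map₂ _ (H.basis_mem i) h2)
  wt_mem p := by
    rw [Module.Basis.tensorProduct_apply']
    exact tmul_mem_wtSpace (H.wt_mem p.1) (H'.wt_mem p.2)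

theorem actOp_H_mem_wtSpace (r : ℕ) {μ : ℤ} {v : V} (hv : v ∈ wtSpace V μ) :
    actOp V sl2H r v ∈ wtSpace V μ := by
  rw [mem_wtSpace] at hv ⊢
  rw [← Module.End.mul_apply, actOp_comm_self, Module.End.mul_apply, hv, map_smul]

theorem actOp_Y_mem_wtSpace (r : ℕ) {μ : ℤ} {v : V} (hv : v ∈ wtSpace V (μ + 2)) :
    actOp V sl2Y r v ∈ wtSpace V μ := by
  rw [mem_wtSpace] at hv ⊢
  rw [← Module.End.mul_apply, actOp_H_Y, LinearMap.add_apply, Module.End.mul_apply, hv, map_smul,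
    zero_add, LinearMap.smul_apply, ← add_smul]
  push_cast
  congr 1
  ring

theorem actOp_X_mem_wtSpace (r : ℕ) {μ : ℤ} {v : V} (hv : v ∈ wtSpace V μ) :
    actOp V sl2X r v ∈ wtSpace V (μ + 2) := by
  rw [mem_wtSpace] at hv ⊢
  rw [← Module.End.mul_apply, actOp_H_X, LinearMap.add_apply, Module.End.mul_apply, hv, map_smul,
    zero_add, LinearMap.smul_apply, ← add_smul]
  push_cast
  rfl

variable (V) in
/-- The part of the weight space of weight `μ` obtained by applying the operators `y ⊗ t^r`. -/
def yImg (μ : ℤ) : Submodule ℂ V := ⨆ r, (wtSpace V (μ + 2)).map (actOp V sl2Y r)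

theorem actOp_Y_mem_yImg (r : ℕ) {μ : ℤ} {v : V} (hv : v ∈ wtSpace V (μ + 2)) :
    actOp V sl2Y r v ∈ yImg V μ :=
  Submodule.mem_iSup_of_mem r ⟨v, hv, rfl⟩

theorem yImg_le {μ : ℤ} : yImg V μ ≤ wtSpace V μ := by
  refine iSup_le fun r => ?_
  rintro _ ⟨v, hv, rfl⟩
  exact actOp_Y_mem_wtSpace r hv

theorem mem_yImg_of_commute {μ : ℤ} {f : Module.End ℂ V} (c : ℂ) (k : ℕ)
    (hf : ∀ v ∈ wtSpace V (μ + 2), f v ∈ wtSpace V (μ + 2))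
    (hc : ∀ r, f * actOp V sl2Y r = actOp V sl2Y r * f + c • actOp V sl2Y (r + k)) {v : V}
    (hv : v ∈ yImg V μ) : f v ∈ yImg V μ := by
  refine (iSup_le (a := (yImg V μ).comap f) fun r => ?_) hv
  rintro _ ⟨v, hv, rfl⟩
  rw [Submodule.mem_comap, ← Module.End.mul_apply, hc]
  exact add_mem (actOp_Y_mem_yImg r (hf v hv))
    (Submodule.smul_mem _ _ (actOp_Y_mem_yImg (r + k) hv))

theorem lAct_actOp_Y_mem (r : ℕ) {μ : ℤ} {v : V ⊗[ℂ] W} (hv : v ∈ wtSpace (V ⊗[ℂ] W) (μ + 2)) :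
    lAct V W (actOp V sl2Y r) v ∈ wtSpace (V ⊗[ℂ] W) μ := by
  have h : actOp (V ⊗[ℂ] W) sl2H 0 * lAct V W (actOp V sl2Y r) =
      lAct V W (actOp V sl2Y r) * actOp (V ⊗[ℂ] W) sl2H 0 +
        (-2 : ℂ) • lAct V W (actOp V sl2Y r) := by
    rw [actOp_tensor, add_mul, mul_add, ← map_mul, actOp_H_Y, ← (commute_lAct_rAct _ _).eq, map_add,
      map_mul, map_smul, zero_add]
    abel
  rw [mem_wtSpace] at hv ⊢
  rw [← Module.End.mul_apply, h, LinearMap.add_apply, Module.End.mul_apply, hv, map_smul,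
    LinearMap.smul_apply, ← add_smul]
  push_cast
  congr 1
  ring

theorem rAct_actOp_Y_mem (r : ℕ) {μ : ℤ} {v : V ⊗[ℂ] W} (hv : v ∈ wtSpace (V ⊗[ℂ] W) (μ + 2)) :
    rAct V W (actOp W sl2Y r) v ∈ wtSpace (V ⊗[ℂ] W) μ := by
  have h := actOp_Y_mem_wtSpace r hv
  rw [actOp_tensor, LinearMap.add_apply] at h
  exact ((Submodule.add_mem_iff_right _ (lAct_actOp_Y_mem r hv)).1 h)

theorem lAct_yEval_mem {k : ℕ} {q : MvPolynomial ℕ ℂ} (hq : q ∈ polyDeg k) {μ : ℤ} {v : V ⊗[ℂ] W}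
    (hv : v ∈ wtSpace (V ⊗[ℂ] W) μ) :
    lAct V W (yEval V q) v ∈ wtSpace (V ⊗[ℂ] W) (μ - 2 * k) := by
  induction k generalizing q with
  | zero =>
    rw [polyDeg_zero_eq, Submodule.mem_span_singleton] at hq
    obtain ⟨c, rfl⟩ := hq
    rw [map_smul, map_smul, map_one, map_one]
    simpa using Submodule.smul_mem _ c hv
  | succ k ih =>
    refine polyDeg_succ_le (N := (wtSpace (V ⊗[ℂ] W) (μ - 2 * (k + 1 : ℕ))).comap
      ((LinearMap.applyₗ v).comp ((lAct V W).toLinearMap.comp (yEval V).toLinearMap))) ?_ hq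
    intro s q hq
    change lAct V W (yEval V (MvPolynomial.X s * q)) v ∈ wtSpace (V ⊗[ℂ] W) _
    rw [map_mul, map_mul, yEval_X]
    refine lAct_actOp_Y_mem s ?_
    rw [show (μ - 2 * (k + 1 : ℕ) + 2 : ℤ) = μ - 2 * k by push_cast; ring]
    exact ih hq

/-- Modulo the image of the operators `y ⊗ t^r`, a product of `k` such operators can be moved from
the first to the second factor, up to the sign `(-1)^k`. -/
theorem lAct_sub_rAct_mem_yImg {k : ℕ} {q : MvPolynomial ℕ ℂ} (hq : q ∈ polyDeg k) {μ : ℤ}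
    {v : V ⊗[ℂ] W} (hv : v ∈ wtSpace (V ⊗[ℂ] W) μ) :
    lAct V W (yEval V q) v - (-1 : ℂ) ^ k • rAct V W (yEval W q) v ∈
      yImg (V ⊗[ℂ] W) (μ - 2 * k) := by
  induction k generalizing q μ v with
  | zero =>
    rw [polyDeg_zero_eq, Submodule.mem_span_singleton] at hq
    obtain ⟨c, rfl⟩ := hq
    simp
  | succ k ih =>
    refine polyDeg_succ_le (N := (yImg (V ⊗[ℂ] W) (μ - 2 * (k + 1 : ℕ))).comap
      ((LinearMap.applyₗ v).comp ((lAct V W).toLinearMap.comp (yEval V).toLinearMap -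
        (-1 : ℂ) ^ (k + 1) • (rAct V W).toLinearMap.comp (yEval W).toLinearMap))) ?_ hq
    intro s q hq
    change lAct V W (yEval V (MvPolynomial.X s * q)) v -
      (-1 : ℂ) ^ (k + 1) • rAct V W (yEval W (MvPolynomial.X s * q)) v ∈ yImg (V ⊗[ℂ] W) _
    have e1 : (μ - 2 * (k + 1 : ℕ) + 2 : ℤ) = μ - 2 * k := by push_cast; ring
    have h1 : actOp (V ⊗[ℂ] W) sl2Y s (lAct V W (yEval V q) v) ∈
        yImg (V ⊗[ℂ] W) (μ - 2 * (k + 1 : ℕ)) :=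
      actOp_Y_mem_yImg s (by rw [e1]; exact lAct_yEval_mem hq hv)
    have h2 := ih hq (μ := μ - 2) (v := rAct V W (actOp W sl2Y s) v)
      (rAct_actOp_Y_mem s (by rwa [sub_add_cancel]))
    rw [show (μ - 2 - 2 * k : ℤ) = μ - 2 * (k + 1 : ℕ) by push_cast; ring] at h2
    have e : lAct V W (yEval V (MvPolynomial.X s * q)) v -
        (-1 : ℂ) ^ (k + 1) • rAct V W (yEval W (MvPolynomial.X s * q)) v =
        actOp (V ⊗[ℂ] W) sl2Y s (lAct V W (yEval V q) v) -
        (lAct V W (yEval V q) (rAct V W (actOp W sl2Y s) v) -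
          (-1 : ℂ) ^ k • rAct V W (yEval W q) (rAct V W (actOp W sl2Y s) v)) := by
      rw [actOp_tensor, mul_comm (MvPolynomial.X s) q, mul_comm q, map_mul, map_mul, yEval_X,
        mul_comm (MvPolynomial.X s) q, map_mul, map_mul, yEval_X, Module.End.mul_apply,
        Module.End.mul_apply, ← Module.End.mul_apply (lAct V W (yEval V q)) (rAct V W _),
        (commute_lAct_rAct _ _).eq, Module.End.mul_apply, LinearMap.add_apply, pow_succ]
      module
    rw [e]
    exact sub_mem h1 h2

end

/-! ### Spanning the weight spaces of `W(a) ⊗ W(b)` -/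

theorem mul_mem_polyDeg {k l : ℕ} {p q : MvPolynomial ℕ ℂ} (hp : p ∈ polyDeg k)
    (hq : q ∈ polyDeg l) : p * q ∈ polyDeg (k + l) := by
  induction k generalizing p with
  | zero =>
    rw [polyDeg_zero_eq, Submodule.mem_span_singleton] at hp
    obtain ⟨c, rfl⟩ := hp
    rw [smul_mul_assoc, one_mul, zero_add]
    exact Submodule.smul_mem _ c hq
  | succ k ih =>
    refine polyDeg_succ_le (N := (polyDeg (k + 1 + l)).comap (LinearMap.mulRight ℂ q)) ?_ hp
    intro s p hp
    rw [Submodule.mem_comap, LinearMap.mulRight_apply, mul_assoc, Nat.add_right_comm]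
    exact X_mul_mem_polyDeg s (ih hp)

theorem coeff_mk_X_pow_mem_polyDeg (k n : ℕ) : PowerSeries.coeff n
    ((PowerSeries.mk fun s => (MvPolynomial.X s : MvPolynomial ℕ ℂ)) ^ k) ∈ polyDeg k := by
  induction k generalizing n with
  | zero =>
    rw [pow_zero, PowerSeries.coeff_one, polyDeg_zero_eq]
    split_ifs
    · exact Submodule.mem_span_singleton_self _
    · exact zero_mem _
  | succ k ih =>
    rw [pow_succ', PowerSeries.coeff_mul]
    refine Submodule.sum_mem _ fun q _ => ?_
    rw [PowerSeries.coeff_mk]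
    exact X_mul_mem_polyDeg _ (ih _)

section

variable (a b : ℕ)

/-- The tensor product `W(a) ⊗ W(b)`. -/
abbrev TW : Type := Weyl a ⊗[ℂ] Weyl b

/-- The vector `w_a ⊗ w_b`. -/
def tGen : TW a b := weylGen a ⊗ₜ weylGen b

/-- The operators `δ ⊗ 1 + 1 ⊗ δ`. -/
def deltaT (r : ℕ) : Module.End ℂ (TW a b) :=
  lAct (Weyl a) (Weyl b) (delta a r) + rAct (Weyl a) (Weyl b) (delta b r)

theorem two_smul_deltaT (r : ℕ) : (2 : ℂ) • deltaT a b r =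
    lAct _ _ (rhoEnd a (r + 1)) + rAct _ _ (rhoEnd b (r + 1)) - actOp (TW a b) sl2H (r + 1) := by
  rw [deltaT, delta, delta, map_smul, map_smul, map_sub, map_sub, actOp_tensor, ← smul_add,
    smul_smul, mul_inv_cancel₀ two_ne_zero, one_smul]
  abel

theorem deltaT_eq (r : ℕ) : deltaT a b r = (2⁻¹ : ℂ) •
    (lAct _ _ (rhoEnd a (r + 1)) + rAct _ _ (rhoEnd b (r + 1)) -
      actOp (TW a b) sl2H (r + 1)) := by
  rw [← two_smul_deltaT, smul_smul, inv_mul_cancel₀ two_ne_zero, one_smul]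

theorem commute_lAct_rho (r : ℕ) (z : Sl2) (s : ℕ) :
    Commute (lAct _ _ (rhoEnd a r)) (actOp (TW a b) z s) := by
  rw [actOp_tensor]
  have h : Commute (rhoEnd a r) (actOp _ z s) := rhoEnd_actOp a r z s
  exact (h.map (lAct _ _)).add_right (commute_lAct_rAct _ _)

theorem commute_rAct_rho (r : ℕ) (z : Sl2) (s : ℕ) :
    Commute (rAct _ _ (rhoEnd b r)) (actOp (TW a b) z s) := by
  rw [actOp_tensor]
  have h : Commute (rhoEnd b r) (actOp _ z s) := rhoEnd_actOp b r z s
  exact (commute_lAct_rAct _ _).symm.add_right (h.map (rAct _ _))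

theorem commute_deltaT_lAct (r s : ℕ) :
    Commute (deltaT a b r) (lAct _ _ (rhoEnd a (s + 1))) :=
  ((commute_rhoEnd_delta a (s + 1) r).symm.map (lAct _ _)).add_left (commute_lAct_rAct _ _).symm

theorem commute_deltaT_rAct (r s : ℕ) :
    Commute (deltaT a b r) (rAct _ _ (rhoEnd b (s + 1))) :=
  (commute_lAct_rAct _ _).add_left ((commute_rhoEnd_delta b (s + 1) r).symm.map (rAct _ _))

theorem commute_deltaT (r s : ℕ) : Commute (deltaT a b r) (deltaT a b s) :=
  (((commute_delta a r s).map (lAct _ _)).add_right (commute_lAct_rAct _ _)).add_left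
    ((commute_lAct_rAct _ _).symm.add_right ((commute_delta b r s).map (rAct _ _)))

/-- The commutative algebra of operators generated by `δ ⊗ 1 + 1 ⊗ δ`, `ρ ⊗ 1` and `1 ⊗ ρ`, as the
image of a polynomial ring. -/
def phiT : MvPolynomial (ℕ ⊕ ℕ ⊕ ℕ) ℂ →ₐ[ℂ] Module.End ℂ (TW a b) :=
  commAeval (Sum.elim (deltaT a b) (Sum.elim (fun i => lAct _ _ (rhoEnd a (i + 1)))
    (fun i => rAct _ _ (rhoEnd b (i + 1))))) (by
    have hl : ∀ i j, Commute (lAct (Weyl a) (Weyl b) (rhoEnd a (i + 1)))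
        (lAct _ _ (rhoEnd a (j + 1))) := fun i j =>
      Commute.map (show Commute _ _ from rhoEnd_comm a (i + 1) (j + 1)) (lAct _ _)
    have hr : ∀ i j, Commute (rAct (Weyl a) (Weyl b) (rhoEnd b (i + 1)))
        (rAct _ _ (rhoEnd b (j + 1))) := fun i j =>
      Commute.map (show Commute _ _ from rhoEnd_comm b (i + 1) (j + 1)) (rAct _ _)
    rintro (i | i | i) (j | j | j)
    · exact commute_deltaT a b i j
    · exact commute_deltaT_lAct a b i j
    · exact commute_deltaT_rAct a b i j
    · exact (commute_deltaT_lAct a b j i).symm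
    · exact hl i j
    · exact commute_lAct_rAct _ _
    · exact (commute_deltaT_rAct a b j i).symm
    · exact (commute_lAct_rAct _ _).symm
    · exact hr i j)

/-- The variable acting by `δ ⊗ 1 + 1 ⊗ δ`. -/
def pD (i : ℕ) : MvPolynomial (ℕ ⊕ ℕ ⊕ ℕ) ℂ := MvPolynomial.X (Sum.inl i)

/-- The variable acting by `ρ ⊗ 1`. -/
def pL (i : ℕ) : MvPolynomial (ℕ ⊕ ℕ ⊕ ℕ) ℂ := MvPolynomial.X (Sum.inr (Sum.inl i))

/-- The variable acting by `1 ⊗ ρ`. -/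
def pR (i : ℕ) : MvPolynomial (ℕ ⊕ ℕ ⊕ ℕ) ℂ := MvPolynomial.X (Sum.inr (Sum.inr i))

theorem phiT_pD (i : ℕ) : phiT a b (pD i) = deltaT a b i := commAeval_X _ _ _

theorem phiT_pL (i : ℕ) : phiT a b (pL i) = lAct _ _ (rhoEnd a (i + 1)) := commAeval_X _ _ _

theorem phiT_pR (i : ℕ) : phiT a b (pR i) = rAct _ _ (rhoEnd b (i + 1)) := commAeval_X _ _ _

theorem phiT_pH (i : ℕ) :
    phiT a b (pL i + pR i - 2 * pD i) = actOp (TW a b) sl2H (i + 1) := by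
  have h2 : (2 : MvPolynomial (ℕ ⊕ ℕ ⊕ ℕ) ℂ) * pD i = (2 : ℂ) • pD i := by
    rw [MvPolynomial.smul_eq_C_mul]; rfl
  rw [h2, map_sub, map_add, map_smul, phiT_pD, phiT_pL, phiT_pR, two_smul_deltaT]
  abel

theorem phiT_lam (i : ℕ) : phiT a b (expC pL i) = lAct _ _ (lam a i) :=
  map_expC_congr (φ := phiT a b) (φ' := (lAct _ _).comp (phiW a)) (fun i => by
    rw [phiT_pL, AlgHom.comp_apply, phiW_inr]) i

theorem phiT_lam' (i : ℕ) : phiT a b (expC pR i) = rAct _ _ (lam b i) :=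
  map_expC_congr (φ := phiT a b) (φ' := (rAct _ _).comp (phiW b)) (fun i => by
    rw [phiT_pR, AlgHom.comp_apply, phiW_inr]) i

theorem phiT_mem {N : Submodule ℂ (TW a b)} (hD : ∀ i, ∀ v ∈ N, deltaT a b i v ∈ N)
    (hL : ∀ i, ∀ v ∈ N, lAct _ _ (rhoEnd a (i + 1)) v ∈ N)
    (hR : ∀ i, ∀ v ∈ N, rAct _ _ (rhoEnd b (i + 1)) v ∈ N) (r : MvPolynomial (ℕ ⊕ ℕ ⊕ ℕ) ℂ)
    {v : TW a b} (hv : v ∈ N) : phiT a b r v ∈ N := by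
  refine mem_of_X_stable (phiT a b) ?_ r hv
  rintro (i | i | i) v hv
  · exact (phiT_pD a b i).symm ▸ hD i v hv
  · exact (phiT_pL a b i).symm ▸ hL i v hv
  · exact (phiT_pR a b i).symm ▸ hR i v hv

theorem mem_wtSpace_of_commute {V : Type} [AddCommGroup V] [Module ℂ V] [LieRingModule Sl2t V]
    [LieModule ℂ Sl2t V] {f : Module.End ℂ V} (hf : Commute f (actOp V sl2H 0)) {μ : ℤ} {v : V}
    (hv : v ∈ wtSpace V μ) : f v ∈ wtSpace V μ := by
  rw [mem_wtSpace] at hv ⊢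
  rw [← Module.End.mul_apply, ← hf.eq, Module.End.mul_apply, hv, map_smul]

theorem deltaT_mem_wtSpace (r : ℕ) {μ : ℤ} {v : TW a b} (hv : v ∈ wtSpace (TW a b) μ) :
    deltaT a b r v ∈ wtSpace (TW a b) μ := by
  rw [deltaT_eq]
  exact Submodule.smul_mem _ _ (sub_mem (add_mem
    (mem_wtSpace_of_commute (commute_lAct_rho a b _ _ _) hv)
    (mem_wtSpace_of_commute (commute_rAct_rho a b _ _ _) hv)) (actOp_H_mem_wtSpace _ hv))

theorem phiT_mem_wtSpace (r : MvPolynomial (ℕ ⊕ ℕ ⊕ ℕ) ℂ) {μ : ℤ} {v : TW a b}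
    (hv : v ∈ wtSpace (TW a b) μ) : phiT a b r v ∈ wtSpace (TW a b) μ :=
  phiT_mem a b (fun i _ => deltaT_mem_wtSpace a b i)
    (fun _ _ => mem_wtSpace_of_commute (commute_lAct_rho a b _ _ _))
    (fun _ _ => mem_wtSpace_of_commute (commute_rAct_rho a b _ _ _)) r hv

theorem deltaT_actOp_Y (r s : ℕ) : deltaT a b r * actOp (TW a b) sl2Y s =
    actOp (TW a b) sl2Y s * deltaT a b r + (1 : ℂ) • actOp (TW a b) sl2Y (s + (r + 1)) := by
  rw [deltaT_eq, smul_mul_assoc, sub_mul, add_mul, (commute_lAct_rho a b _ _ _).eq,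
    (commute_rAct_rho a b _ _ _).eq, actOp_H_Y, mul_smul_comm, mul_sub, mul_add, add_comm s]
  module

theorem phiT_mem_yImg (r : MvPolynomial (ℕ ⊕ ℕ ⊕ ℕ) ℂ) {μ : ℤ} {v : TW a b}
    (hv : v ∈ yImg (TW a b) μ) : phiT a b r v ∈ yImg (TW a b) μ := by
  refine phiT_mem a b (fun i v hv => ?_) (fun i v hv => ?_) (fun i v hv => ?_) r hv
  · exact mem_yImg_of_commute 1 (i + 1) (fun v => deltaT_mem_wtSpace a b i)
      (deltaT_actOp_Y a b i) hv
  · refine mem_yImg_of_commute 0 0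
      (fun v => mem_wtSpace_of_commute (commute_lAct_rho a b _ _ _)) (fun s => ?_) hv
    rw [zero_smul, add_zero]
    exact commute_lAct_rho a b _ _ _
  · refine mem_yImg_of_commute 0 0
      (fun v => mem_wtSpace_of_commute (commute_rAct_rho a b _ _ _)) (fun s => ?_) hv
    rw [zero_smul, add_zero]
    exact commute_rAct_rho a b _ _ _

theorem shiftSystem_tensor :
    ShiftSystem (fun s => rAct (Weyl a) (Weyl b) (actOp _ sl2Y s)) (deltaT a b) where
  comm i j := by rw [← map_mul, actOp_comm_self, map_mul]
  shift r s := by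
    rw [deltaT, add_mul, (commute_lAct_rAct _ _).eq, ← map_mul, (shiftSystem_weyl b).shift,
      map_add, map_mul, mul_add]
    abel

theorem shiftSystem_tensor_eval (q : MvPolynomial ℕ ℂ) :
    (shiftSystem_tensor a b).eval q = rAct _ _ (yEval _ q) := by
  have : (shiftSystem_tensor a b).eval = (rAct (Weyl a) (Weyl b)).comp (yEval (Weyl b)) := by
    ext1 i
    rw [ShiftSystem.eval_X, AlgHom.comp_apply, yEval_X]
  rw [this, AlgHom.comp_apply]

theorem deltaT_tGen (r : ℕ) : deltaT a b r (tGen a b) = 0 := by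
  rw [deltaT, LinearMap.add_apply, tGen, lAct_tmul, rAct_tmul, delta_gen, delta_gen,
    TensorProduct.zero_tmul, TensorProduct.tmul_zero, add_zero]

theorem tGen_mem_wtSpace : tGen a b ∈ wtSpace (TW a b) (a + b) :=
  tmul_mem_wtSpace (by rw [mem_wtSpace, (isWeylVec_weylGen a).h_zero]; rfl)
    (by rw [mem_wtSpace, (isWeylVec_weylGen b).h_zero]; rfl)

/-- The vector `w_a ⊗ (y ⊗ 1)^j w_b`. -/
def cVec (j : ℕ) : TW a b := (rAct (Weyl a) (Weyl b) (actOp _ sl2Y 0) ^ j) (tGen a b)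

theorem cVec_mem_wtSpace (j : ℕ) : cVec a b j ∈ wtSpace (TW a b) (a + b - 2 * j) := by
  induction j with
  | zero => simpa [cVec] using tGen_mem_wtSpace a b
  | succ j ih =>
    rw [cVec, pow_succ', Module.End.mul_apply]
    refine rAct_actOp_Y_mem 0 ?_
    rw [show (a + b - 2 * (j + 1 : ℕ) + 2 : ℤ) = a + b - 2 * j by push_cast; ring]
    exact ih

/-- Polarization: `w_a ⊗ q(y) w_b` is obtained from `w_a ⊗ (y ⊗ 1)^j w_b`. -/
theorem exists_phiT_cVec {j : ℕ} {q : MvPolynomial ℕ ℂ} (hq : q ∈ polyDeg j) :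
    ∃ r, phiT a b r (cVec a b j) = rAct _ _ (yEval _ q) (tGen a b) := by
  have := (shiftSystem_tensor a b).eval_mem (deltaT_tGen a b)
    (N := LinearMap.range ((LinearMap.applyₗ (cVec a b j)).comp (phiT a b).toLinearMap))
    ⟨1, by simp [cVec]⟩ (by
      rintro r _ ⟨s, rfl⟩
      refine ⟨pD r * s, ?_⟩
      simp [phiT_pD]) hq
  rw [shiftSystem_tensor_eval] at this
  exact this

/-- Conversely the operators `δ ⊗ 1 + 1 ⊗ δ` map `w_a ⊗ (y ⊗ 1)^j w_b` to vectors
`w_a ⊗ q(y) w_b`. -/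
theorem exists_yEval_eq (j : ℕ) (x : MvPolynomial ℕ ℂ) : ∃ q ∈ polyDeg j,
    phiT a b (MvPolynomial.rename Sum.inl x) (cVec a b j) = rAct _ _ (yEval _ q) (tGen a b) := by
  have hx : phiT a b (MvPolynomial.rename Sum.inl x) (cVec a b j) ∈ (polyDeg j).map
      ((LinearMap.applyₗ (tGen a b)).comp (shiftSystem_tensor a b).eval.toLinearMap) := by
    refine mem_of_X_stable ((phiT a b).comp (MvPolynomial.rename Sum.inl)) ?_ x ?_
    · rintro i _ ⟨q, hq, rfl⟩
      rw [AlgHom.comp_apply, MvPolynomial.rename_X]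
      refine ⟨_, shiftDer_mem_polyDeg (i + 1) hq, ?_⟩
      refine ((shiftSystem_tensor a b).shift_eval_apply (deltaT_tGen a b) i q).symm.trans ?_
      rw [← phiT_pD]
      rfl
    · refine ⟨MvPolynomial.X 0 ^ j * 1, X_zero_pow_mul_mem_polyDeg j (k := 0) ?_, ?_⟩
      · rw [polyDeg_zero_eq]
        exact Submodule.mem_span_singleton_self _
      · rw [mul_one]
        change (shiftSystem_tensor a b).eval (MvPolynomial.X 0 ^ j) (tGen a b) = cVec a b j
        rw [map_pow, ShiftSystem.eval_X, cVec]
  obtain ⟨q, hq, e⟩ := hx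
  refine ⟨q, hq, e.symm.trans ?_⟩
  rw [← shiftSystem_tensor_eval]
  rfl

/-- The subspace generated by `w_a ⊗ (y ⊗ 1)^j w_b` under the algebra of operators, and the image of
the operators `y ⊗ t^r`. -/
def aSpace (j : ℕ) : Submodule ℂ (TW a b) :=
  LinearMap.range ((LinearMap.applyₗ (cVec a b j)).comp (phiT a b).toLinearMap) ⊔
    yImg (TW a b) (a + b - 2 * j)

theorem phiT_mem_aSpace {j : ℕ} (r : MvPolynomial (ℕ ⊕ ℕ ⊕ ℕ) ℂ) {v : TW a b}
    (hv : v ∈ aSpace a b j) : phiT a b r v ∈ aSpace a b j := by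
  obtain ⟨_, ⟨s, rfl⟩, z, hz, rfl⟩ := Submodule.mem_sup.1 hv
  rw [map_add]
  refine add_mem (Submodule.mem_sup_left ⟨r * s, ?_⟩)
    (Submodule.mem_sup_right (phiT_mem_yImg a b r hz))
  simp

theorem aSpace_le (j : ℕ) : aSpace a b j ≤ wtSpace (TW a b) (a + b - 2 * j) := by
  refine sup_le ?_ yImg_le
  rintro _ ⟨r, rfl⟩
  exact phiT_mem_wtSpace a b r (cVec_mem_wtSpace a b j)

theorem yEval_yEval_mem_aSpace {k l : ℕ} {q q' : MvPolynomial ℕ ℂ} (hq : q ∈ polyDeg k)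
    (hq' : q' ∈ polyDeg l) :
    lAct _ _ (yEval _ q) (rAct _ _ (yEval _ q') (tGen a b)) ∈ aSpace a b (k + l) := by
  have hw : rAct _ _ (yEval _ q') (tGen a b) ∈ wtSpace (TW a b) (a + b - 2 * l) := by
    obtain ⟨r, hr⟩ := exists_phiT_cVec a b hq'
    rw [← hr]
    exact phiT_mem_wtSpace a b r (cVec_mem_wtSpace a b l)
  have h1 := lAct_sub_rAct_mem_yImg hq hw
  rw [show (a + b - 2 * l - 2 * k : ℤ) = a + b - 2 * (k + l : ℕ) by push_cast; ring] at h1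
  refine (Submodule.sub_mem_iff_left _ ?_).1 (Submodule.mem_sup_right h1)
  refine Submodule.mem_sup_left (Submodule.smul_mem _ _ ?_)
  obtain ⟨r, hr⟩ := exists_phiT_cVec a b (mul_mem_polyDeg hq hq')
  refine ⟨r, hr.trans ?_⟩
  rw [map_mul, map_mul]
  rfl

theorem iSup_aSpace : ⨆ j, aSpace a b j = ⊤ := by
  rw [eq_top_iff, ← TensorProduct.map₂_mk_top_top_eq_top, ← span_rho_y a, ← span_rho_y b,
    Submodule.map₂_span_span, Submodule.span_le]
  rintro _ ⟨_, ⟨⟨p, q⟩, rfl⟩, _, ⟨⟨p', q'⟩, rfl⟩, rfl⟩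
  have hl : lAct (Weyl a) (Weyl b) (phiW a (MvPolynomial.rename Sum.inr p)) =
      phiT a b (MvPolynomial.rename (Sum.inr ∘ Sum.inl) p) := by
    have : (lAct (Weyl a) (Weyl b)).comp ((phiW a).comp (MvPolynomial.rename Sum.inr)) =
        (phiT a b).comp (MvPolynomial.rename (Sum.inr ∘ Sum.inl)) := by
      ext1 i
      simp only [AlgHom.comp_apply, MvPolynomial.rename_X, phiW_inr]
      exact (phiT_pL a b i).symm
    exact AlgHom.congr_fun this p
  have hr : rAct (Weyl a) (Weyl b) (phiW b (MvPolynomial.rename Sum.inr p')) =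
      phiT a b (MvPolynomial.rename (Sum.inr ∘ Sum.inr) p') := by
    have : (rAct (Weyl a) (Weyl b)).comp ((phiW b).comp (MvPolynomial.rename Sum.inr)) =
        (phiT a b).comp (MvPolynomial.rename (Sum.inr ∘ Sum.inr)) := by
      ext1 i
      simp only [AlgHom.comp_apply, MvPolynomial.rename_X, phiW_inr]
      exact (phiT_pR a b i).symm
    exact AlgHom.congr_fun this p'
  have e : phiW a (MvPolynomial.rename Sum.inr p) (yEval _ q (weylGen a)) ⊗ₜ[ℂ]
      phiW b (MvPolynomial.rename Sum.inr p') (yEval _ q' (weylGen b)) =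
      phiT a b (MvPolynomial.rename (Sum.inr ∘ Sum.inl) p)
        (phiT a b (MvPolynomial.rename (Sum.inr ∘ Sum.inr) p')
          (lAct _ _ (yEval _ q) (rAct _ _ (yEval _ q') (tGen a b)))) := by
    rw [← hl, ← hr]
    rfl
  change phiW a (MvPolynomial.rename Sum.inr p) (yEval _ q (weylGen a)) ⊗ₜ[ℂ]
      phiW b (MvPolynomial.rename Sum.inr p') (yEval _ q' (weylGen b)) ∈ ⨆ j, aSpace a b j
  rw [e]
  have hst : ∀ r, ∀ v ∈ ⨆ j, aSpace a b j, phiT a b r v ∈ ⨆ j, aSpace a b j := fun r v hv =>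
    (iSup_le (a := (⨆ j, aSpace a b j).comap (phiT a b r)) fun j v hv =>
      Submodule.mem_iSup_of_mem j (phiT_mem_aSpace a b r hv)) hv
  refine hst _ _ (hst _ _ ?_)
  clear e
  have hq : q ∈ ⨆ k, polyDeg k := by rw [iSup_polyDeg]; trivial
  have hq' : q' ∈ ⨆ k, polyDeg k := by rw [iSup_polyDeg]; trivial
  induction hq using Submodule.iSup_induction' with
  | zero => simp
  | add p q _ _ hp hq =>
    rw [map_add, map_add, LinearMap.add_apply]
    exact add_mem hp hq
  | mem k q hq =>
    induction hq' using Submodule.iSup_induction' with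
    | zero => simp
    | add p q _ _ hp hq =>
      rw [map_add, map_add, LinearMap.add_apply, map_add]
      exact add_mem hp hq
    | mem l q' hq' => exact Submodule.mem_iSup_of_mem (k + l) (yEval_yEval_mem_aSpace a b hq hq')

/-- The basis of `W(a) ⊗ W(b)` consisting of the products of basis vectors. -/
theorem isGradedBasis_tensor : IsGradedBasis (tensorGrading (weylGrading a) (weylGrading b))
    ((weylBasis a).tensorProduct (weylBasis b)) (fun p => wDeg p.1 + wDeg p.2)
    (fun p => wWt p.1 + wWt p.2) :=
  (isGradedBasis_weyl a).tensor (isGradedBasis_weyl b)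

theorem wtSpace_le_aSpace (j : ℕ) : wtSpace (TW a b) (a + b - 2 * j) ≤ aSpace a b j := by
  have H := isGradedBasis_tensor a b
  have hwt : ∀ μ, wtSpace (TW a b) μ = Submodule.span ℂ
      (((weylBasis a).tensorProduct (weylBasis b)) '' {p | wWt p.1 + wWt p.2 = μ}) := by
    intro μ
    ext v
    rw [H.mem_wt, Module.Basis.mem_span_image]
    exact ⟨fun h i hi => h i (Finsupp.mem_support_iff.1 hi),
      fun h i hi => h (Finsupp.mem_support_iff.2 hi)⟩
  have h := eq_span_of_le (𝒱 := fun μ => ⨆ j : ℕ, ⨆ _ : (a + b - 2 * j : ℤ) = μ, aSpace a b j)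
    ((weylBasis a).tensorProduct (weylBasis b)) (fun p => wWt p.1 + wWt p.2) (fun μ => by
      refine iSup₂_le fun j hj => ?_
      rw [← hwt, ← hj]
      exact aSpace_le a b j) (by
      rw [eq_top_iff, ← iSup_aSpace]
      refine iSup_le fun j => le_iSup_of_le (a + b - 2 * j : ℤ) ?_
      exact le_iSup₂_of_le j rfl le_rfl) (a + b - 2 * j)
  rw [hwt, ← h]
  refine iSup₂_le fun i hi => ?_
  rw [show i = j by omega]

end

/-! ### Generators of the weight spaces of `W(a) ⊗ W(b)` -/

theorem mk_map {A B : Type*} [Ring A] [Ring B] [Algebra ℂ A] [Algebra ℂ B] (f : A →ₐ[ℂ] B)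
    (u : ℕ → A) : (PowerSeries.mk fun s => f (u s)) =
      PowerSeries.map (f : A →+* B) (PowerSeries.mk u) := by
  ext n
  simp

theorem coeff_map_mk {A B : Type*} [Ring A] [Ring B] [Algebra ℂ A] [Algebra ℂ B] (f : A →ₐ[ℂ] B)
    (u v : ℕ → A) (k n : ℕ) :
    PowerSeries.coeff n ((PowerSeries.mk fun s => f (u s)) ^ k * PowerSeries.mk fun t => f (v t)) =
      f (PowerSeries.coeff n (PowerSeries.mk u ^ k * PowerSeries.mk v)) := by
  rw [mk_map, mk_map, ← map_pow, ← map_mul, PowerSeries.coeff_map]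
  rfl

theorem coeff_mk_yEval_pow {A V : Type} [AddCommGroup V] [Module ℂ V] [LieRingModule Sl2t V]
    [LieModule ℂ Sl2t V] [Ring A] [Algebra ℂ A] (f : Module.End ℂ V →ₐ[ℂ] A) (k n : ℕ) :
    PowerSeries.coeff n ((PowerSeries.mk fun s => f (actOp V sl2Y s)) ^ k) =
      f (yEval V (PowerSeries.coeff n
        ((PowerSeries.mk fun s => (MvPolynomial.X s : MvPolynomial ℕ ℂ)) ^ k))) := by
  have h : (PowerSeries.mk fun s => f (actOp V sl2Y s)) =
      PowerSeries.mk fun s => (f.comp (yEval V)) (MvPolynomial.X s) := by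
    ext s
    rw [PowerSeries.coeff_mk, PowerSeries.coeff_mk, AlgHom.comp_apply, yEval_X]
  rw [h, mk_map, ← map_pow, PowerSeries.coeff_map]
  rfl

section

variable (a b : ℕ)

/-- The coefficients of `Λ(T) / V(T)`, with `Λ(T)` acting on the first factor and `V(T)` the series
`exp (-∑ p_r T^r / r)` for the operators `δ ⊗ 1 + 1 ⊗ δ`. -/
def gT : ℕ → MvPolynomial (ℕ ⊕ ℕ ⊕ ℕ) ℂ := expC (pL - pD)

/-- The coefficients of `Λ(T) / V(T)`, with `Λ(T)` acting on the second factor. -/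
def gT' : ℕ → MvPolynomial (ℕ ⊕ ℕ ⊕ ℕ) ℂ := expC (pR - pD)

theorem phiT_gT'_cVec {i j : ℕ} (h : b < j + i) : phiT a b (gT' i) (cVec a b j) = 0 := by
  rw [gT', cVec, (shiftSystem_tensor a b).expC_sub_apply (phiT a b) (phiT_pD a b) (fun i s => by
    have h : Commute (actOp (Weyl b) sl2Y s) (rhoEnd b (i + 1)) := (rhoEnd_actOp b _ _ _).symm
    rw [phiT_pR]
    exact h.map (rAct _ _)) (deltaT_tGen a b)]
  simp only [phiT_lam']
  rw [coeff_map_mk, tGen, rAct_tmul, coeff_y_pow_lam b i j h, TensorProduct.tmul_zero]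

theorem phiT_gT_cVec {i j : ℕ} (h : a < j + i) :
    phiT a b (gT i) (cVec a b j) ∈ yImg (TW a b) (a + b - 2 * j) := by
  rw [gT, cVec, (shiftSystem_tensor a b).expC_sub_apply (phiT a b) (phiT_pD a b) (fun i s => by
    rw [phiT_pL]
    exact (commute_lAct_rAct _ _).symm) (deltaT_tGen a b)]
  simp only [phiT_lam]
  -- Garland's relation on the first factor, after moving the operators `y` there
  have h0 : PowerSeries.coeff i
      ((PowerSeries.mk fun s => lAct (Weyl a) (Weyl b) (actOp _ sl2Y s)) ^ j *
        PowerSeries.mk fun t => lAct (Weyl a) (Weyl b) (lam a t)) (tGen a b) = 0 := by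
    rw [coeff_map_mk, tGen, lAct_tmul, coeff_y_pow_lam a i j h, TensorProduct.zero_tmul]
  rw [PowerSeries.coeff_mul, LinearMap.sum_apply] at h0 ⊢
  have hmem : ∑ q ∈ antidiagonal i,
      ((PowerSeries.coeff q.1 ((PowerSeries.mk fun s =>
          lAct (Weyl a) (Weyl b) (actOp _ sl2Y s)) ^ j) *
        PowerSeries.coeff q.2 (PowerSeries.mk fun t => lAct (Weyl a) (Weyl b) (lam a t))) (tGen a b) -
      (-1 : ℂ) ^ j • (PowerSeries.coeff q.1 ((PowerSeries.mk fun s =>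
          rAct (Weyl a) (Weyl b) (actOp _ sl2Y s)) ^ j) *
        PowerSeries.coeff q.2 (PowerSeries.mk fun t => lAct (Weyl a) (Weyl b) (lam a t))) (tGen a b)) ∈
      yImg (TW a b) (a + b - 2 * j) := by
    refine Submodule.sum_mem _ fun q _ => ?_
    rw [coeff_mk_yEval_pow, coeff_mk_yEval_pow, Module.End.mul_apply, Module.End.mul_apply,
      PowerSeries.coeff_mk]
    refine lAct_sub_rAct_mem_yImg (coeff_mk_X_pow_mem_polyDeg j _) ?_
    rw [← phiT_lam]
    exact phiT_mem_wtSpace a b _ (tGen_mem_wtSpace a b)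
  rw [Finset.sum_sub_distrib, h0, zero_sub, ← Finset.smul_sum, neg_mem_iff] at hmem
  exact (Submodule.smul_mem_iff _ (pow_ne_zero j (neg_ne_zero.2 one_ne_zero))).1 hmem

/-- The image of a weight space under the operators `h ⊗ t^r` with `r > 0`. -/
def hImg (V : Type) [AddCommGroup V] [Module ℂ V] [LieRingModule Sl2t V] [LieModule ℂ Sl2t V]
    (μ : ℤ) : Submodule ℂ V := ⨆ i : ℕ, (wtSpace V μ).map (actOp V sl2H (i + 1))

theorem phiT_mem_hImg (r : MvPolynomial (ℕ ⊕ ℕ ⊕ ℕ) ℂ) {μ : ℤ} {v : TW a b}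
    (hv : v ∈ hImg (TW a b) μ) : phiT a b r v ∈ hImg (TW a b) μ := by
  refine (iSup_le (a := (hImg (TW a b) μ).comap (phiT a b r)) fun i => ?_) hv
  rintro _ ⟨v, hv, rfl⟩
  refine Submodule.mem_iSup_of_mem i ⟨phiT a b r v, phiT_mem_wtSpace a b r hv, ?_⟩
  rw [← phiT_pH, ← Module.End.mul_apply, ← map_mul, mul_comm, map_mul, Module.End.mul_apply]

/-- The generators of the submodules in the filtration of `W(a) ⊗ W(b)`. -/
def tGens (j : ℕ) (p : Box (a - j) (b - j) × MultN j) : TW a b :=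
  phiT a b (boxMono gT p.1) (rAct _ _ (yEval _ (multMono p.2)) (tGen a b))

theorem phiT_cVec_mem {j : ℕ} (ha : j ≤ a) (hb : j ≤ b) (r : MvPolynomial (ℕ ⊕ ℕ ⊕ ℕ) ℂ) :
    phiT a b r (cVec a b j) ∈ Submodule.span ℂ (Set.range (tGens a b j)) ⊔
      (yImg (TW a b) (a + b - 2 * j) ⊔ hImg (TW a b) (a + b - 2 * j)) := by
  set K := yImg (TW a b) (a + b - 2 * j) ⊔ hImg (TW a b) (a + b - 2 * j) with hK
  have hst : ∀ r, ∀ v ∈ K, phiT a b r v ∈ K := by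
    intro r v hv
    obtain ⟨x, hx, y, hy, rfl⟩ := Submodule.mem_sup.1 hv
    rw [map_add]
    exact add_mem (Submodule.mem_sup_left (phiT_mem_yImg a b r hx))
      (Submodule.mem_sup_right (phiT_mem_hImg a b r hy))
  let J : Ideal (MvPolynomial (ℕ ⊕ ℕ ⊕ ℕ) ℂ) :=
    { carrier := {r | phiT a b r (cVec a b j) ∈ K}
      add_mem' := fun {x y} hx hy => by
        change phiT a b (x + y) (cVec a b j) ∈ K
        rw [map_add, LinearMap.add_apply]
        exact add_mem hx hy
      zero_mem' := by
        change phiT a b 0 (cVec a b j) ∈ K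
        rw [map_zero, LinearMap.zero_apply]
        exact zero_mem _
      smul_mem' := fun s x hx => by
        change phiT a b (s * x) (cVec a b j) ∈ K
        rw [map_mul, Module.End.mul_apply]
        exact hst s _ hx }
  have hH : ∀ i, pL i + pR i - 2 * pD i ∈ J := by
    intro i
    change phiT a b _ (cVec a b j) ∈ K
    rw [phiT_pH]
    exact Submodule.mem_sup_right (Submodule.mem_iSup_of_mem i ⟨_, cVec_mem_wtSpace a b j, rfl⟩)
  have hadj : Algebra.adjoin ℂ (Set.range (MvPolynomial.rename (R := ℂ)
      (Sum.inl : ℕ → ℕ ⊕ ℕ ⊕ ℕ)) ∪ Set.range gT ∪ J) = ⊤ := by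
    set S := Algebra.adjoin ℂ (Set.range (MvPolynomial.rename (R := ℂ)
      (Sum.inl : ℕ → ℕ ⊕ ℕ ⊕ ℕ)) ∪ Set.range gT ∪ J)
    have h0 : ∀ i, pD i ∈ S := fun i =>
      Algebra.subset_adjoin (Or.inl (Or.inl ⟨MvPolynomial.X i, MvPolynomial.rename_X _ _⟩))
    have h1 : ∀ i, pL i ∈ S := by
      intro i
      have := mem_of_expC_mem S (p := pL - pD)
        (fun n => Algebra.subset_adjoin (Or.inl (Or.inr ⟨n, rfl⟩))) i
      have := S.add_mem this (h0 i)
      rwa [Pi.sub_apply, sub_add_cancel] at this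
    have h2 : ∀ i, pR i ∈ S := by
      intro i
      have h3 : pL i + pR i - 2 * pD i ∈ S := Algebra.subset_adjoin (Or.inr (hH i))
      have h4 : pR i = (pL i + pR i - 2 * pD i) - pL i + (pD i + pD i) := by ring
      rw [h4]
      exact S.add_mem (S.sub_mem h3 (h1 i)) (S.add_mem (h0 i) (h0 i))
    rw [eq_top_iff, ← MvPolynomial.adjoin_range_X, Algebra.adjoin_le_iff]
    rintro _ ⟨i | i | i, rfl⟩
    · exact h0 i
    · exact h1 i
    · exact h2 i
  obtain ⟨s, hs, hrs⟩ := exists_sub_mem_of_span (MvPolynomial.rename Sum.inl) J hadj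
    (boxMono gT (a := a - j) (b := b - j)) (fun htop => by
      have := span_boxMono (a - j) (b - j) (fun i => Ideal.Quotient.mk J (gT i))
        (fun i => Ideal.Quotient.mk J (gT' i)) ?_ (by rw [gT, expC_zero, map_one])
        (by rw [gT', expC_zero, map_one])
        (fun i hi => Ideal.Quotient.eq_zero_iff_mem.2
          (Submodule.mem_sup_left (phiT_gT_cVec a b (by omega))))
        (fun i hi => Ideal.Quotient.eq_zero_iff_mem.2 (by
          change phiT a b _ _ ∈ K
          rw [phiT_gT'_cVec a b (by omega)]; exact zero_mem _)) htop
      · simpa only [map_boxMono] using this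
      · have hmk : ∀ p : ℕ → MvPolynomial (ℕ ⊕ ℕ ⊕ ℕ) ℂ,
            (PowerSeries.mk fun i => Ideal.Quotient.mk J (expC p i)) =
              PowerSeries.map (Ideal.Quotient.mk J) (expS p) := by
          intro p
          ext n
          rw [PowerSeries.coeff_mk, PowerSeries.coeff_map, coeff_expS]
        have h0 : ∀ i, Ideal.Quotient.mk J ((pL - pD + (pR - pD)) i) = 0 := by
          intro i
          refine Ideal.Quotient.eq_zero_iff_mem.2 ?_
          have := hH i
          rwa [show (pL - pD + (pR - pD)) i = pL i + pR i - 2 * pD i by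
            simp only [Pi.add_apply, Pi.sub_apply]; ring]
        rw [gT, gT', hmk, hmk, ← map_mul, ← expS_add]
        ext n
        rw [PowerSeries.coeff_map, coeff_expS]
        have := map_expC (Ideal.Quotient.mkₐ ℂ J) (pL - pD + (pR - pD)) n
        rw [show (fun i => Ideal.Quotient.mkₐ ℂ J ((pL - pD + (pR - pD)) i)) = 0 from funext h0,
          ← coeff_expS 0, expS_zero] at this
        exact this) r
  have e : phiT a b r (cVec a b j) = phiT a b s (cVec a b j) +
      phiT a b (r - s) (cVec a b j) := by
    rw [map_sub, LinearMap.sub_apply]; abel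
  rw [e]
  refine add_mem (Submodule.mem_sup_left ?_) (Submodule.mem_sup_right hrs)
  refine Submodule.span_induction (p := fun s _ => phiT a b s (cVec a b j) ∈ _) ?_ ?_ ?_ ?_ hs
  · rintro _ ⟨⟨x, m⟩, rfl⟩
    obtain ⟨q, hq, eq⟩ := exists_yEval_eq a b j x
    simp only []
    rw [mul_comm, map_mul, Module.End.mul_apply, eq]
    refine Submodule.span_induction (p := fun q _ => phiT a b (boxMono gT m)
      (rAct _ _ (yEval _ q) (tGen a b)) ∈ Submodule.span ℂ (Set.range (tGens a b j)))
      ?_ ?_ ?_ ?_ hq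
    · rintro _ ⟨f, rfl⟩
      exact Submodule.subset_span ⟨(m, f), rfl⟩
    · simp
    · intro p q _ _ hp hq
      rw [map_add, map_add, LinearMap.add_apply, map_add]; exact add_mem hp hq
    · intro d p _ hp
      rw [map_smul, map_smul, LinearMap.smul_apply, map_smul]; exact Submodule.smul_mem _ _ hp
  · simp
  · intro p q _ _ hp hq
    rw [map_add, LinearMap.add_apply]; exact add_mem hp hq
  · intro d p _ hp
    rw [map_smul, LinearMap.smul_apply]; exact Submodule.smul_mem _ _ hp

theorem wtSpace_le_span_tGens {j : ℕ} (ha : j ≤ a) (hb : j ≤ b) :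
    wtSpace (TW a b) (a + b - 2 * j) ≤ Submodule.span ℂ (Set.range (tGens a b j)) ⊔
      (yImg (TW a b) (a + b - 2 * j) ⊔ hImg (TW a b) (a + b - 2 * j)) := by
  refine (wtSpace_le_aSpace a b j).trans (sup_le ?_ (le_sup_left.trans le_sup_right))
  rintro _ ⟨r, rfl⟩
  exact phiT_cVec_mem a b ha hb r

theorem wtSpace_le_yImg {j : ℕ} (h : a < j ∨ b < j) :
    wtSpace (TW a b) (a + b - 2 * j) ≤ yImg (TW a b) (a + b - 2 * j) := by
  have hc : cVec a b j ∈ yImg (TW a b) (a + b - 2 * j) := by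
    rcases h with h | h
    · have := phiT_gT_cVec a b (i := 0) (j := j) (by omega)
      rwa [gT, expC_zero, map_one] at this
    · have := phiT_gT'_cVec a b (i := 0) (j := j) (by omega)
      rw [gT', expC_zero, map_one, Module.End.one_apply] at this
      rw [this]; exact zero_mem _
  refine (wtSpace_le_aSpace a b j).trans (sup_le ?_ le_rfl)
  rintro _ ⟨r, rfl⟩
  exact phiT_mem_yImg a b r hc

end

/-! ### Nakayama's lemma in graded spaces -/

section

variable {V : Type} [AddCommGroup V] [Module ℂ V] [LieRingModule Sl2t V] [LieModule ℂ Sl2t V]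
  {𝒱 : ℤ → Submodule ℂ V} {ι : Type} {c : Module.Basis ι ℂ V} {d : ι → ℕ} {wt : ι → ℤ}

/-- A graded submodule generating a weight space modulo the image of the operators `h ⊗ t^r`,
`r > 0`, contains the weight space. -/
theorem IsGradedBasis.wtSpace_le (H : IsGradedBasis 𝒱 c d wt)
    (hdeg : ∀ i, HasDeg 𝒱 i (actOp V sl2H i)) {N : LieSubmodule ℂ Sl2t V}
    (hN : IsGradedSub 𝒱 N) {μ : ℤ} (h : wtSpace V μ ≤ N.toSubmodule ⊔ hImg V μ) :
    wtSpace V μ ≤ N.toSubmodule := by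
  let F : ℕ → Submodule ℂ V := fun m => Submodule.span ℂ (c '' {i | m ≤ d i})
  have hF : ∀ m, wtSpace V μ ≤ N.toSubmodule ⊔ F m := by
    intro m
    induction m with
    | zero =>
      have : F 0 = ⊤ := by
        rw [eq_top_iff, ← c.span_eq]
        refine Submodule.span_mono ?_
        rintro _ ⟨i, rfl⟩
        exact ⟨i, Nat.zero_le _, rfl⟩
      rw [this, sup_top_eq]; exact le_top
    | succ m ih =>
      refine h.trans (sup_le le_sup_left (iSup_le fun i => ?_))
      refine (Submodule.map_mono ih).trans ?_
      rw [Submodule.map_sup]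
      refine sup_le (le_sup_of_le_left ?_) (le_sup_of_le_right ?_)
      · rintro _ ⟨v, hv, rfl⟩
        exact N.lie_mem hv
      · rw [Submodule.map_span_le]
        rintro _ ⟨k, hk, rfl⟩
        have h1 := hdeg (i + 1) _ _ (H.basis_mem k)
        rw [H.grade] at h1
        refine Submodule.span_mono (Set.image_mono fun l hl => ?_) h1
        have h2 : (d l : ℤ) = (i + 1 : ℕ) + d k := hl
        have h3 : m ≤ d k := hk
        change m + 1 ≤ d l
        omega
  intro v hv
  let m := (c.repr v).support.sup d + 1
  let τ : V →ₗ[ℂ] V := c.constr ℂ fun i => if d i < m then c i else 0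
  have hτ : ∀ i, τ (c i) = if d i < m then c i else 0 := fun i => c.constr_basis ℂ _ i
  have hτv : τ v = v := by
    conv_lhs => rw [← c.linearCombination_repr v]
    conv_rhs => rw [← c.linearCombination_repr v]
    rw [Finsupp.linearCombination_apply, map_finsuppSum]
    refine Finsupp.sum_congr fun i hi => ?_
    rw [map_smul, hτ, if_pos (Nat.lt_succ_of_le (Finset.le_sup hi))]
  have hτF : ∀ z ∈ F m, τ z = 0 := by
    intro z hz
    refine (Submodule.span_le (p := LinearMap.ker τ)).2 ?_ hz
    rintro _ ⟨i, hi, rfl⟩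
    rw [SetLike.mem_coe, LinearMap.mem_ker, hτ, if_neg (not_lt.2 hi)]
  have hτN : ∀ n ∈ ⨆ r, N.toSubmodule ⊓ 𝒱 r, τ n ∈ N.toSubmodule := by
    intro n hn
    induction hn using Submodule.iSup_induction' with
    | zero => rw [map_zero]; exact zero_mem _
    | add x y _ _ hx hy => rw [map_add]; exact add_mem hx hy
    | mem r x hx =>
      have hx2 := hx.2
      rw [SetLike.mem_coe, H.grade] at hx2
      by_cases hr : r < m
      · have : τ x = x := by
          refine Submodule.span_induction (p := fun x _ => τ x = x) ?_ (map_zero _)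
            (fun _ _ _ _ h h' => by rw [map_add, h, h']) (fun _ _ _ h => by rw [map_smul, h]) hx2
          rintro _ ⟨i, hi, rfl⟩
          have hi' : (d i : ℤ) = r := hi
          rw [hτ, if_pos (by omega)]
        rw [this]; exact hx.1
      · have : τ x = 0 := by
          refine (Submodule.span_le (p := LinearMap.ker τ)).2 ?_ hx2
          rintro _ ⟨i, hi, rfl⟩
          have hi' : (d i : ℤ) = r := hi
          rw [SetLike.mem_coe, LinearMap.mem_ker, hτ, if_neg (by omega)]
        rw [this]; exact zero_mem _
  obtain ⟨n, hn, z, hz, rfl⟩ := Submodule.mem_sup.1 (hF m hv)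
  rw [← hτv, map_add, hτF z hz, add_zero]
  exact hτN n (hN ▸ hn)

end

/-! ### Subquotients generated by vectors satisfying the Weyl relations -/

theorem exists_weylElt (n : ℕ) (β : WIdx n) :
    ∃ u ∈ gradeU (wDeg β), u • weylGen n = weylBasis n β :=
  mem_weylGrading.1 ((isGradedBasis_weyl n).basis_mem β)

/-- A homogeneous element of the enveloping algebra taking `w_n` to a given basis vector. -/
def weylElt {n : ℕ} (β : WIdx n) : U := (exists_weylElt n β).choose

theorem weylElt_mem {n : ℕ} (β : WIdx n) : weylElt β ∈ gradeU (wDeg β) :=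
  (exists_weylElt n β).choose_spec.1

theorem weylElt_smul {n : ℕ} (β : WIdx n) : weylElt β • weylGen n = weylBasis n β :=
  (exists_weylElt n β).choose_spec.2

section

variable {V : Type} [AddCommGroup V] [Module ℂ V] [LieRingModule Sl2t V] [LieModule ℂ Sl2t V]

theorem uAct_mem_grade {𝒱 : ℤ → Submodule ℂ V} (hdeg : ∀ a i, HasDeg 𝒱 i (actOp V a i)) {k : ℤ}
    {u : U} (hu : u ∈ gradeU k) {s : ℤ} {v : V} (hv : v ∈ 𝒱 s) : uAct V u v ∈ 𝒱 (k + s) := by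
  refine Submodule.span_induction (p := fun u _ => uAct V u v ∈ 𝒱 (k + s)) ?_ ?_ ?_ ?_ hu
  · clear hu
    rintro _ ⟨l, rfl, rfl⟩
    induction l with
    | nil => simpa using hv
    | cons p l ih =>
      rw [List.map_cons, List.map_cons, List.prod_cons, map_mul, Module.End.mul_apply, uAct_curU,
        List.sum_cons, Nat.cast_add, add_assoc]
      exact hdeg _ _ _ _ ih
  · simp
  · intro x y _ _ hx hy
    rw [map_add, LinearMap.add_apply]; exact add_mem hx hy
  · intro c x _ hx
    rw [map_smul, LinearMap.smul_apply]; exact Submodule.smul_mem _ _ hx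

/-- The vector `v` has weight `n` and satisfies the relations of `W(n)` for the elements `x ⊗ t^r`
modulo the submodule `N`. The relation for `y ⊗ 1` is weakened to nilpotency modulo `N`; it follows
from the representation theory of `sl₂`. -/
structure IsWeylVecMod (N : LieSubmodule ℂ Sl2t V) (n : ℕ) (v : V) : Prop where
  x_mem : ∀ r, actOp V sl2X r v ∈ N
  h_eq : actOp V sl2H 0 v = (n : ℂ) • v
  y_mem : ∃ k, (actOp V sl2Y 0 ^ k) v ∈ N

variable {N N' : LieSubmodule ℂ Sl2t V}

/-- The class of an element of `N` in the subquotient `N / (N ∩ N')`. -/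
def subClass (N' : LieSubmodule ℂ Sl2t V) (x : N) : SubQuot N N' :=
  LieSubmodule.Quotient.mk' (N'.comap N.incl) x

theorem subClass_eq_zero {x : N} : subClass N' x = 0 ↔ (x : V) ∈ N' := by
  rw [subClass, LieSubmodule.Quotient.mk_eq_zero]
  rfl

theorem uAct_subClass (u : U) (x : N) : uAct (SubQuot N N') u (subClass N' x) =
    subClass N' ⟨uAct V u x, uAct_mem N u _ x.2⟩ := by
  rw [subClass, ← map_uAct, subClass]
  congr 1
  exact Subtype.ext (map_uAct N.incl u x)

theorem actOp_subClass (a : Sl2) (r : ℕ) (x : N) : actOp (SubQuot N N') a r (subClass N' x) =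
    subClass N' ⟨actOp V a r x, N.lie_mem x.2⟩ := by
  rw [subClass, ← map_actOp]
  rfl

theorem isWeylVec_subClass {n : ℕ} {x : N} (h : IsWeylVecMod N' n (x : V)) :
    IsWeylVec n (subClass N' x) := by
  have hx : ∀ r, actOp (SubQuot N N') sl2X r (subClass N' x) = 0 := fun r => by
    rw [actOp_subClass, subClass_eq_zero]; exact h.x_mem r
  have hh : actOp (SubQuot N N') sl2H 0 (subClass N' x) = (n : ℂ) • subClass N' x := by
    rw [actOp_subClass, subClass, subClass, ← map_smul]
    congr 1
    exact Subtype.ext h.h_eq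
  obtain ⟨k, hk⟩ := h.y_mem
  refine ⟨hx, hh, y_pow_eq_zero_of_nilpotent (N := k) (hx 0) hh ?_⟩
  rw [← uAct_curU, ← map_pow, uAct_subClass, subClass_eq_zero]
  change uAct V (curU sl2Y 0 ^ k) x ∈ N'
  rwa [map_pow, uAct_curU]

/-- If `N` is generated over `N'` by vectors satisfying the relations of `W(n)` modulo `N'`, it is
spanned over `N'` by their images under elements of the enveloping algebra producing a basis of
`W(n)` from its generator. -/
theorem span_subClass {G : Type} {n : ℕ} (g : G → N) (hg : ∀ p, IsWeylVecMod N' n (g p : V))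
    (hmin : ∀ K : LieSubmodule ℂ Sl2t V, N' ≤ K → (∀ p, (g p : V) ∈ K) → N ≤ K) :
    Submodule.span ℂ (Set.range fun q : G × WIdx n =>
      uAct (SubQuot N N') (weylElt q.2) (subClass N' (g q.1))) = ⊤ := by
  choose F hF using fun p => exists_weylLift (isWeylVec_subClass (hg p))
  have hFβ : ∀ p β, F p (weylBasis n β) = uAct (SubQuot N N') (weylElt β) (subClass N' (g p)) := by
    intro p β
    rw [← weylElt_smul, ← uAct_weyl, map_uAct, hF]
  have hspan : (⨆ p, (F p).range).toSubmodule ≤ Submodule.span ℂ (Set.range fun q : G × WIdx n =>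
      uAct (SubQuot N N') (weylElt q.2) (subClass N' (g q.1))) := by
    rw [LieSubmodule.iSup_toSubmodule]
    refine iSup_le fun p => ?_
    rintro _ ⟨v, rfl⟩
    have hv : v ∈ Submodule.span ℂ (Set.range (weylBasis n)) := by
      rw [(weylBasis n).span_eq]; trivial
    refine (Submodule.map_span_le (F p : Weyl n →ₗ[ℂ] _) _ _).2 ?_ ⟨v, hv, rfl⟩
    rintro _ ⟨β, rfl⟩
    exact Submodule.subset_span ⟨(p, β), (hFβ p β).symm⟩
  rw [eq_top_iff]
  rintro w -
  obtain ⟨x, rfl⟩ := LieSubmodule.Quotient.surjective_mk' _ w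
  apply hspan
  have := hmin
    (((⨆ p, (F p).range).comap (LieSubmodule.Quotient.mk' (N'.comap N.incl))).map N.incl ⊔ N')
    le_sup_right (fun p => by
      refine (LieSubmodule.mem_sup _ _ _).2 ⟨g p, ?_, 0, zero_mem _, add_zero _⟩
      refine (LieSubmodule.mem_map _).2 ⟨g p, ?_, rfl⟩
      rw [LieSubmodule.mem_comap]
      refine LieSubmodule.mem_iSup_of_mem p ⟨weylGen n, hF p⟩) x.2
  obtain ⟨y, hy, z, hz, e⟩ := (LieSubmodule.mem_sup _ _ _).1 this
  obtain ⟨y, hy', rfl⟩ := (LieSubmodule.mem_map _).1 hy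
  have hzN : z ∈ N := by
    have : z = x - N.incl y := by rw [← e]; abel
    rw [this]; exact sub_mem x.2 y.2
  have hx : x = y + ⟨z, hzN⟩ := Subtype.ext e.symm
  rw [hx, map_add]
  have h0 : LieSubmodule.Quotient.mk' (N'.comap N.incl) ⟨z, hzN⟩ = 0 := subClass_eq_zero.2 hz
  rw [h0, add_zero]
  exact hy'

/-! ### Filtrations generated by homogeneous vectors -/

variable {G : ℕ → Type}

/-- The submodule generated by the members with index `j < m` of a sequence of families. -/
def genSub (g : ∀ j, G j → V) (m : ℕ) : LieSubmodule ℂ Sl2t V :=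
  LieSubmodule.lieSpan ℂ Sl2t {v | ∃ j < m, ∃ p, g j p = v}

theorem mem_genSub (g : ∀ j, G j → V) {j m : ℕ} (h : j < m) (p : G j) : g j p ∈ genSub g m :=
  LieSubmodule.subset_lieSpan ⟨j, h, p, rfl⟩

theorem genSub_le {g : ∀ j, G j → V} {m : ℕ} {K : LieSubmodule ℂ Sl2t V}
    (h : ∀ j < m, ∀ p, g j p ∈ K) : genSub g m ≤ K := by
  refine LieSubmodule.lieSpan_le.2 ?_
  rintro _ ⟨j, hj, p, rfl⟩
  exact h j hj p

theorem genSub_mono (g : ∀ j, G j → V) : Monotone (genSub g) := fun _ _ h =>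
  genSub_le fun _ hj p => mem_genSub g (hj.trans_le h) p

theorem genSub_zero (g : ∀ j, G j → V) : genSub g 0 = ⊥ :=
  le_bot_iff.1 (genSub_le fun j hj => absurd hj (Nat.not_lt_zero j))

theorem genSub_succ_le {g : ∀ j, G j → V} {m : ℕ} {K : LieSubmodule ℂ Sl2t V} (h : genSub g m ≤ K)
    (h' : ∀ p, g m p ∈ K) : genSub g (m + 1) ≤ K := by
  refine genSub_le fun j hj p => ?_
  rcases Nat.lt_succ_iff_lt_or_eq.1 hj with hj | rfl
  · exact h (mem_genSub g hj p)
  · exact h' p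

theorem isGradedSub_genSub {𝒱 : ℤ → Submodule ℂ V} (hdeg : ∀ a i, HasDeg 𝒱 i (actOp V a i))
    {g : ∀ j, G j → V} {gd : ∀ j, G j → ℕ} {m : ℕ} (hg : ∀ j < m, ∀ p, g j p ∈ 𝒱 (gd j p)) :
    IsGradedSub 𝒱 (genSub g m) := by
  have key : ∀ (a : Sl2) (i : ℕ), ∀ v ∈ ⨆ r, (genSub g m).toSubmodule ⊓ 𝒱 r,
      actOp V a i v ∈ ⨆ r, (genSub g m).toSubmodule ⊓ 𝒱 r := by
    intro a i v hv
    refine Submodule.iSup_induction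
      (motive := fun v => actOp V a i v ∈ ⨆ r, (genSub g m).toSubmodule ⊓ 𝒱 r) _ hv ?_ ?_ ?_
    · intro r v hv
      exact Submodule.mem_iSup_of_mem (i + r) ⟨(genSub g m).lie_mem hv.1, hdeg a i r v hv.2⟩
    · rw [map_zero]; exact zero_mem _
    · intro v w hv hw
      rw [map_add]; exact add_mem hv hw
  refine le_antisymm ?_ (iSup_le fun r => inf_le_left)
  have := genSub_le (g := g) (m := m)
    (K := lieSubmoduleOf (⨆ r, (genSub g m).toSubmodule ⊓ 𝒱 r) (key _) (key _) (key _))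
    fun j hj p => Submodule.mem_iSup_of_mem (gd j p : ℤ) ⟨mem_genSub g hj p, hg j hj p⟩
  exact this

/-- The vectors `u g`, for generators `g` and elements `u` of the enveloping algebra producing a
basis of `W(n)` from its generator. -/
def genVec (n : ℕ → ℕ) (g : ∀ j, G j → V) (j : ℕ) (q : G j × WIdx (n j)) : V :=
  uAct V (weylElt q.2) (g j q.1)

theorem genVec_mem (n : ℕ → ℕ) (g : ∀ j, G j → V) {j m : ℕ} (h : j < m) (q : G j × WIdx (n j)) :
    genVec n g j q ∈ genSub g m := uAct_mem _ _ _ (mem_genSub g h _)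

theorem span_subClass_genVec {n : ℕ → ℕ} {g : ∀ j, G j → V} {j : ℕ}
    (hw : ∀ p, IsWeylVecMod (genSub g j) (n j) (g j p)) :
    Submodule.span ℂ (Set.range fun q : G j × WIdx (n j) =>
      subClass (N := genSub g (j + 1)) (genSub g j)
        ⟨genVec n g j q, genVec_mem n g j.lt_succ_self q⟩) = ⊤ := by
  have := span_subClass (N := genSub g (j + 1)) (N' := genSub g j)
    (fun p => ⟨g j p, mem_genSub g j.lt_succ_self p⟩) hw fun K h h' => genSub_succ_le h h'
  simp only [uAct_subClass] at this
  exact this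

theorem genSub_le_span {n : ℕ → ℕ} {g : ∀ j, G j → V} {m : ℕ}
    (hw : ∀ j < m, ∀ p, IsWeylVecMod (genSub g j) (n j) (g j p)) :
    (genSub g m).toSubmodule ≤ Submodule.span ℂ {v | ∃ j < m, ∃ q, genVec n g j q = v} := by
  induction m with
  | zero => rw [genSub_zero]; exact bot_le
  | succ m ih =>
    intro x hx
    have h1 : subClass (N := genSub g (m + 1)) (genSub g m) ⟨x, hx⟩ ∈ (⊤ : Submodule ℂ _) := trivial
    rw [← span_subClass_genVec (hw m m.lt_succ_self)] at h1
    have h2 : ∀ z ∈ Submodule.span ℂ (Set.range fun q : G m × WIdx (n m) =>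
        subClass (N := genSub g (m + 1)) (genSub g m)
          ⟨genVec n g m q, genVec_mem n g m.lt_succ_self q⟩), ∃ y : genSub g (m + 1),
        subClass (genSub g m) y = z ∧
          (y : V) ∈ Submodule.span ℂ {v | ∃ j < m + 1, ∃ q, genVec n g j q = v} := by
      intro z hz
      refine Submodule.span_induction ?_ ⟨0, map_zero _, zero_mem _⟩ ?_ ?_ hz
      · rintro _ ⟨q, rfl⟩
        exact ⟨_, rfl, Submodule.subset_span ⟨m, m.lt_succ_self, q, rfl⟩⟩
      · rintro _ _ _ _ ⟨y, rfl, hy⟩ ⟨y', rfl, hy'⟩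
        exact ⟨y + y', map_add _ _ _, add_mem hy hy'⟩
      · rintro c _ _ ⟨y, rfl, hy⟩
        exact ⟨c • y, map_smul _ _ _, Submodule.smul_mem _ c hy⟩
    obtain ⟨y, e, hy⟩ := h2 _ h1
    have h3 : ((⟨x, hx⟩ - y : genSub g (m + 1)) : V) ∈ genSub g m := by
      rw [← subClass_eq_zero]
      refine (map_sub (LieSubmodule.Quotient.mk' _) _ _).trans ?_
      exact sub_eq_zero.2 e.symm
    have h4 : x = (x - y) + y := by abel
    rw [h4]
    refine add_mem (Submodule.span_mono ?_ (ih (fun j hj => hw j (hj.trans m.lt_succ_self)) h3)) hy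
    rintro _ ⟨j, hj, q, rfl⟩
    exact ⟨j, hj.trans m.lt_succ_self, q, rfl⟩

end

/-! ### Direct sums of shifted global Weyl modules -/

theorem mem_directSumGrading {ι : Type} {p : ι → ℤ} {n : ℕ} {r : ℤ} {v : ⨁ _ : ι, Weyl n} :
    v ∈ directSumGrading (fun i : ι => shift (p i) (weylGrading n)) r ↔
      ∀ i β, (weylBasis n).repr (v i) β ≠ 0 → (wDeg β : ℤ) = r - p i := by
  rw [directSumGrading, Submodule.mem_iInf]
  exact forall_congr' fun i => (isGradedBasis_weyl n).mem_grade

/-- The basis of a direct sum of copies of `W(n)` formed by the basis vectors of the summands. -/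
def directSumBasis (ι : Type) (n : ℕ) : Module.Basis (ι × WIdx n) ℂ (⨁ _ : ι, Weyl n) :=
  .ofRepr ((DFinsupp.basis fun _ : ι => weylBasis n).repr.trans
    (Finsupp.domLCongr (Equiv.sigmaEquivProd ι (WIdx n))))

theorem directSumBasis_repr {ι : Type} {n : ℕ} (v : ⨁ _ : ι, Weyl n) (q : ι × WIdx n) :
    (directSumBasis ι n).repr v q = (weylBasis n).repr (v q.1) q.2 := rfl

theorem directSumBasis_apply {ι : Type} [DecidableEq ι] {n : ℕ} (q : ι × WIdx n) :
    directSumBasis ι n q = DirectSum.lof ℂ ι (fun _ => Weyl n) q.1 (weylBasis n q.2) := by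
  obtain ⟨i, β⟩ := q
  refine (directSumBasis ι n).repr.injective (Finsupp.ext fun ⟨j, γ⟩ => ?_)
  rw [Module.Basis.repr_self, directSumBasis_repr]
  by_cases hj : j = i
  · subst hj
    rw [DirectSum.lof_apply, Module.Basis.repr_self]
    by_cases hγ : β = γ
    · rw [hγ, Finsupp.single_eq_same, Finsupp.single_eq_same]
    · rw [Finsupp.single_eq_of_ne (Ne.symm hγ), Finsupp.single_eq_of_ne]
      exact fun e => hγ (Prod.ext_iff.1 e).2.symm
  · have h0 : (DirectSum.lof ℂ ι (fun _ => Weyl n) i (weylBasis n β)) j = 0 :=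
      DFinsupp.single_eq_of_ne hj
    rw [h0, map_zero, Finsupp.zero_apply, Finsupp.single_eq_of_ne]
    exact fun e => hj (Prod.ext_iff.1 e).1

/-- A module with a basis consisting of the images of the basis vectors of `W(n)` under a family of
homomorphisms from `W(n)` is a direct sum of copies of `W(n)`; if the homomorphisms are homogeneous,
so is the isomorphism. -/
theorem gradedIso_directSum {Q : Type} [AddCommGroup Q] [Module ℂ Q] [LieRingModule Sl2t Q]
    [LieModule ℂ Sl2t Q] {ι : Type} {n : ℕ} (F : ι → Weyl n →ₗ⁅ℂ,Sl2t⁆ Q)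
    (B : Module.Basis (ι × WIdx n) ℂ Q) (hB : ∀ q, B q = F q.1 (weylBasis n q.2))
    {𝒬 : ℤ → Submodule ℂ Q} {p : ι → ℤ}
    (h𝒬 : ∀ r, 𝒬 r = Submodule.span ℂ (B '' {q | p q.1 + wDeg q.2 = r})) :
    GradedIso 𝒬 (directSumGrading fun i : ι => shift (p i) (weylGrading n)) := by
  classical
  let D := directSumBasis ι n
  let E : (⨁ _ : ι, Weyl n) ≃ₗ[ℂ] Q := D.equiv B (Equiv.refl _)
  have hE : ∀ i v, E (DirectSum.lof ℂ ι (fun _ => Weyl n) i v) = F i v := by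
    intro i
    have : E.toLinearMap.comp (DirectSum.lof ℂ ι (fun _ => Weyl n) i) = (F i : Weyl n →ₗ[ℂ] Q) := by
      refine (weylBasis n).ext fun β => ?_
      rw [LinearMap.comp_apply, ← directSumBasis_apply (i, β)]
      exact (D.equiv_apply _ _ _).trans (hB _)
    exact fun v => LinearMap.congr_fun this v
  have hlie : ∀ (z : Sl2t) (v : ⨁ _ : ι, Weyl n), E ⁅z, v⁆ = ⁅z, E v⁆ := by
    intro z v
    induction v using DirectSum.induction_on with
    | zero => rw [lie_zero, map_zero, lie_zero]
    | of i x =>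
      have h1 : ⁅z, DirectSum.of (fun _ : ι => Weyl n) i x⁆ =
          DirectSum.lof ℂ ι (fun _ => Weyl n) i ⁅z, x⁆ :=
        ((DirectSum.lieModuleOf ℂ ι Sl2t (fun _ => Weyl n) i).map_lie z x).symm
      rw [h1, hE, LieModuleHom.map_lie, ← hE]
      rfl
    | add x y hx hy => rw [lie_add, map_add, map_add, lie_add, hx, hy]
  let e : Q ≃ₗ⁅ℂ,Sl2t⁆ ⨁ _ : ι, Weyl n :=
    { E.symm with
      map_lie' := fun {z v} => E.injective (by
        change E (E.symm ⁅z, v⁆) = E ⁅z, E.symm v⁆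
        rw [hlie, E.apply_symm_apply, E.apply_symm_apply]) }
  refine ⟨e, fun r v => ?_⟩
  have hrepr : ∀ i β, (weylBasis n).repr (e v i) β = B.repr v (i, β) := by
    intro i β
    have h1 : v = E (e v) := (E.apply_symm_apply v).symm
    have h2 : ∀ w, B.repr (E w) = Finsupp.domLCongr (R := ℂ) (M := ℂ) (Equiv.refl _) (D.repr w) :=
      fun w => B.repr.apply_symm_apply _
    conv_rhs => rw [h1, h2]
    rfl
  rw [mem_directSumGrading, h𝒬, Module.Basis.mem_span_image]
  constructor
  · intro h i β hne
    rw [hrepr] at hne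
    have : p i + wDeg β = r := h (Finsupp.mem_support_iff.2 hne)
    omega
  · intro h q hq
    have := h q.1 q.2 (by rw [hrepr]; exact Finsupp.mem_support_iff.1 hq)
    change p q.1 + wDeg q.2 = r
    omega

theorem gradedIso_directSum_of_equiv {ι κ : Type} (e : κ ≃ ι) {n : ℕ} {Q : Type}
    [AddCommGroup Q] [Module ℂ Q] [LieRingModule Sl2t Q] [LieModule ℂ Sl2t Q]
    (F : ι → Weyl n →ₗ⁅ℂ,Sl2t⁆ Q)
    (B : Module.Basis (ι × WIdx n) ℂ Q) (hB : ∀ q, B q = F q.1 (weylBasis n q.2))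
    {𝒬 : ℤ → Submodule ℂ Q} {p : ι → ℤ} {p' : κ → ℤ} (hp : ∀ i, p (e i) = p' i)
    (h𝒬 : ∀ r, 𝒬 r = Submodule.span ℂ (B '' {q | p q.1 + wDeg q.2 = r})) :
    GradedIso 𝒬 (directSumGrading fun i : κ => shift (p' i) (weylGrading n)) := by
  refine gradedIso_directSum (fun i => F (e i)) (B.reindex (e.prodCongr (Equiv.refl _)).symm)
    (fun q => ?_) fun r => ?_
  · rw [Module.Basis.reindex_apply, hB]; rfl
  · rw [h𝒬]
    congr 1
    ext v
    constructor
    · rintro ⟨q, hq, rfl⟩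
      refine ⟨(e.symm q.1, q.2), ?_, ?_⟩
      · change p' (e.symm q.1) + _ = _
        rw [← hp, e.apply_symm_apply]; exact hq
      · rw [Module.Basis.reindex_apply]; simp
    · rintro ⟨q, hq, rfl⟩
      refine ⟨(e q.1, q.2), ?_, ?_⟩
      · change p (e q.1) + _ = _
        rw [hp]; exact hq
      · rw [Module.Basis.reindex_apply]; rfl

/-! ### Filtrations by global Weyl modules from generators -/

section

variable {V : Type} [AddCommGroup V] [Module ℂ V] [LieRingModule Sl2t V] [LieModule ℂ Sl2t V]
  {G : ℕ → Type}

/-- Homogeneous generators of `V`, in families indexed by `j = 0, …, k`, such that those of index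
`j` satisfy the relations of `W(n j)` modulo the submodule generated by those of smaller index. -/
structure IsWeylGenerating (𝒱 : ℤ → Submodule ℂ V) (k : ℕ) (n : ℕ → ℕ) (g : ∀ j, G j → V)
    (gd : ∀ j, G j → ℕ) : Prop where
  hasDeg : ∀ a i, HasDeg 𝒱 i (actOp V a i)
  mem : ∀ j ≤ k, ∀ p, g j p ∈ 𝒱 (gd j p)
  weyl : ∀ j ≤ k, ∀ p, IsWeylVecMod (genSub g j) (n j) (g j p)
  top : genSub g (k + 1) = ⊤
  finFib : ∀ j, FinFib (gd j)

/-- The basis vectors obtained from generators of index at most `k`. -/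
abbrev GenIdx (G : ℕ → Type) (n : ℕ → ℕ) (k : ℕ) : Type :=
  Σ j : Fin (k + 1), G j × WIdx (n j)

namespace IsWeylGenerating

variable {𝒱 : ℤ → Submodule ℂ V} {k : ℕ} {n : ℕ → ℕ} {g : ∀ j, G j → V} {gd : ∀ j, G j → ℕ}

theorem genVec_mem_grade (h : IsWeylGenerating 𝒱 k n g gd) {j : ℕ} (hj : j ≤ k)
    (q : G j × WIdx (n j)) : genVec n g j q ∈ 𝒱 (gd j q.1 + wDeg q.2 : ℕ) := by
  rw [Nat.cast_add, add_comm]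
  exact uAct_mem_grade h.hasDeg (weylElt_mem q.2) (h.mem j hj q.1)

variable {ι : Type} {c : Module.Basis ι ℂ V} {d : ι → ℕ} {wt : ι → ℤ}

/-- If the graded dimension is as large as the generators permit, they give rise to a basis. -/
theorem exists_basis (h : IsWeylGenerating 𝒱 k n g gd) (H : IsGradedBasis 𝒱 c d wt)
    (hgen : genFun d = ∑ j : Fin (k + 1), genFun (gd j) * genFun (wDeg (n := n j))) :
    ∃ T : Module.Basis (GenIdx G n k) ℂ V, (∀ i, T i = genVec n g i.1 i.2) ∧
      ∀ r, 𝒱 r = Submodule.span ℂ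
        (T '' {i | ((gd i.1 i.2.1 + wDeg i.2.2 : ℕ) : ℤ) = r}) := by
  have hfin : ∀ j : Fin (k + 1), FinFib fun q : G j × WIdx (n j) => gd j q.1 + wDeg q.2 :=
    fun j => (h.finFib j).prod (finFib_wDeg _)
  have hspan : Submodule.span ℂ (Set.range fun i : GenIdx G n k => genVec n g i.1 i.2) = ⊤ := by
    rw [eq_top_iff, ← LieSubmodule.top_toSubmodule (L := Sl2t), ← h.top]
    refine (genSub_le_span fun j hj => h.weyl j (Nat.lt_succ_iff.1 hj)).trans
      (Submodule.span_mono ?_)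
    rintro _ ⟨j, hj, q, rfl⟩
    exact ⟨⟨⟨j, hj⟩, q⟩, rfl⟩
  have hli : LinearIndependent ℂ fun i : GenIdx G n k => genVec n g i.1 i.2 := by
    refine linearIndependent_of_genFun_eq c.linearIndependent H.finFib (FinFib.sigma hfin) ?_
      (fun i => ?_) fun i => ?_
    · rw [genFun_sigma hfin, hgen]
      exact Finset.sum_congr rfl fun j _ => genFun_prod (h.finFib j) (finFib_wDeg _)
    · have := h.genVec_mem_grade (Nat.lt_succ_iff.1 i.1.2) i.2
      rw [H.grade] at this
      simpa only [Nat.cast_inj] using this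
    · rw [hspan]; trivial
  let T := Module.Basis.mk hli hspan.ge
  have hT : ∀ i, T i = genVec n g i.1 i.2 := fun i => Module.Basis.mk_apply _ _ _
  refine ⟨T, hT, fun r => ?_⟩
  rw [H.grade, ← eq_span_of_le (𝒱 := fun r => Submodule.span ℂ
    (T '' {i | ((gd i.1 i.2.1 + wDeg i.2.2 : ℕ) : ℤ) = r})) c (fun i => (d i : ℤ))]
  · intro r
    rw [← H.grade, Submodule.span_le]
    rintro _ ⟨i, rfl, rfl⟩
    rw [hT]
    exact h.genVec_mem_grade (Nat.lt_succ_iff.1 i.1.2) i.2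
  · rw [eq_top_iff, ← T.span_eq, Submodule.span_le]
    rintro _ ⟨i, rfl⟩
    exact Submodule.mem_iSup_of_mem _ (Submodule.subset_span ⟨i, rfl, rfl⟩)

/-- The submodules of the filtration are spanned by basis vectors. -/
theorem genSub_eq_span (h : IsWeylGenerating 𝒱 k n g gd) {T : Module.Basis (GenIdx G n k) ℂ V}
    (hT : ∀ i, T i = genVec n g i.1 i.2) {m : ℕ} (hm : m ≤ k + 1) :
    (genSub g m).toSubmodule = Submodule.span ℂ (T '' {i | (i.1 : ℕ) < m}) := by
  apply le_antisymm
  · refine (genSub_le_span (n := n) fun j hj => h.weyl j (by omega)).trans (Submodule.span_mono ?_)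
    rintro _ ⟨j, hj, q, rfl⟩
    exact ⟨⟨⟨j, by omega⟩, q⟩, hj, hT _⟩
  · rw [Submodule.span_le]
    rintro _ ⟨i, hi, rfl⟩
    rw [hT]
    exact genVec_mem n g hi i.2

theorem exists_subQuot_basis (h : IsWeylGenerating 𝒱 k n g gd)
    {T : Module.Basis (GenIdx G n k) ℂ V} (hT : ∀ i, T i = genVec n g i.1 i.2) {j : ℕ}
    (hj : j ≤ k) :
    ∃ B : Module.Basis (G j × WIdx (n j)) ℂ (SubQuot (genSub g (j + 1)) (genSub g j)),
      ∀ q, B q = subClass (genSub g j) ⟨genVec n g j q, genVec_mem n g j.lt_succ_self q⟩ := by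
  let v : G j × WIdx (n j) → genSub g (j + 1) := fun q =>
    ⟨genVec n g j q, genVec_mem n g j.lt_succ_self q⟩
  let j' : Fin (k + 1) := ⟨j, Nat.lt_succ_of_le hj⟩
  have hv : ∀ q, (v q : V) = T ⟨j', q⟩ := fun q => by rw [hT]
  have hli : LinearIndependent ℂ v := by
    refine LinearIndependent.of_comp (genSub g (j + 1)).toSubmodule.subtype ?_
    have := T.linearIndependent.comp (fun q => ⟨j', q⟩ : G j × WIdx (n j) → GenIdx G n k)
      (fun q q' e => eq_of_heq (Sigma.mk.inj e).2)
    have e : (genSub g (j + 1)).toSubmodule.subtype ∘ v = T ∘ fun q => ⟨j', q⟩ := funext hv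
    rwa [e]
  have hdis : Disjoint (Submodule.span ℂ (Set.range v))
      (LinearMap.ker (LieSubmodule.Quotient.mk' ((genSub g j).comap (genSub g (j + 1)).incl) :
        genSub g (j + 1) →ₗ[ℂ] SubQuot (genSub g (j + 1)) (genSub g j))) := by
    rw [Submodule.disjoint_def]
    intro x hx hx'
    have h1 : (x : V) ∈ (genSub g j).toSubmodule := subClass_eq_zero.1 hx'
    rw [h.genSub_eq_span hT (by omega)] at h1
    have h2 : (x : V) ∈ Submodule.span ℂ (T '' {i | i.1 = j'}) := by
      refine (Submodule.span_le (p := (Submodule.span ℂ (T '' {i | i.1 = j'})).comap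
        (genSub g (j + 1)).toSubmodule.subtype)).2 ?_ hx
      rintro _ ⟨q, rfl⟩
      exact Submodule.subset_span ⟨⟨j', q⟩, rfl, (hv q).symm⟩
    have hd : Disjoint {i : GenIdx G n k | (i.1 : ℕ) < j} {i | i.1 = j'} :=
      Set.disjoint_left.2 fun i h1 h2 => by
        have h1' : (i.1 : ℕ) < j := h1
        rw [show i.1 = j' from h2] at h1'
        exact lt_irrefl _ h1'
    exact Subtype.ext
      (Submodule.disjoint_def.1 (T.linearIndependent.disjoint_span_image hd) _ h1 h2)
  have hB := hli.map hdis
  exact ⟨Module.Basis.mk hB (span_subClass_genVec (h.weyl j hj)).ge,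
    fun q => Module.Basis.mk_apply _ _ _⟩

theorem subQuotGrading_eq_span (h : IsWeylGenerating 𝒱 k n g gd)
    {T : Module.Basis (GenIdx G n k) ℂ V} (hT : ∀ i, T i = genVec n g i.1 i.2)
    (hgr : ∀ r, 𝒱 r = Submodule.span ℂ (T '' {i | ((gd i.1 i.2.1 + wDeg i.2.2 : ℕ) : ℤ) = r}))
    {j : ℕ} (hj : j ≤ k)
    {B : Module.Basis (G j × WIdx (n j)) ℂ (SubQuot (genSub g (j + 1)) (genSub g j))}
    (hB : ∀ q, B q = subClass (genSub g j) ⟨genVec n g j q, genVec_mem n g j.lt_succ_self q⟩)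
    (r : ℤ) : subQuotGrading 𝒱 (genSub g (j + 1)) (genSub g j) r =
      Submodule.span ℂ (B '' {q | (gd j q.1 : ℤ) + wDeg q.2 = r}) := by
  apply le_antisymm
  · rintro _ ⟨x, hx, rfl⟩
    have h1 : (x : V) ∈ 𝒱 r := hx
    have h2 : (x : V) ∈ (genSub g (j + 1)).toSubmodule := x.2
    rw [hgr, Module.Basis.mem_span_image] at h1
    rw [h.genSub_eq_span hT (by omega), Module.Basis.mem_span_image] at h2
    have h3 := (Module.Basis.mem_span_image T).2 (Set.subset_inter h1 h2)
    have h4 : Submodule.span ℂ (T '' ({i | ((gd i.1 i.2.1 + wDeg i.2.2 : ℕ) : ℤ) = r} ∩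
        {i | (i.1 : ℕ) < j + 1})) ≤
        ((Submodule.span ℂ (B '' {q | (gd j q.1 : ℤ) + wDeg q.2 = r})).comap
          (LieSubmodule.Quotient.mk' ((genSub g j).comap (genSub g (j + 1)).incl) :
            genSub g (j + 1) →ₗ[ℂ] _)).map (genSub g (j + 1)).toSubmodule.subtype := by
      rw [Submodule.span_le]
      rintro _ ⟨⟨⟨i, hi⟩, q⟩, ⟨hr, hij⟩, rfl⟩
      have hij' : i < j + 1 := hij
      rw [hT]
      refine ⟨⟨genVec n g i q, genVec_mem n g hij' q⟩, ?_, rfl⟩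
      change subClass (N := genSub g (j + 1)) (genSub g j) _ ∈ Submodule.span ℂ _
      rcases Nat.lt_succ_iff_lt_or_eq.1 hij' with hlt | rfl
      · rw [subClass_eq_zero.2 (genVec_mem n g hlt q)]
        exact zero_mem _
      · rw [← hB]
        refine Submodule.subset_span ⟨q, ?_, rfl⟩
        have : ((gd i q.1 + wDeg q.2 : ℕ) : ℤ) = r := hr
        rwa [Nat.cast_add] at this
    obtain ⟨y, hy, e⟩ := h4 h3
    rw [← Subtype.ext (a1 := y) (a2 := x) e]
    exact hy
  · rw [Submodule.span_le]
    rintro _ ⟨q, hq, rfl⟩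
    rw [hB]
    refine ⟨_, ?_, rfl⟩
    have h1 := h.genVec_mem_grade hj q
    rw [Nat.cast_add, show (gd j q.1 : ℤ) + wDeg q.2 = r from hq] at h1
    exact h1

theorem gradedIso (h : IsWeylGenerating 𝒱 k n g gd)
    {T : Module.Basis (GenIdx G n k) ℂ V} (hT : ∀ i, T i = genVec n g i.1 i.2)
    (hgr : ∀ r, 𝒱 r = Submodule.span ℂ (T '' {i | ((gd i.1 i.2.1 + wDeg i.2.2 : ℕ) : ℤ) = r}))
    {j : ℕ} (hj : j ≤ k) {N N' : LieSubmodule ℂ Sl2t V} (hN : N = genSub g (j + 1))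
    (hN' : N' = genSub g j) :
    GradedIso (subQuotGrading 𝒱 N N') (directSumGrading
      fun i : (Σ p : ℤ, Fin (Nat.card {x : G j // (gd j x : ℤ) = p})) =>
        shift i.1 (weylGrading (n j))) := by
  subst hN hN'
  obtain ⟨B, hB⟩ := h.exists_subQuot_basis hT hj
  choose F hF using fun p => exists_weylLift (isWeylVec_subClass (N := genSub g (j + 1))
    (x := ⟨g j p, mem_genSub g j.lt_succ_self p⟩) (h.weyl j hj p))
  have hfin : ∀ p : ℤ, Finite {x : G j // (gd j x : ℤ) = p} := by
    intro p
    by_cases hp : 0 ≤ p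
    · obtain ⟨m, rfl⟩ := Int.eq_ofNat_of_zero_le hp
      have := h.finFib j m
      exact Finite.of_equiv {x // gd j x = m} (Equiv.subtypeEquivRight fun x => Nat.cast_inj.symm)
    · have : IsEmpty {x : G j // (gd j x : ℤ) = p} := ⟨fun x => by have := x.2; omega⟩
      infer_instance
  let e : (Σ p : ℤ, Fin (Nat.card {x : G j // (gd j x : ℤ) = p})) ≃ G j :=
    (Equiv.sigmaCongrRight fun p => (Finite.equivFin _).symm).trans
      (Equiv.sigmaFiberEquiv fun x => (gd j x : ℤ))
  have he : ∀ i, (gd j (e i) : ℤ) = i.1 := fun i =>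
    ((Finite.equivFin {x : G j // (gd j x : ℤ) = i.1}).symm i.2).2
  have hq := h.subQuotGrading_eq_span hT hgr hj hB
  refine gradedIso_directSum_of_equiv (p := fun x => (gd j x : ℤ)) e F B (fun q => ?_) he hq
  rw [hB, ← weylElt_smul, ← uAct_weyl, map_uAct, hF, uAct_subClass]
  rfl

/-- The submodules generated by the generators of index less than `j` form a filtration by global
Weyl modules if the graded dimension is as large as the generators permit. -/
theorem exists_weylFiltration (h : IsWeylGenerating 𝒱 k n g gd) (H : IsGradedBasis 𝒱 c d wt)
    (hgen : genFun d = ∑ j : Fin (k + 1), genFun (gd j) * genFun (wDeg (n := n j))) :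
    Nonempty (WeylFiltration 𝒱) := by
  obtain ⟨T, hT, hgr⟩ := h.exists_basis H hgen
  let F : WeylFiltration 𝒱 :=
    { k := k
      N := fun s => genSub g (k + 1 - s)
      wt := fun s => n (k - s)
      m := fun s p => Nat.card {x : G (k - s) // (gd (k - s) x : ℤ) = p}
      graded := fun s => isGradedSub_genSub h.hasDeg fun j hj => h.mem j (by omega)
      antitone := fun s t hst => genSub_mono g (Nat.sub_le_sub_left hst _)
      first := h.top
      last := by rw [Fin.val_last, Nat.sub_self, genSub_zero]
      iso := fun s => h.gradedIso hT hgr (Nat.sub_le k s)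
        (by have := s.2; rw [Fin.val_castSucc]; congr 1; omega)
        (by have := s.2; rw [Fin.val_succ]; congr 1; omega) }
  exact ⟨F⟩

end IsWeylGenerating

end

/-! ### The filtration of `W(a) ⊗ W(b)` -/

theorem neg_le_wWt {n : ℕ} (i : WIdx n) : -(n : ℤ) ≤ wWt i := by
  have := i.1.2
  rw [wWt]; omega

theorem wWt_le {n : ℕ} (i : WIdx n) : wWt i ≤ n := by
  rw [wWt]; omega

section

variable (a b : ℕ)

theorem hasDeg_tensor (z : Sl2) (r : ℕ) :
    HasDeg (tensorGrading (weylGrading a) (weylGrading b)) r (actOp (TW a b) z r) := by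
  rw [actOp_tensor]
  exact (hasDeg_weyl a z r).lAct.add (hasDeg_weyl b z r).rAct

theorem wtSpace_tensor_eq_bot {μ : ℤ} (h : μ < -(a + b) ∨ (a + b : ℤ) < μ) :
    wtSpace (TW a b) μ = ⊥ := by
  rw [eq_bot_iff]
  intro v hv
  rw [(isGradedBasis_tensor a b).mem_wt] at hv
  refine (Submodule.mem_bot ℂ).2
    (((weylBasis a).tensorProduct (weylBasis b)).repr.map_eq_zero_iff.1 (Finsupp.ext fun i => ?_))
  by_contra hne
  have h1 := hv i hne
  have h2 := neg_le_wWt i.1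
  have h3 := neg_le_wWt i.2
  have h4 := wWt_le i.1
  have h5 := wWt_le i.2
  omega

theorem tGen_mem_grade : tGen a b ∈ tensorGrading (weylGrading a) (weylGrading b) 0 :=
  Submodule.mem_iSup_of_mem 0 (Submodule.apply_mem_map₂ _ (weylGen_mem a)
    (by rw [sub_zero]; exact weylGen_mem b))

/-- The degree of the generators `tGens`. -/
def tGensDeg (j : ℕ) (p : Box (a - j) (b - j) × MultN j) : ℕ := boxDeg p.1 + multDeg p.2

theorem tGens_mem_grade (j : ℕ) (p : Box (a - j) (b - j) × MultN j) :
    tGens a b j p ∈ tensorGrading (weylGrading a) (weylGrading b) (tGensDeg a b j p) := by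
  have hD : ∀ i, HasDeg (tensorGrading (weylGrading a) (weylGrading b)) (i + 1)
      (phiT a b ((pL - pD) i)) := by
    intro i
    rw [Pi.sub_apply, map_sub, phiT_pL, phiT_pD, deltaT]
    exact (hasDeg_rho a (i + 1)).lAct.sub ((hasDeg_delta a i).lAct.add (hasDeg_delta b i).rAct)
  have h1 := hasDeg_boxMono (phiT a b) (g := gT) (fun i => hasDeg_expC (phiT a b) hD i) p.1
  have h2 := (shiftSystem_tensor a b).hasDeg_eval
    (𝒱 := tensorGrading (weylGrading a) (weylGrading b)) (fun s => (hasDeg_weyl b sl2Y s).rAct) p.2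
  rw [shiftSystem_tensor_eval] at h2
  have h3 := h1 _ _ (h2 _ _ (tGen_mem_grade a b))
  rw [add_zero] at h3
  rw [tGensDeg, Nat.cast_add]
  exact h3

theorem tGens_mem_wtSpace (j : ℕ) (p : Box (a - j) (b - j) × MultN j) :
    tGens a b j p ∈ wtSpace (TW a b) (a + b - 2 * j) := by
  refine phiT_mem_wtSpace a b _ ?_
  obtain ⟨r, hr⟩ := exists_phiT_cVec a b (q := multMono p.2) (j := j)
    (Submodule.subset_span ⟨_, rfl⟩)
  rw [← hr]
  exact phiT_mem_wtSpace a b r (cVec_mem_wtSpace a b j)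

theorem isGradedSub_genSub_tGens (m : ℕ) :
    IsGradedSub (tensorGrading (weylGrading a) (weylGrading b)) (genSub (tGens a b) m) :=
  isGradedSub_genSub (hasDeg_tensor a b) fun j _ => tGens_mem_grade a b j

theorem yImg_le_of_wtSpace_le {V : Type} [AddCommGroup V] [Module ℂ V] [LieRingModule Sl2t V]
    [LieModule ℂ Sl2t V] {μ : ℤ} {N : LieSubmodule ℂ Sl2t V}
    (h : wtSpace V (μ + 2) ≤ N.toSubmodule) : yImg V μ ≤ N.toSubmodule := by
  refine iSup_le fun r => ?_
  rintro _ ⟨v, hv, rfl⟩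
  exact N.lie_mem (h hv)

/-- The generators of index at most `j` generate the weight space of weight `a + b - 2 * j`: the
image of the operators `y ⊗ t^r` comes from the previous weight space, and that of the `h ⊗ t^r` is
disposed of by Nakayama's lemma. -/
theorem wtSpace_le_genSub_of_le {j : ℕ} (hj : j ≤ min a b) :
    wtSpace (TW a b) (a + b - 2 * j) ≤ (genSub (tGens a b) (j + 1)).toSubmodule := by
  induction j with
  | zero =>
    refine (isGradedBasis_tensor a b).wtSpace_le (hasDeg_tensor a b sl2H)
      (isGradedSub_genSub_tGens a b 1) ?_
    refine (wtSpace_le_span_tGens a b (Nat.zero_le a) (Nat.zero_le b)).trans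
      (sup_le ?_ (sup_le ?_ le_sup_right))
    · refine le_sup_of_le_left (Submodule.span_le.2 ?_)
      rintro _ ⟨p, rfl⟩
      exact mem_genSub (tGens a b) Nat.zero_lt_one p
    · refine le_sup_of_le_left (yImg_le_of_wtSpace_le ?_)
      rw [wtSpace_tensor_eq_bot a b (Or.inr (by push_cast; omega))]
      exact bot_le
  | succ j ih =>
    refine (isGradedBasis_tensor a b).wtSpace_le (hasDeg_tensor a b sl2H)
      (isGradedSub_genSub_tGens a b _) ?_
    refine (wtSpace_le_span_tGens a b (by omega) (by omega)).trans
      (sup_le ?_ (sup_le ?_ le_sup_right))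
    · refine le_sup_of_le_left (Submodule.span_le.2 ?_)
      rintro _ ⟨p, rfl⟩
      exact mem_genSub (tGens a b) (Nat.lt_succ_self (j + 1)) p
    · refine le_sup_of_le_left (yImg_le_of_wtSpace_le ?_)
      rw [show (a + b - 2 * (j + 1 : ℕ) + 2 : ℤ) = a + b - 2 * j by push_cast; ring]
      exact (ih (by omega)).trans (genSub_mono (tGens a b) (Nat.le_succ (j + 1)))

theorem wtSpace_le_genSub (j : ℕ) :
    wtSpace (TW a b) (a + b - 2 * j) ≤ (genSub (tGens a b) (min a b + 1)).toSubmodule := by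
  induction j with
  | zero =>
    exact (wtSpace_le_genSub_of_le a b (Nat.zero_le _)).trans
      (genSub_mono (tGens a b) (by omega))
  | succ j ih =>
    by_cases hj : j + 1 ≤ min a b
    · exact (wtSpace_le_genSub_of_le a b hj).trans (genSub_mono (tGens a b) (by omega))
    · refine (wtSpace_le_yImg a b (by omega)).trans (yImg_le_of_wtSpace_le ?_)
      rw [show (a + b - 2 * (j + 1 : ℕ) + 2 : ℤ) = a + b - 2 * j by push_cast; ring]
      exact ih

theorem genSub_tGens_eq_top : genSub (tGens a b) (min a b + 1) = ⊤ := by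
  rw [← LieSubmodule.toSubmodule_inj, LieSubmodule.top_toSubmodule, eq_top_iff, ← iSup_aSpace]
  exact iSup_le fun j => (aSpace_le a b j).trans (wtSpace_le_genSub a b j)

/-- The elements `x ⊗ t^r` map the generators of index `j` to the previous weight space, which the
generators of smaller index generate. -/
theorem isWeylVecMod_tGens {j : ℕ} (hj : j ≤ min a b) (p : Box (a - j) (b - j) × MultN j) :
    IsWeylVecMod (genSub (tGens a b) j) (a + b - 2 * j) (tGens a b j p) where
  x_mem r := by
    have h := actOp_X_mem_wtSpace r (tGens_mem_wtSpace a b j p)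
    rcases j with _ | j
    · rw [wtSpace_tensor_eq_bot a b (Or.inr (by push_cast; omega)), Submodule.mem_bot] at h
      rw [h]; exact zero_mem _
    · rw [show (a + b - 2 * (j + 1 : ℕ) + 2 : ℤ) = a + b - 2 * j by push_cast; ring] at h
      exact wtSpace_le_genSub_of_le a b (by omega) h
  h_eq := by
    have h := tGens_mem_wtSpace a b j p
    rw [mem_wtSpace] at h
    rw [h]
    congr 1
    rw [Nat.cast_sub (by omega)]
    push_cast
    ring
  y_mem := by
    have h : ∀ k : ℕ, (actOp (TW a b) sl2Y 0 ^ k) (tGens a b j p) ∈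
        wtSpace (TW a b) (a + b - 2 * j - 2 * k) := by
      intro k
      induction k with
      | zero => simpa using tGens_mem_wtSpace a b j p
      | succ k ih =>
        rw [pow_succ', Module.End.mul_apply]
        refine actOp_Y_mem_wtSpace 0 ?_
        rwa [show (a + b - 2 * j - 2 * (k + 1 : ℕ) + 2 : ℤ) = a + b - 2 * j - 2 * k by
          push_cast; ring]
    refine ⟨a + b + 1, ?_⟩
    have h1 := h (a + b + 1)
    rw [wtSpace_tensor_eq_bot a b (Or.inl (by push_cast; omega)), Submodule.mem_bot] at h1
    rw [h1]; exact zero_mem _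

theorem finFib_tGensDeg (j : ℕ) : FinFib (tGensDeg a b j) :=
  have := Box.finite (a - j) (b - j)
  (FinFib.of_finite _).prod (finFib_multDeg j)

theorem genFun_tGensDeg {j : ℕ} (hj : j ≤ min a b) :
    genFun (tGensDeg a b j) = multSeries a b j := by
  have := Box.finite (a - j) (b - j)
  have h := multSeries_add (a - j) (b - j) j
  rw [Nat.sub_add_cancel (by omega), Nat.sub_add_cancel (by omega)] at h
  rw [h, ← genFun_multDeg]
  exact genFun_prod (FinFib.of_finite _) (finFib_multDeg j)

theorem isWeylGenerating_tGens : IsWeylGenerating (tensorGrading (weylGrading a) (weylGrading b))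
    (min a b) (fun j => a + b - 2 * j) (tGens a b) (tGensDeg a b) where
  hasDeg := hasDeg_tensor a b
  mem j _ := tGens_mem_grade a b j
  weyl _ hj := isWeylVecMod_tGens a b hj
  top := genSub_tGens_eq_top a b
  finFib := finFib_tGensDeg a b

theorem genFun_wDeg_eq_eval (n : ℕ) : genFun (wDeg (n := n)) = (rsPoly n).eval 1 := by
  rw [genFun_wDeg, rsPoly, Polynomial.eval_finsetSum, Finset.sum_range]
  exact Finset.sum_congr rfl fun k _ => by
    rw [Polynomial.eval_monomial, one_pow, mul_one]

/-- The graded dimensions are compared by setting the variable to one in the linearization formula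
for Rogers–Szegő polynomials. -/
theorem exists_weylFiltration_tensor :
    Nonempty (WeylFiltration (tensorGrading (weylGrading a) (weylGrading b))) := by
  refine (isWeylGenerating_tGens a b).exists_weylFiltration (isGradedBasis_tensor a b) ?_
  rw [genFun_prod (finFib_wDeg a) (finFib_wDeg b), genFun_wDeg_eq_eval, genFun_wDeg_eq_eval,
    ← Polynomial.eval_mul, rsPoly_mul_rsPoly, Polynomial.eval_finsetSum, Finset.sum_range]
  refine Finset.sum_congr rfl fun j _ => ?_
  rw [Polynomial.eval_mul, Polynomial.eval_mul, Polynomial.eval_pow, Polynomial.eval_X, one_pow,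
    one_mul, Polynomial.eval_C, genFun_tGensDeg a b (Nat.lt_succ_iff.1 j.2), genFun_wDeg_eq_eval]

theorem isIbdd_tensor : IsIbdd (tensorGrading (weylGrading a) (weylGrading b)) where
  isInternal := (isGradedBasis_tensor a b).isInternal
  lie_mem z r := hasDeg_tensor a b z r
  bddBelow := ⟨0, fun _ hp => (isGradedBasis_tensor a b).eq_bot hp⟩
  finiteDimensional := (isGradedBasis_tensor a b).finiteDimensional
  finite_weights := (isGradedBasis_tensor a b).finite_weights <|
    (Set.finite_Icc (-(a + b : ℤ)) (a + b)).subset <| by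
      rintro _ ⟨i, rfl⟩
      have h2 := neg_le_wWt i.1
      have h3 := neg_le_wWt i.2
      have h4 := wWt_le i.1
      have h5 := wWt_le i.2
      change -(a + b : ℤ) ≤ wWt i.1 + wWt i.2 ∧ wWt i.1 + wWt i.2 ≤ a + b
      constructor <;> omega

end

/-! ### Characters of global Weyl modules and their tensor products -/

/-- The series of dimensions of the homogeneous components of the weight space `W(n)_μ`. -/
def wtSeries (n : ℕ) (μ : ℤ) : ℤ⟦X⟧ := genFun fun i : {i : WIdx n // wWt i = μ} => wDeg i.1

theorem genFun_of_isEmpty {ι : Type*} [IsEmpty ι] (d : ι → ℕ) : genFun d = 0 := by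
  ext n
  simp [genFun]

theorem wtSeries_sub (n k : ℕ) : wtSeries n (n - 2 * k) = (rsPoly n).coeff k := by
  rw [coeff_rsPoly, oSub]
  split_ifs with hk
  · let f : MultN (n - k) × MultN k → {i : WIdx n // wWt i = n - 2 * k} := fun q =>
      ⟨⟨⟨k, Nat.lt_succ_of_le hk⟩, q⟩, rfl⟩
    have hf : Function.Bijective f := by
      constructor
      · intro q q' h
        exact eq_of_heq (Sigma.mk.inj (Subtype.ext_iff.1 h)).2
      · rintro ⟨⟨⟨l, hl⟩, q⟩, h⟩
        have h' : (n - 2 * l : ℤ) = n - 2 * k := h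
        obtain rfl : l = k := by omega
        exact ⟨q, rfl⟩
    rw [← genFun_multDeg, ← genFun_multDeg, mul_comm (genFun _),
      ← genFun_prod (finFib_multDeg _) (finFib_multDeg _)]
    exact (genFun_congr (Equiv.ofBijective f hf) fun q => rfl).symm
  · rw [mul_zero]
    have : IsEmpty {i : WIdx n // wWt i = n - 2 * k} := ⟨fun i => by
      have h1 := i.2
      have h2 := neg_le_wWt i.1
      omega⟩
    exact genFun_of_isEmpty _

theorem wtSeries_eq_zero {n : ℕ} {μ : ℤ} (h : ∀ k : ℕ, μ ≠ n - 2 * k) : wtSeries n μ = 0 := by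
  have : IsEmpty {i : WIdx n // wWt i = μ} := ⟨fun i => h i.1.1 i.2.symm⟩
  exact genFun_of_isEmpty _

theorem wtSeries_self (n : ℕ) : wtSeries n n = oneU n := by
  have := wtSeries_sub n 0
  rw [Nat.cast_zero, mul_zero, sub_zero] at this
  rw [this, coeff_rsPoly, oneU_zero, one_mul, oSub, if_pos (Nat.zero_le n), Nat.sub_zero]

theorem wtSeries_of_lt {n : ℕ} {μ : ℤ} (h : n < μ) : wtSeries n μ = 0 :=
  wtSeries_eq_zero fun k hk => by omega

theorem finFib_wtSeries (n : ℕ) (μ : ℤ) : FinFib fun i : {i : WIdx n // wWt i = μ} => wDeg i.1 :=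
  fun m => by
    have := finFib_wDeg n m
    exact Finite.of_injective (fun i => (⟨i.1.1, i.2⟩ : {i : WIdx n // wDeg i = m}))
      fun i j h => by
        have h' := congrArg Subtype.val h
        exact Subtype.ext (Subtype.ext h')

theorem chGr_weyl (n : ℕ) (μ : ℤ) :
    chGr (weylGrading n) μ = HahnSeries.ofPowerSeries ℤ ℤ (wtSeries n μ) :=
  (isGradedBasis_weyl n).chGr_eq μ

theorem genFun_tensor_fibre (a b : ℕ) (μ : ℤ) :
    genFun (fun p : {p : WIdx a × WIdx b // wWt p.1 + wWt p.2 = μ} => wDeg p.1.1 + wDeg p.1.2) =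
      ∑ k : Fin (a + 1), (rsPoly a).coeff k * wtSeries b (μ - (a - 2 * (k : ℕ))) := by
  let f : (Σ k : Fin (a + 1), (MultN (a - k) × MultN k) ×
      {i : WIdx b // wWt i = μ - (a - 2 * (k : ℕ))}) →
      {p : WIdx a × WIdx b // wWt p.1 + wWt p.2 = μ} := fun x =>
    ⟨(⟨x.1, x.2.1⟩, x.2.2.1), by
      change (a - 2 * (x.1 : ℕ) : ℤ) + wWt x.2.2.1 = μ
      rw [x.2.2.2]; ring⟩
  have hf : Function.Bijective f := by
    constructor
    · rintro ⟨k, q, i⟩ ⟨k', q', i'⟩ h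
      have h1 := Prod.ext_iff.1 (Subtype.ext_iff.1 h)
      have h2 : (⟨k, q⟩ : WIdx a) = ⟨k', q'⟩ := h1.1
      cases h2
      have h3 : i = i' := Subtype.ext h1.2
      rw [h3]
    · rintro ⟨⟨⟨k, q⟩, i⟩, h⟩
      have h' : (a - 2 * (k : ℕ) : ℤ) + wWt i = μ := h
      exact ⟨⟨k, q, ⟨i, by rw [← h']; ring⟩⟩, rfl⟩
  have hfin : ∀ k : Fin (a + 1), FinFib fun q : MultN (a - k) × MultN k =>
      multDeg q.1 + multDeg q.2 := fun k => (finFib_multDeg _).prod (finFib_multDeg _)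
  rw [← genFun_congr (Equiv.ofBijective f hf) (d := fun x =>
    (multDeg x.2.1.1 + multDeg x.2.1.2) + wDeg x.2.2.1) fun _ => rfl]
  refine (genFun_sigma fun k => (hfin k).prod (finFib_wtSeries b _)).trans
    (Finset.sum_congr rfl fun k _ => ?_)
  rw [genFun_prod (hfin k) (finFib_wtSeries b _), genFun_prod (finFib_multDeg _) (finFib_multDeg _),
    genFun_multDeg, genFun_multDeg, coeff_rsPoly, oSub, if_pos (Nat.lt_succ_iff.1 k.2), wtSeries,
    mul_comm (oneU _) (oneU _)]

/-- A coefficient of the linearization formula for Rogers–Szegő polynomials. -/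
theorem genFun_tensor_fibre_eq_sum (a b : ℕ) (μ : ℤ) :
    genFun (fun p : {p : WIdx a × WIdx b // wWt p.1 + wWt p.2 = μ} => wDeg p.1.1 + wDeg p.1.2) =
      ∑ j ∈ Finset.range (min a b + 1), multSeries a b j * wtSeries (a + b - 2 * j) μ := by
  rw [genFun_tensor_fibre]
  by_cases h : ∃ K : ℕ, μ = a + b - 2 * K
  · obtain ⟨K, rfl⟩ := h
    have h1 := congrArg (Polynomial.coeff · K) (rsPoly_mul_rsPoly a b)
    simp only [Polynomial.finsetSum_coeff] at h1
    have h2 : ∀ j ∈ Finset.range (min a b + 1),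
        (Polynomial.X ^ j * Polynomial.C (multSeries a b j) * rsPoly (a + b - 2 * j)).coeff K =
        multSeries a b j * wtSeries (a + b - 2 * j) (a + b - 2 * K) := by
      intro j hj
      rw [Finset.mem_range] at hj
      have hc : ((a + b - 2 * j : ℕ) : ℤ) = a + b - 2 * j := by omega
      rw [mul_assoc, Polynomial.coeff_X_pow_mul', Polynomial.coeff_C_mul]
      split_ifs with hjK
      · rw [← wtSeries_sub, hc]
        congr 2
        omega
      · rw [wtSeries_of_lt (by omega), mul_zero]
    rw [← Finset.sum_congr rfl h2, ← h1, Polynomial.coeff_mul,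
      Finset.Nat.sum_antidiagonal_eq_sum_range_succ_mk,
      Fin.sum_univ_eq_sum_range (fun k => (rsPoly a).coeff k *
        wtSeries b (a + b - 2 * K - (a - 2 * (k : ℕ)))) (a + 1),
      ← Finset.sum_subset (s₁ := Finset.range (min a K + 1)),
      ← Finset.sum_subset (s₁ := Finset.range (min a K + 1)) (s₂ := Finset.range (K + 1))]
    · refine Finset.sum_congr rfl fun k hk => ?_
      rw [Finset.mem_range] at hk
      rw [← wtSeries_sub b]
      congr 2
      omega
    · exact Finset.range_mono (by omega)
    · intro k hk hk'
      rw [Finset.mem_range] at hk hk'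
      rw [coeff_rsPoly, oSub_of_lt (by omega), mul_zero, zero_mul]
    · exact Finset.range_mono (by omega)
    · intro k hk hk'
      rw [Finset.mem_range] at hk hk'
      rw [wtSeries_of_lt (by omega), mul_zero]
  · rw [Finset.sum_eq_zero, Finset.sum_eq_zero]
    · intro j hj
      rw [Finset.mem_range] at hj
      rw [wtSeries_eq_zero, mul_zero]
      intro k hk
      exact h ⟨j + k, by omega⟩
    · intro k _
      rw [wtSeries_eq_zero, mul_zero]
      intro l hl
      exact h ⟨k + l, by push_cast; linarith⟩

theorem chGr_tensor (a b : ℕ) (μ : ℤ) : chGr (tensorGrading (weylGrading a) (weylGrading b)) μ =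
    HahnSeries.ofPowerSeries ℤ ℤ
      (∑ j ∈ Finset.range (min a b + 1), multSeries a b j * wtSeries (a + b - 2 * j) μ) := by
  rw [(isGradedBasis_tensor a b).chGr_eq, genFun_tensor_fibre_eq_sum]

/-- The series of dimensions of the weight spaces of the modules `W(n)` are linearly independent. -/
theorem eq_zero_of_sum_wtSeries {B : ℕ} {D : ℕ → ℤ⟦X⟧}
    (h : ∀ μ : ℤ, ∑ n ∈ Finset.range B, D n * wtSeries n μ = 0) {n : ℕ} (hn : n < B) : D n = 0 := by
  -- descending induction: only `W(n)` and the `W(m)` with `m > n` have the weight `n`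
  obtain ⟨m, hm⟩ : ∃ m, m = B - n := ⟨_, rfl⟩
  induction m using Nat.strong_induction_on generalizing n with
  | _ m ih =>
    have h1 := h n
    rw [Finset.sum_eq_single_of_mem n (Finset.mem_range.2 hn), wtSeries_self] at h1
    · refine (mul_eq_zero.1 h1).resolve_right fun h0 => ?_
      have := prod_mul_oneU n
      rw [h0, mul_zero] at this
      exact zero_ne_one this
    · intro l hl hne
      rw [Finset.mem_range] at hl
      rcases lt_or_gt_of_ne hne with hlt | hgt
      · rw [wtSeries_of_lt (by exact_mod_cast hlt), mul_zero]
      · rw [ih (B - l) (by omega) hl rfl, zero_mul]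

/-! ### The character of a module with a filtration by global Weyl modules -/

section

variable {V : Type} [AddCommGroup V] [Module ℂ V] [LieRingModule Sl2t V] [LieModule ℂ Sl2t V]
  {𝒱 : ℤ → Submodule ℂ V} {ι : Type} {c : Module.Basis ι ℂ V} {d : ι → ℕ} {wt : ι → ℤ}

/-- A homogeneous weight vector of a subquotient has a representative which is a weight vector of
the same degree. -/
theorem IsGradedBasis.exists_wt_lift (H : IsGradedBasis 𝒱 c d wt) {N N' : LieSubmodule ℂ Sl2t V}
    {r μ : ℤ} {x : N} (hx : (x : V) ∈ 𝒱 r) (hw : subClass N' x ∈ wtSpace (SubQuot N N') μ) :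
    ∃ y : N, (y : V) ∈ 𝒱 r ⊓ wtSpace V μ ∧ subClass N' y = subClass N' x := by
  have key : ∀ q : ℂ[X], ∃ y : N, (∀ i, c.repr (y : V) i = q.eval (wt i : ℂ) * c.repr (x : V) i) ∧
      subClass N' y = q.eval (μ : ℂ) • subClass N' x := by
    intro q
    induction q using Polynomial.induction_on with
    | C a =>
      refine ⟨a • x, fun i => ?_, ?_⟩
      · rw [Polynomial.eval_C, LieSubmodule.coe_smul, map_smul, Finsupp.smul_apply, smul_eq_mul]
      · rw [Polynomial.eval_C, subClass, map_smul, subClass]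
    | add p q hp hq =>
      obtain ⟨y, hy, hy'⟩ := hp
      obtain ⟨z, hz, hz'⟩ := hq
      refine ⟨y + z, fun i => ?_, ?_⟩
      · rw [LieSubmodule.coe_add, map_add, Finsupp.add_apply, hy, hz, Polynomial.eval_add, add_mul]
      · rw [Polynomial.eval_add, add_smul, ← hy', ← hz', subClass, map_add, subClass, subClass]
    | monomial m a h =>
      obtain ⟨y, hy, hy'⟩ := h
      refine ⟨⟨actOp V sl2H 0 y, N.lie_mem y.2⟩, fun i => ?_, ?_⟩
      · rw [H.repr_actOp_H, hy, pow_succ, ← mul_assoc (Polynomial.C a), Polynomial.eval_mul_X]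
        ring
      · rw [← actOp_subClass, hy', map_smul, mem_wtSpace.1 hw, pow_succ,
          ← mul_assoc (Polynomial.C a), Polynomial.eval_mul_X, mul_smul]
  -- interpolation between the finitely many weights occurring in `x`
  let S : Finset ℤ := insert μ ((c.repr (x : V)).support.image wt)
  obtain ⟨y, hy, hy'⟩ := key (Lagrange.basis S (fun i : ℤ => (i : ℂ)) μ)
  refine ⟨y, ⟨H.mem_grade.2 fun i hi => H.mem_grade.1 hx i fun h0 => hi ?_,
    H.mem_wt.2 fun i hi => ?_⟩, ?_⟩
  · rw [hy, h0, mul_zero]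
  · by_contra hne
    refine hi ?_
    rw [hy]
    by_cases h0 : c.repr (x : V) i = 0
    · rw [h0, mul_zero]
    · have hmem : wt i ∈ S := Finset.mem_insert_of_mem
        (Finset.mem_image_of_mem _ (Finsupp.mem_support_iff.2 h0))
      have := Lagrange.eval_basis_of_ne (v := fun i : ℤ => (i : ℂ)) (Ne.symm hne) hmem
      rw [this, zero_mul]
  · rw [hy']
    have := Lagrange.eval_basis_self (v := fun i : ℤ => (i : ℂ)) (s := S)
      (Int.cast_injective.injOn) (Finset.mem_insert_self μ _)
    rw [this, one_smul]

/-- Additivity of the dimensions of homogeneous weight spaces. -/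
theorem IsGradedBasis.finrank_add (H : IsGradedBasis 𝒱 c d wt) {N N' : LieSubmodule ℂ Sl2t V}
    (hN : N' ≤ N) (r μ : ℤ) :
    Module.finrank ℂ ↥(N.toSubmodule ⊓ (𝒱 r ⊓ wtSpace V μ)) =
      Module.finrank ℂ ↥(N'.toSubmodule ⊓ (𝒱 r ⊓ wtSpace V μ)) +
        Module.finrank ℂ ↥(subQuotGrading 𝒱 N N' r ⊓ wtSpace (SubQuot N N') μ) := by
  set A := N.toSubmodule ⊓ (𝒱 r ⊓ wtSpace V μ) with hA
  set A' := N'.toSubmodule ⊓ (𝒱 r ⊓ wtSpace V μ) with hA'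
  have : FiniteDimensional ℂ (𝒱 r) := H.finiteDimensional r
  have : FiniteDimensional ℂ A :=
    Submodule.finiteDimensional_of_le (inf_le_right.trans inf_le_left : A ≤ 𝒱 r)
  let φ : A →ₗ[ℂ] SubQuot N N' :=
    (LieSubmodule.Quotient.mk' (N'.comap N.incl) : N →ₗ[ℂ] SubQuot N N').comp
      (Submodule.inclusion (inf_le_left : A ≤ N.toSubmodule))
  have hφ : ∀ x : A, φ x = subClass N' ⟨x, x.2.1⟩ := fun _ => rfl
  have hker : LinearMap.ker φ = A'.comap A.subtype := by
    ext x
    rw [LinearMap.mem_ker, hφ, subClass_eq_zero, Submodule.mem_comap]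
    exact ⟨fun h => ⟨h, x.2.2⟩, fun h => h.1⟩
  have hrange : LinearMap.range φ = subQuotGrading 𝒱 N N' r ⊓ wtSpace (SubQuot N N') μ := by
    apply le_antisymm
    · rintro _ ⟨x, rfl⟩
      refine ⟨⟨⟨x, x.2.1⟩, x.2.2.1, rfl⟩, ?_⟩
      change _ ∈ wtSpace _ μ
      rw [hφ, mem_wtSpace, actOp_subClass, subClass, subClass, ← map_smul]
      congr 1
      exact Subtype.ext x.2.2.2
    · rintro _ ⟨⟨x, hx, rfl⟩, hw⟩
      obtain ⟨y, hy, e⟩ := H.exists_wt_lift (N' := N') hx hw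
      exact ⟨⟨y, y.2, hy⟩, e⟩
  have hle : A' ≤ A := inf_le_inf_right _ hN
  rw [← LinearMap.finrank_range_add_finrank_ker φ, hker, hrange, add_comm]
  congr 1
  exact (Submodule.comapSubtypeEquivOfLe hle).finrank_eq

theorem GradedIso.finrank_eq {Q W : Type} [AddCommGroup Q] [Module ℂ Q] [LieRingModule Sl2t Q]
    [LieModule ℂ Sl2t Q] [AddCommGroup W] [Module ℂ W] [LieRingModule Sl2t W] [LieModule ℂ Sl2t W]
    {𝒬 : ℤ → Submodule ℂ Q} {𝒲 : ℤ → Submodule ℂ W} (h : GradedIso 𝒬 𝒲) (r μ : ℤ) :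
    Module.finrank ℂ ↥(𝒬 r ⊓ wtSpace Q μ) = Module.finrank ℂ ↥(𝒲 r ⊓ wtSpace W μ) := by
  obtain ⟨e, he⟩ := h
  have hw : ∀ v, v ∈ wtSpace Q μ ↔ e v ∈ wtSpace W μ := by
    intro v
    have h1 : e (actOp Q sl2H 0 v) = actOp W sl2H 0 (e v) := map_actOp e.toLieModuleHom sl2H 0 v
    have h2 : e ((μ : ℂ) • v) = (μ : ℂ) • e v := map_smul e.toLinearEquiv _ _
    rw [mem_wtSpace, mem_wtSpace, ← h1, ← h2, e.injective.eq_iff]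
  have hmap : 𝒲 r ⊓ wtSpace W μ =
      (𝒬 r ⊓ wtSpace Q μ).map (e.toLinearEquiv : Q →ₗ[ℂ] W) := by
    ext w
    constructor
    · intro hv
      refine ⟨e.symm w, ⟨(he r _).2 ?_, (hw _).2 ?_⟩, e.apply_symm_apply w⟩
      · rw [e.apply_symm_apply]; exact hv.1
      · rw [e.apply_symm_apply]; exact hv.2
    · rintro ⟨v, hv, rfl⟩
      exact ⟨(he r v).1 hv.1, (hw v).1 hv.2⟩
  rw [hmap]
  exact (LinearEquiv.finrank_map_eq e.toLinearEquiv _).symm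

theorem isGradedBasis_directSum {κ : Type} {n : ℕ} {p : κ → ℤ} {e : κ → ℕ} (hp : ∀ i, p i = e i)
    (he : FinFib e) :
    IsGradedBasis (directSumGrading fun i : κ => shift (p i) (weylGrading n)) (directSumBasis κ n)
      (fun q => e q.1 + wDeg q.2) (fun q => wWt q.2) where
  finFib := he.prod (finFib_wDeg n)
  grade r := by
    ext v
    rw [mem_directSumGrading, Module.Basis.mem_span_image]
    constructor
    · intro h q hq
      have hq' : (directSumBasis κ n).repr v q ≠ 0 := Finsupp.mem_support_iff.1 hq
      have := h q.1 q.2 hq'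
      rw [hp] at this
      change ((e q.1 + wDeg q.2 : ℕ) : ℤ) = r
      omega
    · intro h i β hne
      have hne' : (directSumBasis κ n).repr v (i, β) ≠ 0 := hne
      have : ((e i + wDeg β : ℕ) : ℤ) = r := h (Finsupp.mem_support_iff.2 hne')
      rw [hp]
      omega
  wt_mem q := by
    classical
    rw [directSumBasis_apply, mem_wtSpace]
    have h1 := map_actOp (DirectSum.lieModuleOf ℂ κ Sl2t (fun _ => Weyl n) q.1) sl2H 0
      (weylBasis n q.2)
    rw [mem_wtSpace.1 ((isGradedBasis_weyl n).wt_mem q.2), map_smul] at h1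
    exact h1.symm

theorem sum_of_succ {m : ℕ} (f : Fin (m + 1) → ℕ) (Q : Fin m → ℕ)
    (h : ∀ s, f s.castSucc = f s.succ + Q s) : f 0 = f (Fin.last m) + ∑ s, Q s := by
  induction m with
  | zero => simp
  | succ m ih =>
    have h1 := ih (fun s => f s.succ) (fun s => Q s.succ) fun s => h s.succ
    have h2 := h 0
    rw [Fin.castSucc_zero] at h2
    rw [Fin.sum_univ_succ, h2, h1, Fin.succ_last]
    ring

theorem weylGen_ne_zero (n : ℕ) : weylGen n ≠ 0 := fun h => by
  have := toModel_gen n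
  rw [h, map_zero] at this
  exact pow_ne_zero n (MvPolynomial.X_ne_zero _) this.symm

namespace WeylFiltration

/-- A summand `W(n, p)` has a non-zero vector of degree `p`, and `V` has none for `p < 0`. -/
theorem nonneg_of_m_ne_zero (F : WeylFiltration 𝒱) (H : IsGradedBasis 𝒱 c d wt) {s : Fin (F.k + 1)}
    {p : ℤ} (i : Fin (F.m s p)) : 0 ≤ p := by
  classical
  by_contra hp
  obtain ⟨e, he⟩ := F.iso s
  let w : ⨁ _ : (Σ p : ℤ, Fin (F.m s p)), Weyl (F.wt s) :=
    DirectSum.lof ℂ _ (fun _ => Weyl (F.wt s)) ⟨p, i⟩ (weylGen (F.wt s))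
  have hw : w ∈ directSumGrading (fun i : (Σ p : ℤ, Fin (F.m s p)) =>
      shift i.1 (weylGrading (F.wt s))) p := by
    rw [directSumGrading, Submodule.mem_iInf]
    intro j
    rw [Submodule.mem_comap]
    by_cases hj : j = ⟨p, i⟩
    · subst hj
      rw [DirectSum.component.lof_self, shift, sub_self]
      exact weylGen_mem _
    · rw [DirectSum.component.of, dif_neg (Ne.symm hj)]
      exact zero_mem _
  have h1 := (he p (e.symm w)).2 (by rw [e.apply_symm_apply]; exact hw)
  rw [subQuotGrading, H.eq_bot (not_le.1 hp)] at h1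
  obtain ⟨x, hx, hx'⟩ := h1
  have hx0 : x = 0 := Subtype.ext hx
  rw [hx0, map_zero] at hx'
  have h2 : w = 0 := by rw [← e.apply_symm_apply w, ← hx', map_zero]
  have h3 : weylGen (F.wt s) = 0 := by
    have := congrArg (DirectSum.component ℂ _ (fun _ => Weyl (F.wt s)) ⟨p, i⟩) h2
    rwa [DirectSum.component.lof_self, map_zero] at this
  exact weylGen_ne_zero _ h3

/-- The multiplicities in a step of the filtration, as a series. -/
def series (F : WeylFiltration 𝒱) (s : Fin (F.k + 1)) : ℤ⟦X⟧ :=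
  PowerSeries.mk fun r => (F.m s r : ℤ)

theorem finrank_subQuot (F : WeylFiltration 𝒱) (H : IsGradedBasis 𝒱 c d wt) (s : Fin (F.k + 1))
    (r : ℕ) (μ : ℤ) : (Module.finrank ℂ ↥(subQuotGrading 𝒱 (F.N s.castSucc) (F.N s.succ) r ⊓
      wtSpace (SubQuot (F.N s.castSucc) (F.N s.succ)) μ) : ℤ) =
      PowerSeries.coeff r (F.series s * wtSeries (F.wt s) μ) := by
  have hp : ∀ i : (Σ p : ℤ, Fin (F.m s p)), i.1 = (i.1.toNat : ℤ) := fun i =>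
    (Int.toNat_of_nonneg (F.nonneg_of_m_ne_zero H i.2)).symm
  have hequiv : ∀ m : ℕ,
      Nonempty ({i : (Σ p : ℤ, Fin (F.m s p)) // i.1.toNat = m} ≃ Fin (F.m s m)) := by
    intro m
    let f : Fin (F.m s m) → {i : (Σ p : ℤ, Fin (F.m s p)) // i.1.toNat = m} := fun x =>
      ⟨⟨m, x⟩, Int.toNat_natCast m⟩
    refine ⟨(Equiv.ofBijective f ⟨fun x y h => ?_, ?_⟩).symm⟩
    · exact eq_of_heq (Sigma.mk.inj (Subtype.mk.inj h)).2
    · rintro ⟨⟨p, x⟩, h⟩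
      have h' : p.toNat = m := h
      have h'' : p = p.toNat := hp ⟨p, x⟩
      rw [h'] at h''
      subst h''
      exact ⟨x, rfl⟩
  have hfin : FinFib fun i : (Σ p : ℤ, Fin (F.m s p)) => i.1.toNat := fun m => by
    obtain ⟨f⟩ := hequiv m
    exact Finite.of_equiv _ f.symm
  have hgen : genFun (fun i : (Σ p : ℤ, Fin (F.m s p)) => i.1.toNat) = F.series s := by
    ext m
    obtain ⟨f⟩ := hequiv m
    rw [genFun, series, PowerSeries.coeff_mk, PowerSeries.coeff_mk, Nat.card_congr f, Nat.card_fin]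
  have HD := isGradedBasis_directSum (n := F.wt s) hp hfin
  rw [(F.iso s).finrank_eq, HD.finrank_inf, ← hgen, wtSeries,
    ← genFun_prod hfin (finFib_wtSeries _ _), genFun, PowerSeries.coeff_mk]
  congr 1
  exact Nat.card_congr
    { toFun := fun i => ⟨(i.1.1, ⟨i.1.2, i.2.2⟩), by exact_mod_cast i.2.1⟩
      invFun := fun i => ⟨(i.1.1, i.1.2.1), by exact_mod_cast i.2, i.1.2.2⟩
      left_inv := fun _ => rfl
      right_inv := fun _ => rfl }

theorem chGr_eq (F : WeylFiltration 𝒱) (H : IsGradedBasis 𝒱 c d wt) (μ : ℤ) :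
    chGr 𝒱 μ = HahnSeries.ofPowerSeries ℤ ℤ (∑ s, F.series s * wtSeries (F.wt s) μ) := by
  rw [H.chGr_eq]
  congr 1
  ext r
  have h1 := H.finrank_inf r μ
  have h2 := sum_of_succ (fun s => Module.finrank ℂ ↥((F.N s).toSubmodule ⊓ (𝒱 r ⊓ wtSpace V μ))) _
    fun s => H.finrank_add (F.antitone s.castSucc_lt_succ.le) r μ
  beta_reduce at h2
  rw [F.first, F.last, LieSubmodule.bot_toSubmodule, LieSubmodule.top_toSubmodule, bot_inf_eq,
    top_inf_eq, finrank_bot, zero_add, h1] at h2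
  rw [map_sum, genFun, PowerSeries.coeff_mk]
  have h3 : Nat.card {i : {i // wt i = μ} // d i = r} = Nat.card {i // (d i : ℤ) = r ∧ wt i = μ} :=
    Nat.card_congr
      { toFun := fun i => ⟨i.1.1, by exact_mod_cast i.2, i.1.2⟩
        invFun := fun i => ⟨⟨i.1, i.2.2⟩, by exact_mod_cast i.2.1⟩
        left_inv := fun _ => rfl
        right_inv := fun _ => rfl }
  rw [h3, h2, Nat.cast_sum]
  exact Finset.sum_congr rfl fun s _ => F.finrank_subQuot H s r μ

end WeylFiltration

end

/-! ### The multiplicities in a filtration of `W(a) ⊗ W(b)` -/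

section

variable {V : Type} [AddCommGroup V] [Module ℂ V] [LieRingModule Sl2t V] [LieModule ℂ Sl2t V]
  {𝒱 : ℤ → Submodule ℂ V} {ι : Type} {c : Module.Basis ι ℂ V} {d : ι → ℕ} {wt : ι → ℤ}

/-- The multiplicity of `W(n)` in a filtration, as a series. -/
def WeylFiltration.multSer (F : WeylFiltration 𝒱) (n : ℕ) : ℤ⟦X⟧ :=
  ∑ s, if F.wt s = n then F.series s else 0

theorem WeylFiltration.coeff_multSer (F : WeylFiltration 𝒱) (n r : ℕ) :
    PowerSeries.coeff r (F.multSer n) = F.mult n r := by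
  rw [multSer, mult, map_sum, Nat.cast_sum]
  refine Finset.sum_congr rfl fun s _ => ?_
  split_ifs
  · rw [series, PowerSeries.coeff_mk]
  · rw [map_zero, Nat.cast_zero]

theorem WeylFiltration.mult_eq_coeff (F : WeylFiltration 𝒱) (H : IsGradedBasis 𝒱 c d wt) (n : ℕ)
    (p : ℤ) : (F.mult n p : ℤ) =
      HahnSeries.coeff (HahnSeries.ofPowerSeries ℤ ℤ (F.multSer n)) p := by
  rw [PowerSeries.coeff_coe]
  split_ifs with hp
  · rw [Nat.cast_eq_zero, mult]
    refine Finset.sum_eq_zero fun s _ => ?_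
    split_ifs
    · by_contra hne
      have := F.nonneg_of_m_ne_zero H ⟨0, Nat.pos_of_ne_zero hne⟩
      omega
    · rfl
  · rw [F.coeff_multSer, Int.natAbs_of_nonneg (not_lt.1 hp)]

/-- The multiplicities are determined by the character. -/
theorem WeylFiltration.multSer_eq (F : WeylFiltration 𝒱) (H : IsGradedBasis 𝒱 c d wt) {κ : Type}
    (s : Finset κ) (M : κ → ℤ⟦X⟧) (w : κ → ℕ)
    (h : ∀ μ, chGr 𝒱 μ = HahnSeries.ofPowerSeries ℤ ℤ (∑ j ∈ s, M j * wtSeries (w j) μ)) (n : ℕ) :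
    F.multSer n = ∑ j ∈ s, if w j = n then M j else 0 := by
  classical
  let B := n + 1 + ∑ s, F.wt s + ∑ j ∈ s, w j
  have hn : n < B := by omega
  have hF : ∀ t, F.wt t < B := fun t => by
    have := Finset.single_le_sum (f := F.wt) (fun _ _ => Nat.zero_le _) (Finset.mem_univ t)
    omega
  have hw : ∀ j ∈ s, w j < B := fun j hj => by
    have := Finset.single_le_sum (f := w) (fun _ _ => Nat.zero_le _) hj
    omega
  have aux : ∀ (κ : Type) (s : Finset κ) (M : κ → ℤ⟦X⟧) (w : κ → ℕ) (μ : ℤ), (∀ j ∈ s, w j < B) →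
      ∑ m ∈ Finset.range B, (∑ j ∈ s, if w j = m then M j else 0) * wtSeries m μ =
        ∑ j ∈ s, M j * wtSeries (w j) μ := by
    intro κ s M w μ hw
    simp only [Finset.sum_mul, ite_mul, zero_mul]
    rw [Finset.sum_comm]
    refine Finset.sum_congr rfl fun j hj => ?_
    rw [Finset.sum_ite_eq, if_pos (Finset.mem_range.2 (hw j hj))]
  have h0 := eq_zero_of_sum_wtSeries (B := B)
    (D := fun m => F.multSer m - ∑ j ∈ s, if w j = m then M j else 0) (fun μ => ?_) hn
  · exact sub_eq_zero.1 h0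
  · simp only [sub_mul, Finset.sum_sub_distrib, multSer]
    rw [aux _ s M w μ hw, aux _ Finset.univ F.series F.wt μ fun t _ => hF t, sub_eq_zero]
    exact HahnSeries.ofPowerSeries_injective ((F.chGr_eq H μ).symm.trans (h μ))

end

/-- The numerator of the `q`-binomial coefficient vanishes, or its lower index is negative. -/
theorem multSeries_eq_zero {a b j : ℕ} (h : min a b < j) (hj : 2 * j ≤ a + b) :
    multSeries a b j = 0 := by
  rw [multSeries, qBinom]
  split_ifs with h0
  · rw [zero_mul]
  · rw [Finset.prod_eq_zero (i := a + b - 2 * j), zero_mul, zero_mul]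
    · rw [Finset.mem_range]; omega
    · rw [Nat.sub_self, pow_zero, sub_self]

theorem multSer_tensor {a b : ℕ}
    (F : WeylFiltration (tensorGrading (weylGrading a) (weylGrading b))) (n : ℕ) : F.multSer n =
      ∑ j ∈ Finset.range (min a b + 1), if a + b - 2 * j = n then multSeries a b j else 0 :=
  F.multSer_eq (isGradedBasis_tensor a b) _ _ _ (chGr_tensor a b) n

theorem multSer_tensor_sub {a b ν : ℕ}
    (F : WeylFiltration (tensorGrading (weylGrading a) (weylGrading b))) (hν : 2 * ν ≤ a + b) :
    F.multSer (a + b - 2 * ν) = multSeries a b ν := by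
  rw [multSer_tensor]
  by_cases h : ν ≤ min a b
  · rw [Finset.sum_eq_single_of_mem ν (Finset.mem_range.2 (by omega)), if_pos rfl]
    intro j hj hne
    rw [Finset.mem_range] at hj
    exact if_neg (by omega)
  · rw [multSeries_eq_zero (not_le.1 h) hν]
    refine Finset.sum_eq_zero fun j hj => ?_
    rw [Finset.mem_range] at hj
    exact if_neg (by omega)

theorem multSer_tensor_eq_zero {a b n : ℕ}
    (F : WeylFiltration (tensorGrading (weylGrading a) (weylGrading b)))
    (hn : ∀ ν : ℕ, n + 2 * ν ≠ a + b) : F.multSer n = 0 := by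
  rw [multSer_tensor]
  refine Finset.sum_eq_zero fun j hj => ?_
  rw [Finset.mem_range] at hj
  exact if_neg fun h => hn j (by omega)

end CurrentSl2

end

open CurrentSl2
theorem mainTheorem6 (a b : ℕ) :
    IsIbdd (tensorGrading (weylGrading a) (weylGrading b)) ∧
    Nonempty (WeylFiltration (tensorGrading (weylGrading a) (weylGrading b))) ∧
    (∀ F : WeylFiltration (tensorGrading (weylGrading a) (weylGrading b)),
      (∀ ν : ℕ, 2 * ν ≤ a + b → ∀ p : ℤ,
        (F.mult (a + b - 2 * ν) p : ℤ) =
          HahnSeries.coeff (HahnSeries.ofPowerSeries ℤ ℤ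
            (qBinom (a + b - 2 * ν) ((b : ℤ) - ν) * oneU ν)) p) ∧
      (∀ n : ℕ, (∀ ν : ℕ, n + 2 * ν ≠ a + b) → ∀ p : ℤ, F.mult n p = 0)) ∧
    (∀ μ : ℤ,
      chGr (tensorGrading (weylGrading a) (weylGrading b)) μ =
        ∑ ν ∈ Finset.range (min a b + 1),
          HahnSeries.ofPowerSeries ℤ ℤ (qBinom (a + b - 2 * ν) ((b : ℤ) - ν) * oneU ν) *
            chGr (weylGrading (a + b - 2 * ν)) μ) := by
  have H := isGradedBasis_tensor a b
  refine ⟨isIbdd_tensor a b, exists_weylFiltration_tensor a b,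
    fun F => ⟨fun ν hν p => ?_, fun n hn p => ?_⟩, fun μ => ?_⟩
  · rw [F.mult_eq_coeff H, multSer_tensor_sub F hν, multSeries]
  · have h := F.mult_eq_coeff H n p
    rw [multSer_tensor_eq_zero F hn, map_zero, HahnSeries.coeff_zero] at h
    exact_mod_cast h
  · rw [chGr_tensor, map_sum]
    refine Finset.sum_congr rfl fun ν _ => ?_
    rw [chGr_weyl, map_mul, multSeries]
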